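/- For $\tau\in\mathbb C\setminus\mathbb R$ put $b=\sqrt\tau$ (principal branch), $c_b=\frac{i}{2}(b+b^{-1})$, $q=e^{2\pi i\tau}$, $\tilde q=e^{-2\pi i/\tau}$, and write $(q/\tilde q)^r=e^{2\pi i r(\tau+1/\tau)}$, $q^{1/2}=e^{\pi i\tau}$, $\tilde q^{1/2}=e^{-\pi i/\tau}$. Let $(x;q)_m=\prod_{k=0}^{m-1}(1-q^kx)$, and let $(x;q)_\infty=\prod_{k\ge 0}(1-q^kx)$ for $|q|<1$, $(x;q)_\infty=1/(q^{-1}x;q^{-1})_\infty$ for $|q|>1$. Let $$\Phi_b(x)=\frac{(-q^{1/2}e^{2\pi bx};q)_\infty}{(-\tilde q^{1/2}e^{2\pi b^{-1}x};\tilde q)_\infty}$$ be Faddeev's quantum dilogarithm, and let $$Z_{(-2,3,7)}(\tau)=\Big(\frac q{\tilde q}\Big)^{-1/24}\int_{\mathbb R+c_b/2+i\varepsilon}\Phi_b(x)^2\,\Phi_b(2x-c_b)\,e^{-\pi i(2x-c_b)^2}\,dx$$ be the Andersen--Kashaev state integral of the $(-2,3,7)$ pretzel knot (up to prefactors), where $0<\varepsilon<\frac14\operatorname{Re}(b+b^{-1})$.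 For $0<|q|<1$ let $\mathcal E_2(q)=1-24\sum_{n\ge1}\frac{q^n}{(1-q^n)^2}$ and define $H_j^\pm(q)$, $j=0,1,2$, by the expansions at $\varepsilon=0$ $$\frac{(qe^\varepsilon;q)_\infty^2(qe^{2\varepsilon};q)_\infty}{(q;q)_\infty^3}\sum_{m\ge0}\frac{q^{m(2m+1)}e^{\varepsilon(4m+1)}}{(qe^\varepsilon;q)_m^2(qe^{2\varepsilon};q)_{2m}}=H_0^++\varepsilon H_1^++\tfrac{\varepsilon^2}2\big(H_2^++\tfrac13\mathcal E_2H_0^+\big)+O(\varepsilon^3),$$ $$\frac{(q;q)_\infty^3}{(qe^{-\varepsilon};q)_\infty^2(qe^{-2\varepsilon};q)_\infty}\sum_{n\ge0}\frac{q^{n(n+1)}e^{\varepsilon(2n+1)}}{(qe^\varepsilon;q)_n^2(qe^{2\varepsilon};q)_{2n}}=H_0^-+\varepsilon H_1^-+\tfrac{\varepsilon^2}2\big(H_2^-+(\tfrac12-\tfrac13\mathcal E_2)H_0^-\big)+O(\varepsilon^3),$$ and further $$H_3^+=\frac{(q^{3/2};q)_\infty^2}{(q;q)_\infty^2}\sum_{m\ge0}\frac{q^{(2m+1)(m+1)}}{(q^{3/2};q)_m^2(q;q)_{2m+1}},\qquad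 H_3^-=\frac{(q;q)_\infty^2}{(q^{-1/2};q)_\infty^2}\sum_{n\ge0}\frac{q^{n(n+2)}}{(q^{3/2};q)_n^2(q;q)_{2n+1}},$$ $$H_4^+=\frac{(-q;q)_\infty^2}{(q;q)_\infty^2}\sum_{m\ge0}\frac{q^{(2m+1)m}}{(-q;q)_m^2(q;q)_{2m}},\qquad H_4^-=\frac{(q;q)_\infty^2}{(-1;q)_\infty^2}\sum_{n\ge0}\frac{q^{n(n+1)}}{(-q;q)_n^2(q;q)_{2n}},$$ with $H_5^\pm$ obtained from $H_3^\pm$ by replacing $q^{3/2}$, $q^{-1/2}$ by $-q^{3/2}$, $-q^{-1/2}$. Put $h_j(\tau)=(\pm1)^{\delta_j}H_j^\pm(e^{\pm2\pi i\tau})$ for $\pm\operatorname{Im}\tau>0$, with $(\delta_0,\dots,\delta_5)=(0,1,2,0,0,0)$, where half-integral powers are formed with $q^{1/2}=e^{\pm\pi i\tau}$. **Proposition.** For every $\tau\in\mathbb C\setminus\mathbb R$ and every such $\varepsilon$ the integral converges absolutely, and $$2e^{\pi i/4}\Big(\frac q{\tilde q}\Big)^{1/24}Z_{(-2,3,7)}(\tau)=-\frac1{2\tau}h_0(\tau)h_2(\tau^{-1})-h_1(\tau)h_1(\tau^{-1})-\frac\tau2h_2(\tau)h_0(\tau^{-1})+R(\tau),$$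 where $$R(\tau)=\begin{cases}\frac1\tau\big(h_3(\tau)h_4(\tau^{-1})-h_4(\tau)h_3(\tau^{-1})+h_5(\tau)h_5(\tau^{-1})\big)&\operatorname{Im}\tau>0,\\[2pt] \tau\big(h_4(\tau)h_3(\tau^{-1})-h_3(\tau)h_4(\tau^{-1})+h_5(\tau)h_5(\tau^{-1})\big)&\operatorname{Im}\tau<0.\end{cases}$$ Moreover the $H_j^\pm$ are power series in $q^{1/2}$, convergent for $|q|<1$, which begin $$\begin{aligned} H_0^+&=1+q^3+3q^4+7q^5+13q^6+\cdots,& H_0^-&=1+q^2+3q^3+7q^4+13q^5+\cdots,\\ H_1^+&=1-4q-8q^2-3q^3+3q^4+\cdots,& H_1^-&=1-4q-5q^2+q^3+7q^4+\cdots,\\ H_2^+&=\tfrac23-6q+6q^2+\tfrac{242}3q^3+200q^4+\cdots,& H_2^-&=\tfrac56-10q+\tfrac{17}6q^2+\tfrac{141}2q^3+\tfrac{971}6q^4+\cdots,\\ H_3^+&=q+3q^2-2q^{5/2}+8q^3-8q^{7/2}+\cdots,& H_3^-&=q+4q^{3/2}+9q^2+18q^{5/2}+31q^3+\cdots,\\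 H_4^+&=1+4q+12q^2+33q^3+79q^4+\cdots,& H_4^-&=\tfrac14-q+\tfrac54q^2-\tfrac54q^3+\tfrac{15}4q^4+\cdots,\\ H_5^+&=q+3q^2+2q^{5/2}+8q^3+8q^{7/2}+\cdots,& H_5^-&=q-4q^{3/2}+9q^2-18q^{5/2}+31q^3+\cdots. \end{aligned}$$ -/

import Mathlib

open Complex MeasureTheory

noncomputable section

namespace PretzelKnot

/-- The finite q-Pochhammer symbol `(x; q)_m = (1 - x)(1 - q x) ⋯ (1 - q^(m-1) x)`. -/
def qPoch (x q : ℂ) (m : ℕ) : ℂ := ∏ k ∈ Finset.range m, (1 - x * q ^ k)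

/-- The infinite q-Pochhammer symbol `(x; q)_∞`: the product of the `1 - x q^k`, `k ≥ 0`, for
`|q| < 1`, and the customary extension `(x; q)_∞ = 1 / (q⁻¹ x; q⁻¹)_∞` for `|q| > 1`. -/
def qPochInf (x q : ℂ) : ℂ :=
  if ‖q‖ < 1 then ∏' k : ℕ, (1 - x * q ^ k) else (∏' k : ℕ, (1 - x * q⁻¹ * q⁻¹ ^ k))⁻¹

/-- The quasimodular Eisenstein series of weight 2, `1 - 24 ∑_{n ≥ 1} q^n / (1 - q^n)^2`. -/
def E₂ (q : ℂ) : ℂ := 1 - 24 * ∑' n : ℕ, q ^ (n + 1) / (1 - q ^ (n + 1)) ^ 2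

/-! ### The state integral -/

/-- Faddeev's quantum dilogarithm `Φ_b(x)`, for `b ^ 2` not real, with `q = exp(2πi b²)`,
`q^(1/2) = exp(πi b²)`, `q̃ = exp(-2πi b⁻²)` and `q̃^(1/2) = exp(-πi b⁻²)`. -/
def faddeev (b x : ℂ) : ℂ :=
  qPochInf (-(exp (Real.pi * I * b ^ 2) * exp (2 * Real.pi * b * x)))
      (exp (2 * Real.pi * I * b ^ 2)) /
    qPochInf (-(exp (-(Real.pi * I / b ^ 2)) * exp (2 * Real.pi * b⁻¹ * x)))
      (exp (-(2 * Real.pi * I / b ^ 2)))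

/-- `b = √τ`, the principal branch on the plane cut along `(-∞, 0]`. -/
def bOf (τ : ℂ) : ℂ := τ ^ (1 / 2 : ℂ)

/-- `c_b = (i/2) (b + b⁻¹)` for `b = √τ`. -/
def cb (τ : ℂ) : ℂ := I / 2 * (bOf τ + (bOf τ)⁻¹)

/-- The integrand `Φ_b(x)² Φ_b(2x - c_b) exp(-πi (2x - c_b)²)`. -/
def integrand (τ x : ℂ) : ℂ :=
  faddeev (bOf τ) x ^ 2 * faddeev (bOf τ) (2 * x - cb τ) *
    exp (-(Real.pi * I * (2 * x - cb τ) ^ 2))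

/-- The point with parameter `t` on the horizontal contour `ℝ + c_b / 2 + iε`. -/
def contour (τ : ℂ) (ε t : ℝ) : ℂ := t + cb τ / 2 + I * ε

/-- `(q / q̃)^r = exp(2πi r (τ + 1/τ))`. -/
def qRatioPow (τ : ℂ) (r : ℝ) : ℂ := exp (2 * Real.pi * I * r * (τ + τ⁻¹))

/-- The state integral of the `(-2,3,7)` pretzel knot, along the contour `ℝ + c_b / 2 + iε`. -/
def stateIntegral (ε : ℝ) (τ : ℂ) : ℂ :=
  qRatioPow τ (-(1 / 24)) * ∫ t : ℝ, integrand τ (contour τ ε t)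

/-! ### The twelve q-series -/

/-- The `ε`-deformed series whose Taylor expansion at `ε = 0` defines `H₀⁺, H₁⁺, H₂⁺`. -/
def Fplus (q ε : ℂ) : ℂ :=
  qPochInf (q * exp ε) q ^ 2 * qPochInf (q * exp (2 * ε)) q / qPochInf q q ^ 3 *
    ∑' m : ℕ, q ^ (m * (2 * m + 1)) * exp (ε * (4 * m + 1)) /
      (qPoch (q * exp ε) q m ^ 2 * qPoch (q * exp (2 * ε)) q (2 * m))

/-- The `ε`-deformed series whose Taylor expansion at `ε = 0` defines `H₀⁻, H₁⁻, H₂⁻`. -/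
def Fminus (q ε : ℂ) : ℂ :=
  qPochInf q q ^ 3 / (qPochInf (q * exp (-ε)) q ^ 2 * qPochInf (q * exp (-(2 * ε))) q) *
    ∑' n : ℕ, q ^ (n * (n + 1)) * exp (ε * (2 * n + 1)) /
      (qPoch (q * exp ε) q n ^ 2 * qPoch (q * exp (2 * ε)) q (2 * n))

/-- The series `H_j⁺`, `j = 0, …, 5`, as functions of `s = q^(1/2)`. The first three are given by
`Fplus q ε = H₀⁺ + ε H₁⁺ + (ε²/2) (H₂⁺ + E₂/3 · H₀⁺) + O(ε³)`. -/
def Hplus (s : ℂ) : Fin 6 → ℂ :=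
  let q := s ^ 2
  ![Fplus q 0,
    deriv (Fplus q) 0,
    iteratedDeriv 2 (Fplus q) 0 - 1 / 3 * E₂ q * Fplus q 0,
    qPochInf (s ^ 3) q ^ 2 / qPochInf q q ^ 2 *
      ∑' m : ℕ, q ^ ((2 * m + 1) * (m + 1)) / (qPoch (s ^ 3) q m ^ 2 * qPoch q q (2 * m + 1)),
    qPochInf (-q) q ^ 2 / qPochInf q q ^ 2 *
      ∑' m : ℕ, q ^ ((2 * m + 1) * m) / (qPoch (-q) q m ^ 2 * qPoch q q (2 * m)),
    qPochInf (-s ^ 3) q ^ 2 / qPochInf q q ^ 2 *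
      ∑' m : ℕ, q ^ ((2 * m + 1) * (m + 1)) / (qPoch (-s ^ 3) q m ^ 2 * qPoch q q (2 * m + 1))]

/-- The series `H_j⁻`, `j = 0, …, 5`, as functions of `s = q^(1/2)`. The first three are given by
`Fminus q ε = H₀⁻ + ε H₁⁻ + (ε²/2) (H₂⁻ + (1/2 - E₂/3) H₀⁻) + O(ε³)`. -/
def Hminus (s : ℂ) : Fin 6 → ℂ :=
  let q := s ^ 2
  ![Fminus q 0,
    deriv (Fminus q) 0,
    iteratedDeriv 2 (Fminus q) 0 - (1 / 2 - 1 / 3 * E₂ q) * Fminus q 0,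
    qPochInf q q ^ 2 / qPochInf s⁻¹ q ^ 2 *
      ∑' n : ℕ, q ^ (n * (n + 2)) / (qPoch (s ^ 3) q n ^ 2 * qPoch q q (2 * n + 1)),
    qPochInf q q ^ 2 / qPochInf (-1) q ^ 2 *
      ∑' n : ℕ, q ^ (n * (n + 1)) / (qPoch (-q) q n ^ 2 * qPoch q q (2 * n)),
    qPochInf q q ^ 2 / qPochInf (-s⁻¹) q ^ 2 *
      ∑' n : ℕ, q ^ (n * (n + 2)) / (qPoch (-s ^ 3) q n ^ 2 * qPoch q q (2 * n + 1))]

/-- The degrees `δ_j` of the `ε`-deformation. -/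
def defDegree : Fin 6 → ℕ := ![0, 1, 2, 0, 0, 0]

/-- `h_j(τ) = (±1)^(δ_j) H_j^±(exp(± 2πi τ))` for `± Im τ > 0`, where `q^(1/2)` is read as
`exp(± πi τ)`. -/
def h (j : Fin 6) (τ : ℂ) : ℂ :=
  if 0 < τ.im then Hplus (exp (Real.pi * I * τ)) j
  else (-1) ^ defDegree j * Hminus (exp (-(Real.pi * I * τ))) j

/-- The first coefficients of `H_j⁺`; the entry with index `n` belongs to `q^(n/2)`. -/
def firstPlus : Fin 6 → List ℂ :=
  ![[1, 0, 0, 0, 0, 0, 1, 0, 3, 0, 7, 0, 13],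
    [1, 0, -4, 0, -8, 0, -3, 0, 3],
    [2 / 3, 0, -6, 0, 6, 0, 242 / 3, 0, 200],
    [0, 0, 1, 0, 3, -2, 8, -8],
    [1, 0, 4, 0, 12, 0, 33, 0, 79],
    [0, 0, 1, 0, 3, 2, 8, 8]]

/-- The first coefficients of `H_j⁻`; the entry with index `n` belongs to `q^(n/2)`. -/
def firstMinus : Fin 6 → List ℂ :=
  ![[1, 0, 0, 0, 1, 0, 3, 0, 7, 0, 13],
    [1, 0, -4, 0, -5, 0, 1, 0, 7],
    [5 / 6, 0, -10, 0, 17 / 6, 0, 141 / 2, 0, 971 / 6],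
    [0, 0, 1, 4, 9, 18, 31],
    [1 / 4, 0, -1, 0, 5 / 4, 0, -5 / 4, 0, 15 / 4],
    [0, 0, 1, -4, 9, -18, 31]]

/-- `H` is, on the punctured unit disc in `s = q^(1/2)`, the sum of a power series in `s` that
starts with the coefficients in the list `l`. -/
def HasExpansion (H : ℂ → ℂ) (l : List ℂ) : Prop :=
  ∃ a : ℕ → ℂ, (∀ (n : ℕ) (hn : n < l.length), a n = l[n]) ∧
    ∀ s : ℂ, 0 < ‖s‖ → ‖s‖ < 1 → HasSum (fun n => a n * s ^ n) (H s)

end PretzelKnot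

end

open PretzelKnot

/-!
In the coordinate `x = c_b + i b z` the integrand of the state integral becomes a function `f₀ τ z`
whose zeros and poles lie on the lattice `½ (ℤ + ℤ τ⁻¹)` and which is quasi-periodic under
`z ↦ z + 1` and `z ↦ z + τ⁻¹`. By the product formula for the quantum dilogarithm,
`f₀ (z + m) / f₀ z` depends only on `exp(2πiτz)` and `f₀ (z + n / τ) / f₀ z` only on `exp(2πiz)`, so
that summing over all translates `z + m + n / τ` with `m, n ≥ 0` gives `cellFun = f₀ · U · V` with
two one-variable q-hypergeometric series `U` (in `q`) and `V` (in `q̃`).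

Let `τ` be in the upper half-plane. The left half of the contour may be rotated into the ray
`a + ℝ₊` and the right half into the ray `a + ℝ₊ τ⁻¹`, for `f₀` decays exponentially in the two
sectors swept out. On the left this is visible from the product formula. On the right one first
rewrites `f₀` by means of the inversion of the theta function (`exists_theta_inversion`), which is
proved by comparing two entire functions with the same factors of automorphy. Folding the rays up to
the segments `[a, a + 1]` and `[a, a + τ⁻¹]` turns the integrals of `f₀` into integrals of `f₀ · U`
and `f₀ · V`; since a translation by `1`, respectively `τ⁻¹`, removes exactly the first summand of
`U`, respectively `V`, these are the boundary integral `perInt` of `cellFun` around the period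
parallelogram with corner `a` (`integral_f₀_eq_perInt`, `integral_contour_eq_perInt`).

The residue theorem (`perInt_eq_sum`) evaluates it (`perInt_cellFun`). At `z = 0` there is a triple
pole, near which `cellFun` is the product of `Fplus` in `ε = 2πiτz` and `Fminus` in `ε = -2πiz` with
elementary factors; its residue is made of the 2-jets of these two functions, i.e. of `H₀`, `H₁` and
`H₂`. At the half periods there are simple poles, where `U` and `V` specialise to `H₃`, `H₄` and
`H₅`. The common constant is evaluated by the transformation law of the Dedekind eta function
(`residueConst_eq`), and that of `E₂` (`sq_mul_E₂_sub`) absorbs the remaining multiple of `H₀ H₀`.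
The lower half-plane follows because Faddeev's quantum dilogarithm is invariant under `b ↦ b⁻¹`.

For the expansions, a function holomorphic on the punctured disc with an asymptotic expansion at the
origin is the sum of a power series that begins with that expansion (`hasExpansion_of_isBigO`). The
asymptotics are computed in the calculus `Cong` of truncated expansions. For `H₁` and `H₂` the
expansion of the deformed series is uniform in `ε`, so that by Cauchy's estimate it may be
differentiated with respect to `ε` (`Cong.jet`); that these derivatives are holomorphic in `q` is
`HolAt.deriv`.
-/

noncomputable section

namespace PretzelKnot

open Filter Topology Finset

/-! ### q-Pochhammer symbols -/

lemma qPochInf_eq_tprod (x : ℂ) {q : ℂ} (hq : ‖q‖ < 1) :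
    qPochInf x q = ∏' k : ℕ, (1 - x * q ^ k) := by
  simp [qPochInf, hq]

lemma summable_norm_mul_pow (x : ℂ) {q : ℂ} (hq : ‖q‖ < 1) :
    Summable fun k : ℕ => ‖-(x * q ^ k)‖ := by
  simp only [norm_neg, norm_mul, norm_pow]
  exact (summable_geometric_of_lt_one (norm_nonneg _) hq).mul_left _

lemma multipliable_one_sub_mul_pow (x : ℂ) {q : ℂ} (hq : ‖q‖ < 1) :
    Multipliable fun k : ℕ => 1 - x * q ^ k := by
  simpa [sub_eq_add_neg] using multipliable_one_add_of_summable (summable_norm_mul_pow x hq)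

lemma tendsto_qPoch (x : ℂ) {q : ℂ} (hq : ‖q‖ < 1) :
    Tendsto (fun n => qPoch x q n) atTop (𝓝 (qPochInf x q)) := by
  rw [qPochInf_eq_tprod x hq]
  exact (multipliable_one_sub_mul_pow x hq).hasProd.tendsto_prod_nat

lemma qPoch_succ' (x q : ℂ) (n : ℕ) :
    qPoch x q (n + 1) = (1 - x) * qPoch (x * q) q n := by
  simp only [qPoch, Finset.prod_range_succ', pow_zero, mul_one]
  rw [mul_comm]
  congr 1
  exact Finset.prod_congr rfl fun k _ => by ring

lemma qPoch_add (x q : ℂ) (m n : ℕ) :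
    qPoch x q (m + n) = qPoch x q m * qPoch (x * q ^ m) q n := by
  simp only [qPoch, Finset.prod_range_add]
  congr 1
  exact Finset.prod_congr rfl fun k _ => by ring

lemma qPochInf_eq_qPoch_mul (x : ℂ) {q : ℂ} (hq : ‖q‖ < 1) (n : ℕ) :
    qPochInf x q = qPoch x q n * qPochInf (x * q ^ n) q := by
  have h1 := (tendsto_qPoch x hq).comp (tendsto_add_atTop_nat n)
  have h2 := (tendsto_qPoch (x * q ^ n) hq).const_mul (qPoch x q n)
  refine tendsto_nhds_unique h1 (h2.congr fun m => ?_)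
  rw [Function.comp_apply, add_comm m n, qPoch_add]

lemma qPochInf_eq_one_sub_mul (x : ℂ) {q : ℂ} (hq : ‖q‖ < 1) :
    qPochInf x q = (1 - x) * qPochInf (x * q) q := by
  simpa [qPoch] using qPochInf_eq_qPoch_mul x hq 1

lemma qPochInf_ne_zero {x q : ℂ} (hq : ‖q‖ < 1) (h : ∀ k : ℕ, x * q ^ k ≠ 1) :
    qPochInf x q ≠ 0 := by
  rw [qPochInf_eq_tprod x hq]
  simp only [sub_eq_add_neg]
  refine tprod_one_add_ne_zero_of_summable (fun k hk => h k ?_) (summable_norm_mul_pow x hq)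
  linear_combination -hk

lemma norm_mul_pow_lt_one {x q : ℂ} (hq : ‖q‖ < 1) (hx : ‖x‖ < 1) (k : ℕ) : ‖x * q ^ k‖ < 1 := by
  rw [norm_mul, norm_pow]
  have := pow_le_one₀ (norm_nonneg q) hq.le (n := k)
  nlinarith [norm_nonneg x]

lemma mul_pow_ne_one {x q : ℂ} (hq : ‖q‖ < 1) (hx : ‖x‖ < 1) (k : ℕ) : x * q ^ k ≠ 1 := by
  intro h
  have := norm_mul_pow_lt_one hq hx k
  simp [h] at this

lemma qPochInf_ne_zero_of_norm_lt {x q : ℂ} (hq : ‖q‖ < 1) (hx : ‖x‖ < 1) :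
    qPochInf x q ≠ 0 :=
  qPochInf_ne_zero hq (mul_pow_ne_one hq hx)

lemma qPoch_ne_zero_of_norm_lt {x q : ℂ} (hq : ‖q‖ < 1) (hx : ‖x‖ < 1) (m : ℕ) :
    qPoch x q m ≠ 0 :=
  Finset.prod_ne_zero_iff.2 fun k _ h => mul_pow_ne_one hq hx k (by linear_combination -h)

/-- The infinite q-Pochhammer symbol depends analytically on both of its arguments. -/
lemma analyticAt_qPochInf {f g : ℂ → ℂ} {w : ℂ} (hf : AnalyticAt ℂ f w) (hg : AnalyticAt ℂ g w)
    (hq : ‖g w‖ < 1) : AnalyticAt ℂ (fun z => qPochInf (f z) (g z)) w := by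
  obtain ⟨r, hr1, hr2⟩ := exists_between hq
  have h1 : ∀ᶠ z in 𝓝 w, ‖g z‖ < r := (hg.continuousAt.norm).eventually_lt_const hr1
  have h2 : ∀ᶠ z in 𝓝 w, ‖f z‖ < ‖f w‖ + 1 :=
    (hf.continuousAt.norm).eventually_lt_const (lt_add_one _)
  have h3 := hf.eventually_analyticAt
  have h4 := hg.eventually_analyticAt
  obtain ⟨U, hU, hUo, hwU⟩ := eventually_nhds_iff.1 (h1.and (h2.and (h3.and h4)))
  have hr0 : 0 ≤ r := (norm_nonneg _).trans hr1.le
  have hu : Summable fun k : ℕ => (‖f w‖ + 1) * r ^ k :=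
    (summable_geometric_of_lt_one hr0 hr2).mul_left _
  have hcf : ContinuousOn f U := fun z hz => (hU z hz).2.2.1.continuousAt.continuousWithinAt
  have hcg : ContinuousOn g U := fun z hz => (hU z hz).2.2.2.continuousAt.continuousWithinAt
  have hdf : DifferentiableOn ℂ f U := fun z hz =>
    (hU z hz).2.2.1.differentiableAt.differentiableWithinAt
  have hdg : DifferentiableOn ℂ g U := fun z hz =>
    (hU z hz).2.2.2.differentiableAt.differentiableWithinAt
  have key := Summable.hasProdLocallyUniformlyOn_nat_one_add (f := fun k z => -(f z * g z ^ k))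
    hUo hu (.of_forall fun k z hz => by
      rw [norm_neg, norm_mul, norm_pow]
      have := (hU z hz).1.le
      have := (hU z hz).2.1.le
      gcongr) (fun k => by fun_prop)
  have hd : DifferentiableOn ℂ (fun z => ∏' k : ℕ, (1 + -(f z * g z ^ k))) U :=
    key.differentiableOn (.of_forall fun s => by
      simpa [Finset.prod_fn] using DifferentiableOn.finsetProd (fun _ _ => by fun_prop)) hUo
  refine (hd.congr fun z hz => ?_).analyticAt (hUo.mem_nhds hwU)
  rw [qPochInf_eq_tprod _ ((hU z hz).1.trans hr2)]
  simp [sub_eq_add_neg]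

lemma norm_qPochInf_sub_one_le (x : ℂ) {q : ℂ} (hq : ‖q‖ < 1) :
    ‖qPochInf x q - 1‖ ≤ Real.exp (‖x‖ / (1 - ‖q‖)) - 1 := by
  refine le_of_tendsto ((tendsto_qPoch x hq).sub_const 1).norm (.of_forall fun n => ?_)
  have h := Finset.norm_prod_one_add_sub_one_le (Finset.range n) (fun k => -(x * q ^ k))
  simp only [← sub_eq_add_neg] at h
  refine h.trans ?_
  gcongr
  have h2 := (summable_norm_mul_pow x hq).sum_le_tsum (Finset.range n) fun _ _ => norm_nonneg _
  refine h2.trans (le_of_eq ?_)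
  simp only [norm_neg, norm_mul, norm_pow, tsum_mul_left]
  rw [tsum_geometric_of_lt_one (norm_nonneg _) hq, div_eq_mul_inv]

lemma norm_qPochInf_le (x : ℂ) {q : ℂ} (hq : ‖q‖ < 1) :
    ‖qPochInf x q‖ ≤ Real.exp (‖x‖ / (1 - ‖q‖)) := by
  have h := norm_qPochInf_sub_one_le x hq
  have h2 := norm_le_norm_sub_add (qPochInf x q) 1
  simp only [norm_one] at h2
  linarith

lemma norm_inv_one_sub_le {y : ℂ} {ρ : ℝ} (hρ : ρ < 1) (hy : ‖y‖ ≤ ρ) :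
    ‖(1 - y)⁻¹‖ ≤ (1 - ρ)⁻¹ := by
  rw [norm_inv]
  have : 1 - ρ ≤ ‖1 - y‖ := by
    have := norm_sub_norm_le (1 : ℂ) y
    simp only [norm_one] at this
    linarith
  gcongr

lemma norm_inv_qPoch_le {x q : ℂ} {ρ : ℝ} (hq : ‖q‖ < 1) (hρ : ρ < 1) (hx : ‖x‖ ≤ ρ) (n : ℕ) :
    ‖(qPoch x q n)⁻¹‖ ≤ ((1 - ρ)⁻¹) ^ n := by
  rw [qPoch, ← Finset.prod_inv_distrib]
  refine (Finset.norm_prod_le _ _).trans ?_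
  refine (Finset.prod_le_prod (fun _ _ => norm_nonneg _) fun k _ =>
    norm_inv_one_sub_le hρ (?_ : ‖x * q ^ k‖ ≤ ρ)).trans (by simp)
  rw [norm_mul, norm_pow]
  exact (mul_le_of_le_one_right (norm_nonneg _) (pow_le_one₀ (norm_nonneg _) hq.le)).trans hx

lemma norm_inv_qPochInf_le {x q : ℂ} {ρ : ℝ} (hq : ‖q‖ < 1) (hρ : ρ < 1) (hx : ‖x‖ ≤ ρ) :
    ‖(qPochInf x q)⁻¹‖ ≤ Real.exp ((1 - ρ)⁻¹ / (1 - ‖q‖)) := by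
  have hx1 := hx.trans_lt hρ
  refine le_of_tendsto ((tendsto_qPoch x hq).inv₀ (qPochInf_ne_zero_of_norm_lt hq hx1)).norm
    (.of_forall fun n => ?_)
  have e : (qPoch x q n)⁻¹ = ∏ k ∈ range n, (1 + x * q ^ k * (1 - x * q ^ k)⁻¹) := by
    rw [qPoch, ← Finset.prod_inv_distrib]
    refine Finset.prod_congr rfl fun k _ => ?_
    have : 1 - x * q ^ k ≠ 0 := fun h => mul_pow_ne_one hq hx1 k (by linear_combination -h)
    field_simp
    ring
  have h := Finset.norm_prod_one_add_sub_one_le (range n)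
    (fun k => x * q ^ k * (1 - x * q ^ k)⁻¹)
  rw [← e] at h
  have h2 := norm_le_norm_sub_add (qPoch x q n)⁻¹ 1
  simp only [norm_one] at h2
  have h3 : ∑ k ∈ range n, ‖x * q ^ k * (1 - x * q ^ k)⁻¹‖ ≤ (1 - ρ)⁻¹ / (1 - ‖q‖) := by
    calc _ ≤ ∑ k ∈ range n, (1 - ρ)⁻¹ * ‖q‖ ^ k := by
          refine Finset.sum_le_sum fun k _ => ?_
          have hb : ‖x * q ^ k‖ ≤ ρ := by
            rw [norm_mul, norm_pow]
            exact (mul_le_of_le_one_right (norm_nonneg _)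
              (pow_le_one₀ (norm_nonneg _) hq.le)).trans hx
          have := norm_inv_one_sub_le hρ hb
          rw [norm_mul, norm_mul, norm_pow]
          have h0 : 0 ≤ (1 - ρ)⁻¹ := inv_nonneg.2 (by linarith)
          calc ‖x‖ * ‖q‖ ^ k * ‖(1 - x * q ^ k)⁻¹‖ ≤ 1 * ‖q‖ ^ k * (1 - ρ)⁻¹ := by gcongr
            _ = _ := by ring
      _ ≤ _ := by
          rw [← Finset.mul_sum, div_eq_mul_inv]
          refine mul_le_mul_of_nonneg_left ?_ (inv_nonneg.2 (by linarith))
          rw [← tsum_geometric_of_lt_one (norm_nonneg _) hq]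
          exact (summable_geometric_of_lt_one (norm_nonneg _) hq).sum_le_tsum _
            fun _ _ => by positivity
  have h4 := Real.exp_le_exp.2 h3
  linarith

/-! ### The hypergeometric series -/

/-- The general term of `qSum`. -/
def qTerm (c : ℕ) (q L x y : ℂ) (m : ℕ) : ℂ :=
  q ^ (c * m ^ 2) * L ^ m / (qPoch x q m ^ 2 * qPoch y q (2 * m))

/-- The q-hypergeometric series `∑ q^(c m²) L^m / ((x; q)_m² (y; q)_(2m))`, of which all the series
of the state integral are specialisations with `c = 1` or `c = 2`. -/
def qSum (c : ℕ) (q L x y : ℂ) : ℂ := ∑' m, qTerm c q L x y m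

lemma summable_pow_sq_mul_pow {r : ℝ} (hr0 : 0 ≤ r) (hr : r < 1) (K : ℝ) :
    Summable fun m : ℕ => r ^ m ^ 2 * K ^ m := by
  have h1 : Tendsto (fun m : ℕ => r ^ m * |K|) atTop (𝓝 0) := by
    simpa using (tendsto_pow_atTop_nhds_zero_of_lt_one hr0 hr).mul_const |K|
  have h2 : ∀ᶠ m : ℕ in atTop, r ^ m * |K| ≤ 1 / 2 :=
    (h1.eventually_lt_const (by norm_num : (0 : ℝ) < 1 / 2)).mono fun _ h => h.le
  refine Summable.of_norm_bounded_eventually_nat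
    (summable_geometric_of_lt_one (by norm_num : (0 : ℝ) ≤ 1 / 2) (by norm_num))
    (h2.mono fun m hm => ?_)
  rw [pow_two, pow_mul, ← mul_pow, norm_pow, Real.norm_eq_abs, abs_mul, abs_pow, abs_of_nonneg hr0]
  gcongr

lemma norm_qTerm_le {c : ℕ} (hc : 1 ≤ c) {q L x y : ℂ} {r B ρ : ℝ} (hr : r < 1) (hρ : ρ < 1)
    (hq : ‖q‖ ≤ r) (hL : ‖L‖ ≤ B) (hx : ‖x‖ ≤ ρ) (hy : ‖y‖ ≤ ρ) (m : ℕ) :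
    ‖qTerm c q L x y m‖ ≤ r ^ m ^ 2 * (B * ((1 - ρ)⁻¹) ^ 4) ^ m := by
  have hq1 := hq.trans_lt hr
  have h1 := norm_inv_qPoch_le hq1 hρ hx m
  have h2 := norm_inv_qPoch_le hq1 hρ hy (2 * m)
  have h0 : 0 ≤ (1 - ρ)⁻¹ := inv_nonneg.2 (by linarith)
  have hr0 := (norm_nonneg _).trans hq
  have hB0 := (norm_nonneg _).trans hL
  rw [qTerm, div_eq_mul_inv, mul_inv, ← inv_pow, norm_mul, norm_mul, norm_mul, norm_pow, norm_pow,
    norm_pow]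
  calc _ ≤ r ^ (c * m ^ 2) * B ^ m * ((((1 - ρ)⁻¹) ^ m) ^ 2 * ((1 - ρ)⁻¹) ^ (2 * m)) := by gcongr
    _ ≤ r ^ m ^ 2 * B ^ m * ((((1 - ρ)⁻¹) ^ m) ^ 2 * ((1 - ρ)⁻¹) ^ (2 * m)) := by
        gcongr ?_ * _ * _
        exact pow_le_pow_of_le_one hr0 hr.le (Nat.le_mul_of_pos_left _ hc)
    _ = _ := by ring

lemma summable_qTerm {c : ℕ} (hc : 1 ≤ c) {q x y : ℂ} (L : ℂ) (hq : ‖q‖ < 1) (hx : ‖x‖ < 1)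
    (hy : ‖y‖ < 1) : Summable (qTerm c q L x y) :=
  .of_norm_bounded (summable_pow_sq_mul_pow (norm_nonneg q) hq _)
    (norm_qTerm_le hc hq (max_lt hx hy) le_rfl le_rfl (le_max_left _ _) (le_max_right _ _))

/-- The series `qSum` depends analytically on its arguments as long as `q`, `x` and `y` stay in the
unit disc. -/
lemma analyticAt_qSum {c : ℕ} (hc : 1 ≤ c) {q L x y : ℂ → ℂ} {w : ℂ} (hq : AnalyticAt ℂ q w)
    (hL : AnalyticAt ℂ L w) (hx : AnalyticAt ℂ x w) (hy : AnalyticAt ℂ y w) (hq1 : ‖q w‖ < 1)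
    (hx1 : ‖x w‖ < 1) (hy1 : ‖y w‖ < 1) :
    AnalyticAt ℂ (fun z => qSum c (q z) (L z) (x z) (y z)) w := by
  obtain ⟨r, hr1, hr2⟩ := exists_between hq1
  obtain ⟨ρ, hρ1, hρ2⟩ := exists_between (max_lt hx1 hy1)
  have h1 : ∀ᶠ z in 𝓝 w, ‖q z‖ < r := (hq.continuousAt.norm).eventually_lt_const hr1
  have h2 : ∀ᶠ z in 𝓝 w, ‖L z‖ < ‖L w‖ + 1 :=
    (hL.continuousAt.norm).eventually_lt_const (lt_add_one _)
  have h3 : ∀ᶠ z in 𝓝 w, ‖x z‖ < ρ :=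
    (hx.continuousAt.norm).eventually_lt_const ((le_max_left _ _).trans_lt hρ1)
  have h4 : ∀ᶠ z in 𝓝 w, ‖y z‖ < ρ :=
    (hy.continuousAt.norm).eventually_lt_const ((le_max_right _ _).trans_lt hρ1)
  obtain ⟨U, hU, hUo, hwU⟩ := eventually_nhds_iff.1 (h1.and (h2.and (h3.and (h4.and
    (hq.eventually_analyticAt.and (hL.eventually_analyticAt.and
      (hx.eventually_analyticAt.and hy.eventually_analyticAt)))))))
  refine DifferentiableOn.analyticAt (s := U) ?_ (hUo.mem_nhds hwU)
  refine differentiableOn_tsum_of_summable_norm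
    (summable_pow_sq_mul_pow ((norm_nonneg _).trans hr1.le) hr2
      ((‖L w‖ + 1) * ((1 - ρ)⁻¹) ^ 4)) (fun m z hz => ?_) hUo
    (fun m z hz => norm_qTerm_le hc hr2 hρ2 (hU z hz).1.le (hU z hz).2.1.le (hU z hz).2.2.1.le
      (hU z hz).2.2.2.1.le m)
  obtain ⟨a1, -, a3, a4, b1, b2, b3, b4⟩ := hU z hz
  replace b1 := b1.differentiableAt
  replace b2 := b2.differentiableAt
  replace b3 := b3.differentiableAt
  replace b4 := b4.differentiableAt
  have n1 := qPoch_ne_zero_of_norm_lt (a1.trans hr2) (a3.trans hρ2) m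
  have n2 := qPoch_ne_zero_of_norm_lt (a1.trans hr2) (a4.trans hρ2) (2 * m)
  refine DifferentiableAt.differentiableWithinAt (DifferentiableAt.div (by fun_prop) ?_
    (mul_ne_zero (pow_ne_zero _ n1) n2))
  unfold qPoch
  fun_prop

lemma norm_qSum_le {c : ℕ} (hc : 1 ≤ c) {q L x y : ℂ} {r B ρ : ℝ} (hr : r < 1) (hρ : ρ < 1)
    (hq : ‖q‖ ≤ r) (hL : ‖L‖ ≤ B) (hx : ‖x‖ ≤ ρ) (hy : ‖y‖ ≤ ρ) :
    ‖qSum c q L x y‖ ≤ ∑' m : ℕ, r ^ m ^ 2 * (B * ((1 - ρ)⁻¹) ^ 4) ^ m :=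
  tsum_of_norm_bounded (summable_pow_sq_mul_pow ((norm_nonneg _).trans hq) hr _).hasSum
    (norm_qTerm_le hc hr hρ hq hL hx hy)

/-! ### The normalised exponential -/

/-- `ee z = exp(2πi z)`. -/
def ee (z : ℂ) : ℂ := exp (2 * Real.pi * I * z)

lemma ee_add (z w : ℂ) : ee (z + w) = ee z * ee w := by
  rw [ee, ee, ee, ← Complex.exp_add]; ring_nf

lemma ee_zero : ee 0 = 1 := by simp [ee]

lemma ee_ne_zero (z : ℂ) : ee z ≠ 0 := exp_ne_zero _

lemma ee_neg (z : ℂ) : ee (-z) = (ee z)⁻¹ := by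
  rw [ee, ee, ← Complex.exp_neg]; ring_nf

lemma ee_sub (z w : ℂ) : ee (z - w) = ee z / ee w := by
  rw [sub_eq_add_neg, ee_add, ee_neg, div_eq_mul_inv]

lemma ee_nat_mul (n : ℕ) (z : ℂ) : ee (n * z) = ee z ^ n := by
  rw [ee, ee, ← Complex.exp_nat_mul]; ring_nf

lemma ee_two_mul (z : ℂ) : ee (2 * z) = ee z ^ 2 := by
  exact_mod_cast ee_nat_mul 2 z

lemma ee_int (n : ℤ) : ee n = 1 := by
  rw [ee, mul_comm, exp_int_mul_two_pi_mul_I]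

lemma ee_one : ee 1 = 1 := by exact_mod_cast ee_int 1

lemma ee_half : ee (1 / 2) = -1 := by
  rw [ee, ← exp_pi_mul_I]; ring_nf

lemma ee_add_one (z : ℂ) : ee (z + 1) = ee z := by rw [ee_add, ee_one, mul_one]

lemma ee_eq_one_iff (z : ℂ) : ee z = 1 ↔ ∃ n : ℤ, z = n := by
  have hp : (2 * Real.pi * I : ℂ) ≠ 0 := two_pi_I_ne_zero
  rw [ee, exp_eq_one_iff]
  refine exists_congr fun n => ?_
  rw [mul_comm (n : ℂ)]
  exact mul_right_inj' hp

lemma norm_ee (z : ℂ) : ‖ee z‖ = Real.exp (-(2 * Real.pi * z.im)) := by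
  rw [ee, norm_exp]
  simp

lemma norm_ee_lt_one {z : ℂ} (hz : 0 < z.im) : ‖ee z‖ < 1 := by
  rw [norm_ee, Real.exp_lt_one_iff]
  have := Real.pi_pos
  have := mul_pos this hz
  linarith

lemma analyticAt_ee {f : ℂ → ℂ} {w : ℂ} (hf : AnalyticAt ℂ f w) :
    AnalyticAt ℂ (fun z => ee (f z)) w :=
  (analyticAt_const.mul hf).cexp

lemma hasDerivAt_ee (z : ℂ) : HasDerivAt ee (2 * Real.pi * I * ee z) z := by
  have := ((hasDerivAt_id z).const_mul (2 * Real.pi * I : ℂ)).cexp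
  simp only [id_eq, mul_one, mul_comm (cexp _)] at this
  exact this

lemma differentiable_ee : Differentiable ℂ ee := fun z => (hasDerivAt_ee z).differentiableAt

lemma continuous_ee : Continuous ee := differentiable_ee.continuous

lemma inv_im_neg {τ : ℂ} (hτ : 0 < τ.im) : (τ⁻¹).im < 0 := by
  rw [inv_im]
  exact div_neg_of_neg_of_pos (by linarith) (normSq_pos.2 fun h => by simp [h] at hτ)

lemma norm_ee_neg_inv_lt_one {τ : ℂ} (hτ : 0 < τ.im) : ‖ee (-τ⁻¹)‖ < 1 :=
  norm_ee_lt_one (by have := inv_im_neg hτ; simpa using this)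

/-! ### Quasi-periodic functions -/

/-- Coordinates of a complex number with respect to the real basis `1, ω`. -/
lemma exists_coords {ω : ℂ} (hω : ω.im ≠ 0) (z : ℂ) : ∃ α β : ℝ, z = α + β * ω := by
  refine ⟨z.re - z.im / ω.im * ω.re, z.im / ω.im, ?_⟩
  apply Complex.ext
  · simp
  · simp [hω]

/-- Two entire functions with the same factors of automorphy under the lattice `ℤ + ℤω` are
proportional as soon as the second one has only simple zeros at the lattice points and the first
one vanishes there: their quotient is an entire elliptic function. -/
lemma exists_eq_const_mul_of_quasiperiodic {ω : ℂ} (hω : ω.im ≠ 0) {F₁ F₂ m₁ m₂ : ℂ → ℂ}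
    (hF₁ : Differentiable ℂ F₁) (hF₂ : Differentiable ℂ F₂)
    (hm₁ : ∀ z, m₁ z ≠ 0) (hm₂ : ∀ z, m₂ z ≠ 0)
    (h₁ : ∀ z, F₁ (z + 1) = m₁ z * F₁ z) (h₁' : ∀ z, F₁ (z + ω) = m₂ z * F₁ z)
    (h₂ : ∀ z, F₂ (z + 1) = m₁ z * F₂ z) (h₂' : ∀ z, F₂ (z + ω) = m₂ z * F₂ z)
    (hz : ∀ z, F₂ z = 0 → ∃ m n : ℤ, z = m + n * ω)
    (h₁0 : F₁ 0 = 0) (h₂0 : F₂ 0 = 0) (hd : deriv F₂ 0 ≠ 0) :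
    ∃ C, ∀ z, F₁ z = C * F₂ z := by
  classical
  -- the quotient `F₁ / F₂`, extended to the lattice points by the quotient of the derivatives
  let g : ℂ → ℂ := fun z => if F₂ z = 0 then deriv F₁ 0 / deriv F₂ 0 else F₁ z / F₂ z
  have gp1 : Function.Periodic g 1 := fun z => by
    simp only [g, h₁, h₂, mul_eq_zero, hm₁ z, false_or, mul_div_mul_left _ _ (hm₁ z)]
  have gp2 : Function.Periodic g ω := fun z => by
    simp only [g, h₁', h₂', mul_eq_zero, hm₂ z, false_or, mul_div_mul_left _ _ (hm₂ z)]
  have gp (m n : ℤ) : Function.Periodic g (m + n * ω) := by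
    have := (gp1.int_mul m).add_period (gp2.int_mul n)
    simpa using this
  have ds (F : ℂ → ℂ) (hF : Differentiable ℂ F) : Differentiable ℂ (dslope F 0) := by
    have := (differentiableOn_dslope (f := F) (c := 0) (s := Set.univ) univ_mem).2
      hF.differentiableOn
    exact differentiableOn_univ.1 this
  have g0 : DifferentiableAt ℂ g 0 := by
    have hne : dslope F₂ 0 0 ≠ 0 := by rwa [dslope_same]
    have h3 : DifferentiableAt ℂ (fun w => dslope F₁ 0 w / dslope F₂ 0 w) 0 :=
      (ds F₁ hF₁ 0).div (ds F₂ hF₂ 0) hne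
    refine h3.congr_of_eventuallyEq ?_
    filter_upwards [(ds F₂ hF₂).continuous.continuousAt.eventually_ne hne] with w hw
    rcases eq_or_ne w 0 with rfl | hw0
    · simp [g, h₂0, dslope_same]
    · rw [dslope_of_ne _ hw0, slope_def_field, h₂0, sub_zero, sub_zero] at hw
      have hw2 : F₂ w ≠ 0 := fun h => hw (by simp [h])
      simp only [g, if_neg hw2]
      rw [dslope_of_ne _ hw0, dslope_of_ne _ hw0, slope_def_field, slope_def_field, h₂0, h₁0]
      simp only [sub_zero]
      field_simp
  have gd : Differentiable ℂ g := fun z => by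
    by_cases hz0 : F₂ z = 0
    · obtain ⟨m, n, hmn⟩ := hz z hz0
      have e : g = fun w => g (w - z) := by
        funext w
        rw [hmn, (gp m n).sub_eq]
      rw [e]
      have g0' : DifferentiableAt ℂ g (z - z) := by simpa using g0
      exact DifferentiableAt.comp (g := g) (f := fun w => w - z) z g0' (by fun_prop)
    · refine ((hF₁ z).div (hF₂ z) hz0).congr_of_eventuallyEq ?_
      filter_upwards [(hF₂ z).continuousAt.eventually_ne hz0] with w hw
      simp [g, hw]
  -- the values of `g` are those on the compact period parallelogram
  have gb : Bornology.IsBounded (Set.range g) := by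
    have hK : IsCompact ((fun p : ℝ × ℝ => g (p.1 + p.2 * ω)) ''
        (Set.Icc 0 1 ×ˢ Set.Icc 0 1)) :=
      (isCompact_Icc.prod isCompact_Icc).image
        (gd.continuous.comp (by fun_prop))
    refine hK.isBounded.subset ?_
    rintro _ ⟨z, rfl⟩
    obtain ⟨α, β, rfl⟩ := exists_coords hω z
    refine ⟨(Int.fract α, Int.fract β), ⟨⟨Int.fract_nonneg _, (Int.fract_lt_one _).le⟩,
      ⟨Int.fract_nonneg _, (Int.fract_lt_one _).le⟩⟩, ?_⟩
    dsimp only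
    rw [← (gp ⌊α⌋ ⌊β⌋)]
    congr 1
    have e1 := Int.fract_add_floor α
    have e2 := Int.fract_add_floor β
    have e1' : ((Int.fract α : ℝ) : ℂ) + (⌊α⌋ : ℂ) = α := by exact_mod_cast e1
    have e2' : ((Int.fract β : ℝ) : ℂ) + (⌊β⌋ : ℂ) = β := by exact_mod_cast e2
    linear_combination e1' + ω * e2'
  refine ⟨g 0, fun z => ?_⟩
  by_cases hz0 : F₂ z = 0
  · rw [hz0, mul_zero]
    obtain ⟨m, n, hmn⟩ := hz z hz0
    have p1 : Function.Periodic (fun z => F₁ z = 0) 1 := fun z => by simp [h₁, hm₁]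
    have p2 : Function.Periodic (fun z => F₁ z = 0) ω := fun z => by simp [h₁', hm₂]
    have := ((p1.int_mul m).add_period (p2.int_mul n)).eq
    simp only [mul_one, h₁0, eq_iff_iff, iff_true] at this
    rwa [hmn]
  · rw [gd.apply_eq_apply_of_bounded gb 0 z]
    simp only [g, if_neg hz0]
    field_simp

/-! ### The quantum dilogarithm and its asymptotics -/

/-- The factor `exp(-πi x²)` in the coordinate `x = c_b + i b z`. -/
def gauss (τ z : ℂ) : ℂ := exp (Real.pi * I * τ * (z + (1 + τ⁻¹) / 2) ^ 2)

/-- Faddeev's quantum dilogarithm in the coordinate `x = c_b + i b z`. -/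
def phi (τ z : ℂ) : ℂ :=
  qPochInf (ee (τ * (z + 1))) (ee τ) / qPochInf (ee z) (ee (-τ⁻¹))

/-- The integrand of the state integral in the coordinate `x = c_b + i b z`. -/
def f₀ (τ z : ℂ) : ℂ := phi τ z ^ 2 * phi τ (2 * z) * gauss τ (2 * z)

lemma gauss_ne_zero (τ z : ℂ) : gauss τ z ≠ 0 := exp_ne_zero _

lemma gauss_add_one {τ : ℂ} (hτ : τ ≠ 0) (z : ℂ) :
    gauss τ (z + 1) = -ee (τ * (z + 1)) * gauss τ z := by
  rw [neg_eq_neg_one_mul, ← ee_half, gauss, gauss, ee, ee, ← Complex.exp_add, ← Complex.exp_add]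
  congr 1
  field_simp
  ring

lemma gauss_add_inv {τ : ℂ} (hτ : τ ≠ 0) (z : ℂ) :
    gauss τ (z + τ⁻¹) = -ee (z + τ⁻¹) * gauss τ z := by
  rw [neg_eq_neg_one_mul, ← ee_half, gauss, gauss, ee, ee, ← Complex.exp_add, ← Complex.exp_add]
  congr 1
  field_simp
  ring

lemma ne_zero_of_im_pos {τ : ℂ} (hτ : 0 < τ.im) : τ ≠ 0 := fun h => by simp [h] at hτ

lemma qPochInf_ee_eq_zero_imp {τ z : ℂ} (hτ : 0 < τ.im)
    (h : qPochInf (ee z) (ee τ) = 0) : ∃ m : ℤ, ∃ n : ℕ, z = m - n * τ := by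
  by_contra! hc
  refine qPochInf_ne_zero (norm_ee_lt_one hτ) (fun k hk => ?_) h
  rw [← ee_nat_mul, ← ee_add, ee_eq_one_iff] at hk
  obtain ⟨m, hm⟩ := hk
  exact hc m k (by linear_combination hm)

/-- The modular inversion of the Jacobi theta function, up to a constant factor. -/
lemma exists_theta_inversion {τ : ℂ} (hτ : 0 < τ.im) : ∃ C : ℂ, ∀ z,
    gauss τ z * (qPochInf (ee (-(τ * z))) (ee τ) * qPochInf (ee (τ * (z + 1))) (ee τ)) =
      C * (qPochInf (ee z) (ee (-τ⁻¹)) * qPochInf (ee (-τ⁻¹ - z)) (ee (-τ⁻¹))) := by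
  have hτ0 := ne_zero_of_im_pos hτ
  have hq := norm_ee_lt_one hτ
  have hqt := norm_ee_neg_inv_lt_one hτ
  have hti := inv_im_neg hτ
  have hti' : 0 < (-τ⁻¹).im := by simpa using hti
  have hA : ∀ (f : ℂ → ℂ) (r : ℂ), (∀ z, AnalyticAt ℂ f z) → ‖r‖ < 1 →
      Differentiable ℂ fun z => qPochInf (ee (f z)) r := fun f r hf hr z =>
    (analyticAt_qPochInf (analyticAt_ee (hf z)) analyticAt_const hr).differentiableAt
  refine exists_eq_const_mul_of_quasiperiodic (ω := τ⁻¹) hti.ne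
    (F₁ := fun z => gauss τ z * (qPochInf (ee (-(τ * z))) (ee τ) *
      qPochInf (ee (τ * (z + 1))) (ee τ)))
    (F₂ := fun z => qPochInf (ee z) (ee (-τ⁻¹)) * qPochInf (ee (-τ⁻¹ - z)) (ee (-τ⁻¹)))
    (m₁ := fun _ => 1) (m₂ := fun z => -ee (z + τ⁻¹))
    ?_ ?_ (fun _ => one_ne_zero) (fun z => neg_ne_zero.2 (ee_ne_zero _))
    (fun z => ?_) (fun z => ?_) (fun z => ?_) (fun z => ?_) (fun z hz => ?_) ?_ ?_ ?_
  · have h1 := hA (fun z => -(τ * z)) (ee τ) (fun z => by fun_prop) hq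
    have h2 := hA (fun z => τ * (z + 1)) (ee τ) (fun z => by fun_prop) hq
    have h3 : Differentiable ℂ (gauss τ) := by unfold gauss; fun_prop
    exact h3.mul (h1.mul h2)
  · exact (hA (fun z => z) _ (fun z => by fun_prop) hqt).mul
      (hA (fun z => -τ⁻¹ - z) _ (fun z => by fun_prop) hqt)
  · rw [gauss_add_one hτ0, qPochInf_eq_one_sub_mul (ee (-(τ * (z + 1)))) hq,
      qPochInf_eq_one_sub_mul (ee (τ * (z + 1))) hq, ← ee_add, ← ee_add, ee_neg,
      show -(τ * (z + 1)) + τ = -(τ * z) by ring,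
      show τ * (z + 1) + τ = τ * (z + 1 + 1) by ring]
    have := ee_ne_zero (τ * (z + 1))
    field_simp
    ring
  · have e1 : ee (-(τ * (z + τ⁻¹))) = ee (-(τ * z)) := by
      rw [← ee_add_one]; congr 1; field_simp; ring
    have e2 : ee (τ * (z + τ⁻¹ + 1)) = ee (τ * (z + 1)) := by
      rw [← ee_add_one (τ * (z + 1))]; congr 1; field_simp; ring
    rw [gauss_add_inv hτ0, e1, e2]
    ring
  · have e1 : ee (-τ⁻¹ - (z + 1)) = ee (-τ⁻¹ - z) := by
      rw [← ee_add_one]; congr 1; ring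
    rw [ee_add_one, e1, one_mul]
  · rw [qPochInf_eq_one_sub_mul (ee (z + τ⁻¹)) hqt, qPochInf_eq_one_sub_mul (ee (-τ⁻¹ - z)) hqt,
      ← ee_add, ← ee_add, show z + τ⁻¹ + -τ⁻¹ = z by ring,
      show -τ⁻¹ - (z + τ⁻¹) = -τ⁻¹ - z + -τ⁻¹ by ring]
    have e1 : ee (-τ⁻¹ - z) = (ee (z + τ⁻¹))⁻¹ := by rw [← ee_neg]; congr 1; ring
    rw [e1]
    have h0 := ee_ne_zero (z + τ⁻¹)
    linear_combination -qPochInf (ee z) (ee (-τ⁻¹)) *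
      qPochInf (ee (-τ⁻¹ - z + -τ⁻¹)) (ee (-τ⁻¹)) * (mul_inv_cancel₀ h0)
  · rcases mul_eq_zero.1 hz with h | h
    · obtain ⟨m, n, h⟩ := qPochInf_ee_eq_zero_imp hti' h
      exact ⟨m, n, by rw [h]; push_cast; ring⟩
    · obtain ⟨m, n, h⟩ := qPochInf_ee_eq_zero_imp hti' h
      refine ⟨-m, -n - 1, ?_⟩
      push_cast
      linear_combination -h
  · rw [qPochInf_eq_one_sub_mul (ee (-(τ * 0))) hq]
    simp [ee_zero]
  · rw [qPochInf_eq_one_sub_mul (ee 0) hqt]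
    simp [ee_zero]
  · have e : (fun z => qPochInf (ee z) (ee (-τ⁻¹)) * qPochInf (ee (-τ⁻¹ - z)) (ee (-τ⁻¹))) =
        fun z => (1 - ee z) * (qPochInf (ee (z + -τ⁻¹)) (ee (-τ⁻¹)) *
          qPochInf (ee (-τ⁻¹ - z)) (ee (-τ⁻¹))) := by
      funext z
      rw [qPochInf_eq_one_sub_mul (ee z) hqt, ← ee_add]
      ring
    have hd := ((hA (fun z => z + -τ⁻¹) _ (fun z => by fun_prop) hqt).mul
      (hA (fun z => -τ⁻¹ - z) _ (fun z => by fun_prop) hqt)) 0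
    have := ((hasDerivAt_ee 0).const_sub 1).mul hd.hasDerivAt
    have h2 := this.deriv
    rw [e]
    simp only [Pi.mul_def] at h2
    rw [h2]
    have n1 := qPochInf_ne_zero_of_norm_lt hqt hqt
    have := Real.pi_ne_zero
    simp [ee_zero, n1, this]

/-- The quantum dilogarithm to the right of its zeros and poles, where it is asymptotic to a
Gaussian. -/
lemma exists_phi_eq_right {τ : ℂ} (hτ : 0 < τ.im) : ∃ C : ℂ, ∀ z,
    (¬ ∃ m n : ℤ, z = m + n * τ⁻¹) →
    phi τ z = C * qPochInf (ee (-τ⁻¹ - z)) (ee (-τ⁻¹)) /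
      (qPochInf (ee (-(τ * z))) (ee τ) * gauss τ z) := by
  obtain ⟨C, hC⟩ := exists_theta_inversion hτ
  have hτ0 := ne_zero_of_im_pos hτ
  have hti' : 0 < (-τ⁻¹).im := by simpa using inv_im_neg hτ
  refine ⟨C, fun z hz => ?_⟩
  have h1 : qPochInf (ee z) (ee (-τ⁻¹)) ≠ 0 := fun h => by
    obtain ⟨m, n, h⟩ := qPochInf_ee_eq_zero_imp hti' h
    exact hz ⟨m, n, by rw [h]; push_cast; ring⟩
  have h2 : qPochInf (ee (-(τ * z))) (ee τ) ≠ 0 := fun h => by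
    obtain ⟨m, n, h⟩ := qPochInf_ee_eq_zero_imp hτ h
    refine hz ⟨n, -m, ?_⟩
    have : z = (-(m - n * τ)) * τ⁻¹ := by rw [← h]; field_simp
    rw [this]
    push_cast
    field_simp
    ring
  rw [phi, div_eq_div_iff h1 (mul_ne_zero h2 (gauss_ne_zero _ _))]
  linear_combination hC z

/-! ### Cauchy's theorem on parallelograms and in sectors -/

/-- Cauchy's theorem for a parallelogram, obtained from the divergence theorem on the rectangle
`[0, S] × [0, T]` after an affine change of variables. -/
lemma integral_parallelogram_eq_zero {g : ℂ → ℂ} {a u v : ℂ} {S T : ℝ} (hS : 0 ≤ S) (hT : 0 ≤ T)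
    (hg : ∀ s ∈ Set.Icc 0 S, ∀ t ∈ Set.Icc 0 T, DifferentiableAt ℂ g (a + s * u + t * v)) :
    u * (∫ s in (0 : ℝ)..S, g (a + s * u)) + v * (∫ t in (0 : ℝ)..T, g (a + S * u + t * v)) -
      u * (∫ s in (0 : ℝ)..S, g (a + s * u + T * v)) - v * (∫ t in (0 : ℝ)..T, g (a + t * v))
      = 0 := by
  let L : ℝ × ℝ →L[ℝ] ℂ := (ContinuousLinearMap.fst ℝ ℝ ℝ).smulRight u +
    (ContinuousLinearMap.snd ℝ ℝ ℝ).smulRight v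
  have hL (x : ℝ × ℝ) : L x = x.1 * u + x.2 * v := by simp [L]
  have hF (c : ℂ) (x : ℝ × ℝ) (hx : x ∈ Set.Icc 0 S ×ˢ Set.Icc 0 T) :
      HasFDerivAt (fun x : ℝ × ℝ => c * g (a + x.1 * u + x.2 * v))
        ((c * deriv g (a + x.1 * u + x.2 * v)) • L) x := by
    have h1 : HasFDerivAt (fun x : ℝ × ℝ => a + x.1 * u + x.2 * v) L x := by
      have := L.hasFDerivAt (x := x) |>.const_add a
      refine this.congr_of_eventuallyEq (.of_forall fun y => ?_)
      simp only [hL, add_assoc]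
    have h2 := ((hg x.1 hx.1 x.2 hx.2).hasDerivAt.const_mul c).comp_hasFDerivAt x h1
    exact h2
  have hsub : Set.Ioo (min 0 S) (max 0 S) ×ˢ Set.Ioo (min 0 T) (max 0 T) \ (∅ : Set (ℝ × ℝ)) ⊆
      Set.Icc 0 S ×ˢ Set.Icc 0 T := by
    rw [min_eq_left hS, max_eq_right hS, min_eq_left hT, max_eq_right hT]
    exact Set.sdiff_subset.trans (Set.prod_mono Set.Ioo_subset_Icc_self Set.Ioo_subset_Icc_self)
  have key := integral2_divergence_prod_of_hasFDerivAt_off_countable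
    (fun x : ℝ × ℝ => v * g (a + x.1 * u + x.2 * v))
    (fun x : ℝ × ℝ => -u * g (a + x.1 * u + x.2 * v))
    (fun x => (v * deriv g (a + x.1 * u + x.2 * v)) • L)
    (fun x => (-u * deriv g (a + x.1 * u + x.2 * v)) • L) 0 0 S T ∅ Set.countable_empty
    (fun x hx => by
      rw [Set.uIcc_of_le hS, Set.uIcc_of_le hT] at hx
      exact (hF v x hx).continuousAt.continuousWithinAt)
    (fun x hx => by
      rw [Set.uIcc_of_le hS, Set.uIcc_of_le hT] at hx
      exact (hF (-u) x hx).continuousAt.continuousWithinAt)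
    (fun x hx => hF v x (hsub hx)) (fun x hx => hF (-u) x (hsub hx))
  have hz (x y : ℝ) : ((v * deriv g (a + x * u + y * v)) • L) (1, 0) +
      ((-u * deriv g (a + x * u + y * v)) • L) (0, 1) = 0 := by
    simp only [smul_apply, hL, smul_eq_mul]
    push_cast
    ring
  simp only [hz, intervalIntegral.integral_zero, intervalIntegral.integral_const_mul] at key
  have := key integrableOn_zero
  simp only [ofReal_zero, zero_mul, add_zero] at this
  linear_combination -this

lemma integrableOn_ray {g : ℂ → ℂ} {a u : ℂ} {C κ : ℝ} (hκ : 0 < κ)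
    (hd : ∀ s : ℝ, 0 ≤ s → DifferentiableAt ℂ g (a + s * u))
    (hb : ∀ s : ℝ, 0 ≤ s → ‖g (a + s * u)‖ ≤ C * Real.exp (-κ * s)) :
    IntegrableOn (fun s : ℝ => g (a + s * u)) (Set.Ioi 0) := by
  have hc : ContinuousOn (fun s : ℝ => g (a + s * u)) (Set.Ioi 0) := fun s hs => by
    have h1 : ContinuousAt (fun s : ℝ => a + s * u) s := by fun_prop
    exact (ContinuousAt.comp (f := fun s : ℝ => a + s * u) (g := g)
      (hd s (le_of_lt hs)).continuousAt h1).continuousWithinAt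
  refine Integrable.mono' ((integrableOn_exp_mul_Ioi (neg_lt_zero.2 hκ) 0).const_mul C)
    (hc.aestronglyMeasurable measurableSet_Ioi) ?_
  exact (ae_restrict_iff' measurableSet_Ioi).2 (.of_forall fun s hs => hb s (le_of_lt hs))

/-- In a sector where a holomorphic function decays exponentially, the integrals along the two
bounding rays agree. -/
lemma tendsto_integral_sector {g : ℂ → ℂ} {a u v : ℂ} {C κ : ℝ} (hκ : 0 < κ)
    (hd : ∀ s t : ℝ, 0 ≤ s → 0 ≤ t → DifferentiableAt ℂ g (a + s * u + t * v))
    (hb : ∀ s t : ℝ, 0 ≤ s → 0 ≤ t →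
      ‖g (a + s * u + t * v)‖ ≤ C * Real.exp (-κ * (s + t))) :
    Tendsto (fun n : ℕ => v * ∫ t in (0 : ℝ)..n, g (a + t * v)) atTop
      (𝓝 (u * ∫ s in Set.Ioi (0 : ℝ), g (a + s * u))) := by
  have hint := integrableOn_ray (a := a) (u := u) hκ (fun s hs => by simpa using hd s 0 hs le_rfl)
    (fun s hs => by simpa using hb s 0 hs le_rfl)
  have h1 : Tendsto (fun n : ℕ => u * ∫ s in (0 : ℝ)..n, g (a + s * u)) atTop
      (𝓝 (u * ∫ s in Set.Ioi (0 : ℝ), g (a + s * u))) :=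
    (intervalIntegral_tendsto_integral_Ioi 0 hint tendsto_natCast_atTop_atTop).const_mul u
  have hsmall : Tendsto (fun n : ℕ => C * ((n : ℝ) * Real.exp (-κ * n))) atTop (𝓝 0) := by
    have h := (Real.tendsto_pow_mul_exp_neg_atTop_nhds_zero 1).comp
      ((tendsto_natCast_atTop_atTop (R := ℝ)).const_mul_atTop hκ)
    have h2 := h.const_mul (C * κ⁻¹)
    rw [mul_zero] at h2
    refine h2.congr fun n => ?_
    simp only [Function.comp_apply, pow_one]
    field_simp
  have hside (p w : ℂ) (n : ℕ) (hp : ∀ t ∈ Set.Icc (0 : ℝ) n,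
      ‖g (p + t * w)‖ ≤ C * Real.exp (-κ * n)) :
      ‖∫ t in (0 : ℝ)..n, g (p + t * w)‖ ≤ C * ((n : ℝ) * Real.exp (-κ * n)) := by
    have := intervalIntegral.norm_integral_le_of_norm_le_const (a := (0 : ℝ)) (b := n)
      (f := fun t : ℝ => g (p + t * w)) (C := C * Real.exp (-κ * n)) (fun t ht => by
        rw [Set.uIoc_of_le (Nat.cast_nonneg n)] at ht
        exact hp t ⟨ht.1.le, ht.2⟩)
    simp only [sub_zero, Nat.abs_cast] at this
    linarith
  have hC : 0 ≤ C := by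
    have := (norm_nonneg _).trans (hb 0 0 le_rfl le_rfl)
    simpa using this
  have h2 : Tendsto (fun n : ℕ => v * ∫ t in (0 : ℝ)..n, g (a + n * u + t * v)) atTop (𝓝 0) := by
    have : Tendsto (fun n : ℕ => ∫ t in (0 : ℝ)..n, g (a + n * u + t * v)) atTop (𝓝 0) :=
      squeeze_zero_norm (fun n => hside _ _ n fun t ht => by
        have := hb n t (Nat.cast_nonneg n) ht.1
        refine le_trans (by exact_mod_cast this) ?_
        exact mul_le_mul_of_nonneg_left (Real.exp_le_exp.2 (by nlinarith [ht.1])) hC) hsmall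
    simpa using this.const_mul v
  have h3 : Tendsto (fun n : ℕ => u * ∫ s in (0 : ℝ)..n, g (a + s * u + n * v)) atTop (𝓝 0) := by
    have : Tendsto (fun n : ℕ => ∫ s in (0 : ℝ)..n, g (a + s * u + n * v)) atTop (𝓝 0) := by
      refine squeeze_zero_norm (fun n => ?_) hsmall
      have e : (fun s : ℝ => g (a + s * u + n * v)) = fun s : ℝ => g (a + n * v + s * u) := by
        funext s; congr 1; ring
      rw [e]
      refine hside _ _ n fun t ht => ?_
      have := hb t n ht.1 (Nat.cast_nonneg n)
      rw [show a + n * v + t * u = a + t * u + n * v by ring]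
      refine le_trans (by exact_mod_cast this) ?_
      exact mul_le_mul_of_nonneg_left (Real.exp_le_exp.2 (by nlinarith [ht.1])) hC
    simpa using this.const_mul u
  have := (h1.add h2).sub h3
  simp only [add_zero, sub_zero] at this
  refine this.congr fun n => ?_
  have := integral_parallelogram_eq_zero (g := g) (a := a) (u := u) (v := v) (S := n) (T := n)
    (Nat.cast_nonneg n) (Nat.cast_nonneg n) fun s hs t ht => hd s t hs.1 ht.1
  push_cast at this
  linear_combination this

/-! ### Residues in a period parallelogram -/

/-- The integral of `φ` along the positively oriented boundary of the parallelogram with corners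
`a`, `a + 1`, `a + 1 + ω`, `a + ω`, grouped by pairs of parallel sides. -/
def perInt (a ω : ℂ) (φ : ℂ → ℂ) : ℂ :=
  (∫ t in (0 : ℝ)..1, (φ (a + t) - φ (a + ω + t))) -
    ω * ∫ t in (0 : ℝ)..1, (φ (a + t * ω) - φ (a + 1 + t * ω))

/-- Continuity along the boundary of the parallelogram with corner `a` and sides `1`, `ω`. -/
def BdryCont (a ω : ℂ) (φ : ℂ → ℂ) : Prop :=
  ∀ t ∈ Set.Icc (0 : ℝ) 1, ContinuousAt φ (a + t) ∧ ContinuousAt φ (a + ω + t) ∧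
    ContinuousAt φ (a + t * ω) ∧ ContinuousAt φ (a + 1 + t * ω)

lemma intervalIntegrable_of_continuousAt {φ : ℂ → ℂ} {f : ℝ → ℂ} (hf : Continuous f)
    (h : ∀ t ∈ Set.Icc (0 : ℝ) 1, ContinuousAt φ (f t)) :
    IntervalIntegrable (fun t => φ (f t)) volume 0 1 := by
  refine ContinuousOn.intervalIntegrable fun t ht => ?_
  rw [Set.uIcc_of_le zero_le_one] at ht
  exact (ContinuousAt.comp (g := φ) (h t ht) hf.continuousAt).continuousWithinAt

lemma BdryCont.intervalIntegrable {a ω : ℂ} {φ : ℂ → ℂ} (h : BdryCont a ω φ) :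
    IntervalIntegrable (fun t : ℝ => φ (a + t)) volume 0 1 ∧
    IntervalIntegrable (fun t : ℝ => φ (a + ω + t)) volume 0 1 ∧
    IntervalIntegrable (fun t : ℝ => φ (a + t * ω)) volume 0 1 ∧
    IntervalIntegrable (fun t : ℝ => φ (a + 1 + t * ω)) volume 0 1 :=
  ⟨intervalIntegrable_of_continuousAt (by fun_prop) fun t ht => (h t ht).1,
    intervalIntegrable_of_continuousAt (by fun_prop) fun t ht => (h t ht).2.1,
    intervalIntegrable_of_continuousAt (by fun_prop) fun t ht => (h t ht).2.2.1,
    intervalIntegrable_of_continuousAt (by fun_prop) fun t ht => (h t ht).2.2.2⟩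

lemma BdryCont.add {a ω : ℂ} {φ ψ : ℂ → ℂ} (h : BdryCont a ω φ) (h' : BdryCont a ω ψ) :
    BdryCont a ω (fun z => φ z + ψ z) := fun t ht =>
  ⟨(h t ht).1.add (h' t ht).1, (h t ht).2.1.add (h' t ht).2.1, (h t ht).2.2.1.add (h' t ht).2.2.1,
    (h t ht).2.2.2.add (h' t ht).2.2.2⟩

lemma BdryCont.const_mul {a ω : ℂ} {φ : ℂ → ℂ} (h : BdryCont a ω φ) (c : ℂ) :
    BdryCont a ω (fun z => c * φ z) := fun t ht =>
  ⟨(h t ht).1.const_mul c, (h t ht).2.1.const_mul c, (h t ht).2.2.1.const_mul c,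
    (h t ht).2.2.2.const_mul c⟩

lemma BdryCont.sum {ι : Type*} {a ω : ℂ} {φ : ι → ℂ → ℂ} (s : Finset ι)
    (h : ∀ i ∈ s, BdryCont a ω (φ i)) : BdryCont a ω (fun z => ∑ i ∈ s, φ i z) := by
  classical
  induction s using Finset.induction_on with
  | empty => intro t _; simp [continuousAt_const]
  | insert i s hi ih =>
    simp only [Finset.sum_insert hi]
    exact (h i (mem_insert_self _ _)).add (ih fun j hj => h j (mem_insert_of_mem hj))

lemma perInt_add {a ω : ℂ} {φ ψ : ℂ → ℂ} (h : BdryCont a ω φ) (h' : BdryCont a ω ψ) :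
    perInt a ω (fun z => φ z + ψ z) = perInt a ω φ + perInt a ω ψ := by
  obtain ⟨h1, h2, h3, h4⟩ := h.intervalIntegrable
  obtain ⟨h1', h2', h3', h4'⟩ := h'.intervalIntegrable
  simp only [perInt]
  rw [intervalIntegral.integral_sub (h1.add h1') (h2.add h2'),
    intervalIntegral.integral_sub (h3.add h3') (h4.add h4'),
    intervalIntegral.integral_add h1 h1', intervalIntegral.integral_add h2 h2',
    intervalIntegral.integral_add h3 h3', intervalIntegral.integral_add h4 h4',
    intervalIntegral.integral_sub h1 h2, intervalIntegral.integral_sub h3 h4,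
    intervalIntegral.integral_sub h1' h2', intervalIntegral.integral_sub h3' h4']
  ring

lemma perInt_const_mul (a ω c : ℂ) (φ : ℂ → ℂ) :
    perInt a ω (fun z => c * φ z) = c * perInt a ω φ := by
  simp only [perInt, ← mul_sub, intervalIntegral.integral_const_mul]
  ring

lemma perInt_sum {ι : Type*} {a ω : ℂ} {φ : ι → ℂ → ℂ} (s : Finset ι)
    (h : ∀ i ∈ s, BdryCont a ω (φ i)) :
    perInt a ω (fun z => ∑ i ∈ s, φ i z) = ∑ i ∈ s, perInt a ω (φ i) := by
  classical
  induction s using Finset.induction_on with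
  | empty => simp [perInt]
  | insert i s hi ih =>
    simp only [Finset.sum_insert hi]
    rw [perInt_add (h i (mem_insert_self _ _))
      (BdryCont.sum s fun j hj => h j (mem_insert_of_mem hj)),
      ih fun j hj => h j (mem_insert_of_mem hj)]

lemma perInt_eq_zero {a ω : ℂ} {φ : ℂ → ℂ}
    (h : ∀ s ∈ Set.Icc (0 : ℝ) 1, ∀ t ∈ Set.Icc (0 : ℝ) 1,
      DifferentiableAt ℂ φ (a + s + t * ω)) : perInt a ω φ = 0 := by
  have key := integral_parallelogram_eq_zero (g := φ) (a := a) (u := 1) (v := ω) zero_le_one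
    zero_le_one (by simpa using h)
  have hb : BdryCont a ω φ := fun t ht => by
    have z0 : (0 : ℝ) ∈ Set.Icc (0 : ℝ) 1 := by simp
    have z1 : (1 : ℝ) ∈ Set.Icc (0 : ℝ) 1 := by simp
    have k1 := (h t ht 0 z0).continuousAt
    have k2 := (h t ht 1 z1).continuousAt
    have k3 := (h 0 z0 t ht).continuousAt
    have k4 := (h 1 z1 t ht).continuousAt
    simp only [ofReal_zero, ofReal_one, zero_mul, one_mul, add_zero] at k1 k2 k3 k4
    refine ⟨k1, ?_, k3, k4⟩
    rwa [add_right_comm]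
  obtain ⟨h1, h2, h3, h4⟩ := hb.intervalIntegrable
  simp only [mul_one, ofReal_one, one_mul] at key
  rw [perInt, intervalIntegral.integral_sub h1 h2, intervalIntegral.integral_sub h3 h4]
  have e : (fun s : ℝ => φ (a + s + ω)) = fun s : ℝ => φ (a + ω + s) := by
    funext s; rw [add_right_comm]
  rw [e] at key
  linear_combination key

/-- Real coordinates with respect to `1, ω` are unique. -/
lemma coords_unique {ω : ℂ} (hω : ω.im ≠ 0) {s t s' t' : ℝ}
    (h : (s + t * ω : ℂ) = s' + t' * ω) : s = s' ∧ t = t' := by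
  have h1 := congrArg Complex.im h
  simp [hω] at h1
  have h2 := congrArg Complex.re h
  simp [h1] at h2
  exact ⟨h2, h1⟩

/-- Cauchy's theorem for a function with removable singularities at finitely many points, none of
which lies on the boundary. The values of `φ` at these points are irrelevant. -/
lemma perInt_eq_zero_of_removable {a ω : ℂ} {φ : ℂ → ℂ} (S : Finset ℂ)
    (hS : ∀ p ∈ S, ∀ t ∈ Set.Icc (0 : ℝ) 1, a + t ≠ p ∧ a + ω + t ≠ p ∧ a + t * ω ≠ p ∧
      a + 1 + t * ω ≠ p)
    (h : ∀ s ∈ Set.Icc (0 : ℝ) 1, ∀ t ∈ Set.Icc (0 : ℝ) 1, a + s + t * ω ∉ S →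
      DifferentiableAt ℂ φ (a + s + t * ω))
    (hr : ∀ p ∈ S, ∃ ψ, AnalyticAt ℂ ψ p ∧ φ =ᶠ[𝓝[≠] p] ψ) : perInt a ω φ = 0 := by
  classical
  let φ' : ℂ → ℂ := fun z => if z ∈ S then limUnder (𝓝[≠] z) φ else φ z
  have hd : perInt a ω φ' = 0 := by
    refine perInt_eq_zero fun s hs t ht => ?_
    set z := a + s + t * ω with hz
    have hfin : ∀ᶠ w in 𝓝[≠] z, w ∉ S := by
      have : ((S : Set ℂ) \ {z})ᶜ ∈ 𝓝 z :=
        (S.finite_toSet.subset Set.sdiff_subset).isClosed.isOpen_compl.mem_nhds (by simp)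
      filter_upwards [mem_nhdsWithin_of_mem_nhds this, self_mem_nhdsWithin] with w hw hw2 hw3
      exact hw ⟨hw3, hw2⟩
    by_cases hzS : z ∈ S
    · obtain ⟨ψ, hψ, he⟩ := hr z hzS
      refine hψ.differentiableAt.congr_of_eventuallyEq ?_
      have hlim : limUnder (𝓝[≠] z) φ = ψ z :=
        ((hψ.continuousAt.tendsto.mono_left nhdsWithin_le_nhds).congr' he.symm).limUnder_eq
      have h2 : φ' =ᶠ[𝓝[≠] z] ψ := by
        filter_upwards [hfin, he] with w hw hw2
        simp [φ', hw, hw2]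
      have h3 : φ' z = ψ z := by simp [φ', hzS, hlim]
      exact eventuallyEq_nhds_of_eventuallyEq_nhdsNE h2 h3
    · refine (h s hs t ht hzS).congr_of_eventuallyEq ?_
      exact eventuallyEq_nhds_of_eventuallyEq_nhdsNE
        (hfin.mono fun w hw => by simp [φ', hw]) (show φ' z = φ z by simp [φ', hzS])
  rw [← hd]
  have hne (f : ℝ → ℂ) (hf : ∀ t ∈ Set.Icc (0 : ℝ) 1, ∀ p ∈ S, f t ≠ p) :
      ∀ t ∈ Set.Icc (0 : ℝ) 1, φ (f t) = φ' (f t) := fun t ht => by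
    have : f t ∉ S := fun h => hf t ht _ h rfl
    simp [φ', this]
  have e1 := hne (fun t => a + t) fun t ht p hp => (hS p hp t ht).1
  have e2 := hne (fun t => a + ω + t) fun t ht p hp => (hS p hp t ht).2.1
  have e3 := hne (fun t => a + t * ω) fun t ht p hp => (hS p hp t ht).2.2.1
  have e4 := hne (fun t => a + 1 + t * ω) fun t ht p hp => (hS p hp t ht).2.2.2
  rw [perInt, perInt]
  congr 1
  · refine intervalIntegral.integral_congr fun t ht => ?_
    rw [Set.uIcc_of_le zero_le_one] at ht
    simp only [e1 t ht, e2 t ht]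
  · congr 1
    refine intervalIntegral.integral_congr fun t ht => ?_
    rw [Set.uIcc_of_le zero_le_one] at ht
    simp only [e3 t ht, e4 t ht]

/-- The `1`-periodic function `1 / (1 - exp(2πi(z - p)))`, with a simple pole at `p`, in terms of
which principal parts are expressed. -/
def kap (p z : ℂ) : ℂ := (1 - ee (z - p))⁻¹

lemma kap_add_one (p z : ℂ) : kap p (z + 1) = kap p z := by
  rw [kap, kap, add_sub_right_comm, ee_add_one]

lemma analyticAt_kap {p z : ℂ} (h : ee (z - p) ≠ 1) : AnalyticAt ℂ (kap p) z := by
  have h1 : AnalyticAt ℂ (fun z => 1 - ee (z - p)) z :=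
    analyticAt_const.sub (analyticAt_ee (by fun_prop))
  exact h1.inv (sub_ne_zero.2 h.symm)

lemma hasDerivAt_ee_add (w : ℂ) (t : ℝ) :
    HasDerivAt (fun t : ℝ => ee (w + t)) (2 * Real.pi * I * ee (w + t)) t := by
  have h1 : HasDerivAt (fun t : ℝ => w + (t : ℂ)) 1 t := by
    simpa using (ofRealCLM.hasDerivAt (x := t)).const_add w
  have := HasDerivAt.comp t (hasDerivAt_ee (w + t)) h1
  rw [mul_one] at this
  exact this

lemma ee_add_ne_one {w : ℂ} (hw : w.im ≠ 0) (t : ℝ) : ee (w + t) ≠ 1 := by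
  rw [Ne, ee_eq_one_iff]
  rintro ⟨n, hn⟩
  have := congrArg Complex.im hn
  simp at this
  exact hw this

lemma one_sub_mem_slitPlane {y : ℂ} (hy : ‖y‖ < 1) : 1 - y ∈ slitPlane := by
  left
  have := (abs_re_le_norm y).trans_lt hy
  rw [abs_lt] at this
  simp
  linarith

lemma integral_inv_one_sub_ee_of_pos {w : ℂ} (hw : 0 < w.im) :
    ∫ t in (0 : ℝ)..1, (1 - ee (w + t))⁻¹ = 1 := by
  have hne (t : ℝ) : 1 - ee (w + t) ≠ 0 := sub_ne_zero.2 (ee_add_ne_one hw.ne' t).symm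
  have hlt (t : ℝ) : ‖ee (w + t)‖ < 1 := norm_ee_lt_one (by simpa using hw)
  have hd : ∀ t ∈ Set.uIcc (0 : ℝ) 1,
      HasDerivAt (fun t : ℝ => (t : ℂ) - (2 * Real.pi * I)⁻¹ * Complex.log (1 - ee (w + t)))
        ((1 - ee (w + t))⁻¹) t := fun t _ => by
    have h1 := ((hasDerivAt_ee_add w t).const_sub 1).clog_real (one_sub_mem_slitPlane (hlt t))
    have h2 := (ofRealCLM.hasDerivAt (x := t)).sub (h1.const_mul (2 * Real.pi * I : ℂ)⁻¹)
    refine h2.congr_deriv ?_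
    have := two_pi_I_ne_zero
    have := hne t
    simp only [ofRealCLM_apply, ofReal_one]
    field_simp
    ring
  have hc : Continuous fun t : ℝ => (1 - ee (w + t))⁻¹ :=
    (continuous_const.sub (continuous_ee.comp (by fun_prop))).inv₀ hne
  rw [intervalIntegral.integral_eq_sub_of_hasDerivAt hd (hc.intervalIntegrable _ _)]
  simp [ee_add_one]

lemma integral_inv_one_sub_ee_of_neg {w : ℂ} (hw : w.im < 0) :
    ∫ t in (0 : ℝ)..1, (1 - ee (w + t))⁻¹ = 0 := by
  have h1 : ∀ t : ℝ, (1 - ee (w + t))⁻¹ = 1 - (1 - (ee (w + t))⁻¹)⁻¹ := fun t => by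
    have h2 : 1 - ee (w + t) ≠ 0 := sub_ne_zero.2 (ee_add_ne_one hw.ne t).symm
    have h3 := ee_ne_zero (w + t)
    have h4 : ee (w + t) - 1 ≠ 0 := sub_ne_zero.2 (ee_add_ne_one hw.ne t)
    have h5 : 1 - (ee (w + t))⁻¹ ≠ 0 := by
      rw [show 1 - (ee (w + t))⁻¹ = (ee (w + t) - 1) / ee (w + t) by field_simp]
      exact div_ne_zero h4 h3
    field_simp
    ring
  have h6 : ∫ t in (0 : ℝ)..1, (1 - (ee (w + t))⁻¹)⁻¹ = 1 := by
    have h7 := intervalIntegral.integral_comp_sub_left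
      (fun t : ℝ => (1 - ee (-w - 1 + t))⁻¹) (a := 0) (b := 1) 1
    rw [sub_self, sub_zero, integral_inv_one_sub_ee_of_pos (by simpa using hw)] at h7
    rw [← h7]
    refine intervalIntegral.integral_congr fun t _ => ?_
    simp only [← ee_neg]
    congr 3
    push_cast
    ring
  have hc : Continuous fun t : ℝ => (1 - (ee (w + t))⁻¹)⁻¹ := by
    have hc1 : Continuous fun t : ℝ => (ee (w + t))⁻¹ :=
      (continuous_ee.comp (by fun_prop)).inv₀ fun t => ee_ne_zero _
    refine (continuous_const.sub hc1).inv₀ fun t ht => ?_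
    change 1 - (ee (w + t))⁻¹ = 0 at ht
    rw [sub_eq_zero, eq_comm, inv_eq_one] at ht
    exact ee_add_ne_one hw.ne t ht
  simp_rw [h1]
  rw [intervalIntegral.integral_sub (by simp) (hc.intervalIntegrable _ _), h6]
  simp

lemma integral_inv_one_sub_ee_pow {w : ℂ} (hw : w.im ≠ 0) (k : ℕ) :
    ∫ t in (0 : ℝ)..1, (1 - ee (w + t))⁻¹ ^ (k + 2) =
      ∫ t in (0 : ℝ)..1, (1 - ee (w + t))⁻¹ ^ (k + 1) := by
  have hne (t : ℝ) : 1 - ee (w + t) ≠ 0 := sub_ne_zero.2 (ee_add_ne_one hw t).symm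
  have hc (n : ℕ) : Continuous fun t : ℝ => (1 - ee (w + t))⁻¹ ^ n :=
    ((continuous_const.sub (continuous_ee.comp (by fun_prop))).inv₀ hne).pow n
  rw [← sub_eq_zero, ← intervalIntegral.integral_sub ((hc _).intervalIntegrable _ _)
    ((hc _).intervalIntegrable _ _)]
  have hd : ∀ t ∈ Set.uIcc (0 : ℝ) 1,
      HasDerivAt (fun t : ℝ => (2 * Real.pi * I * (k + 1))⁻¹ * (1 - ee (w + t))⁻¹ ^ (k + 1))
        ((1 - ee (w + t))⁻¹ ^ (k + 2) - (1 - ee (w + t))⁻¹ ^ (k + 1)) t := fun t _ => by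
    have h1 := ((((hasDerivAt_ee_add w t).const_sub 1).inv (hne t)).pow (k + 1)).const_mul
      (2 * Real.pi * I * (k + 1) : ℂ)⁻¹
    refine h1.congr_deriv ?_
    have h2 := two_pi_I_ne_zero
    have h3 := hne t
    have h4 : (k + 1 : ℂ) ≠ 0 := by exact_mod_cast k.succ_ne_zero
    simp only [Pi.inv_apply, inv_pow, Nat.cast_add, Nat.cast_one, Nat.add_sub_cancel]
    field_simp
    ring
  rw [intervalIntegral.integral_eq_sub_of_hasDerivAt hd
    (((hc _).sub (hc _)).intervalIntegrable _ _)]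
  simp [ee_add_one]

lemma integral_inv_one_sub_ee_pow_of_pos {w : ℂ} (hw : 0 < w.im) (k : ℕ) :
    ∫ t in (0 : ℝ)..1, (1 - ee (w + t))⁻¹ ^ (k + 1) = 1 := by
  induction k with
  | zero => simpa using integral_inv_one_sub_ee_of_pos hw
  | succ k ih => rw [integral_inv_one_sub_ee_pow hw.ne', ih]

lemma integral_inv_one_sub_ee_pow_of_neg {w : ℂ} (hw : w.im < 0) (k : ℕ) :
    ∫ t in (0 : ℝ)..1, (1 - ee (w + t))⁻¹ ^ (k + 1) = 0 := by
  induction k with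
  | zero => simpa using integral_inv_one_sub_ee_of_neg hw
  | succ k ih => rw [integral_inv_one_sub_ee_pow hw.ne, ih]

/-- The powers of `kap` have boundary integral `1`: by periodicity the slanted sides cancel, and the
difference of the horizontal sides is that of the limits `1` and `0` of `kap` as `Im z → ±∞`. -/
lemma perInt_kap_pow {a ω : ℂ} (hω : ω.im < 0) {α β : ℝ} (hβ : β ∈ Set.Ioo (0 : ℝ) 1)
    (k : ℕ) : perInt a ω (fun z => kap (a + α + β * ω) z ^ (k + 1)) = 1 := by
  have e1 : ∀ t : ℝ, kap (a + α + β * ω) (a + t * ω) ^ (k + 1) -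
      kap (a + α + β * ω) (a + 1 + t * ω) ^ (k + 1) = 0 := fun t => by
    rw [add_right_comm a 1, kap_add_one, sub_self]
  have him1 : 0 < (-(α + β * ω) : ℂ).im := by
    simp
    nlinarith [hβ.1]
  have him2 : ((1 - β) * ω - α : ℂ).im < 0 := by
    simp
    nlinarith [hβ.2]
  have hc (w : ℂ) (hw : w.im ≠ 0) : IntervalIntegrable
      (fun t : ℝ => (1 - ee (w + t))⁻¹ ^ (k + 1)) volume 0 1 := by
    have hne (t : ℝ) : 1 - ee (w + t) ≠ 0 := sub_ne_zero.2 (ee_add_ne_one hw t).symm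
    exact (((continuous_const.sub (continuous_ee.comp (by fun_prop))).inv₀ hne).pow
      _).intervalIntegrable _ _
  have e2 : ∀ t : ℝ, kap (a + α + β * ω) (a + t) = (1 - ee (-(α + β * ω) + t))⁻¹ := fun t => by
    rw [kap]; congr 3; ring
  have e3 : ∀ t : ℝ, kap (a + α + β * ω) (a + ω + t) = (1 - ee ((1 - β) * ω - α + t))⁻¹ :=
    fun t => by rw [kap]; congr 3; ring
  simp only [perInt, e1, e2, e3]
  rw [intervalIntegral.integral_sub (hc _ him1.ne') (hc _ him2.ne),
    integral_inv_one_sub_ee_pow_of_pos him1, integral_inv_one_sub_ee_pow_of_neg him2]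
  simp

lemma ee_sub_ne_one_of_cell {a ω : ℂ} (hω : ω.im < 0) {α β s t : ℝ}
    (hα : α ∈ Set.Ioo (0 : ℝ) 1) (hs : s ∈ Set.Icc (0 : ℝ) 1)
    (hne : a + s + t * ω ≠ a + α + β * ω) : ee (a + s + t * ω - (a + α + β * ω)) ≠ 1 := by
  rw [Ne, ee_eq_one_iff]
  rintro ⟨n, hn⟩
  have h1 : (((s - α : ℝ) : ℂ) + ((t - β : ℝ) : ℂ) * ω) = ((n : ℝ) : ℂ) + ((0 : ℝ) : ℂ) * ω := by
    push_cast
    linear_combination hn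
  obtain ⟨h2, h3⟩ := coords_unique hω.ne h1
  have h4 : (n : ℝ) < 1 := by linarith [hα.1, hs.2]
  have h5 : (-1 : ℝ) < n := by linarith [hα.2, hs.1]
  have h6 : n < 1 := by exact_mod_cast h4
  have h7 : -1 < n := by exact_mod_cast h5
  obtain rfl : n = 0 := by omega
  apply hne
  have h8 : s = α := by simpa [sub_eq_zero] using h2
  have h9 : t = β := by linarith
  rw [h8, h9]

/-- The residue theorem for a period parallelogram, for principal parts written in powers of
`kap`. Each of these powers contributes `1`. -/
theorem perInt_eq_sum {a ω : ℂ} (hω : ω.im < 0) (S : Finset ℂ)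
    (hS : ∀ p ∈ S, ∃ α ∈ Set.Ioo (0 : ℝ) 1, ∃ β ∈ Set.Ioo (0 : ℝ) 1, p = a + α + β * ω)
    {G : ℂ → ℂ} (hG : ∀ s ∈ Set.Icc (0 : ℝ) 1, ∀ t ∈ Set.Icc (0 : ℝ) 1, a + s + t * ω ∉ S →
      DifferentiableAt ℂ G (a + s + t * ω)) (c₁ c₂ c₃ : ℂ → ℂ)
    (hr : ∀ p ∈ S, ∃ ψ, AnalyticAt ℂ ψ p ∧ G =ᶠ[𝓝[≠] p] fun z =>
      ψ z + (c₁ p * kap p z + c₂ p * kap p z ^ 2 + c₃ p * kap p z ^ 3)) :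
    perInt a ω G = ∑ p ∈ S, (c₁ p + c₂ p + c₃ p) := by
  classical
  set Q : ℂ → ℂ → ℂ := fun p z => c₁ p * kap p z + c₂ p * kap p z ^ 2 + c₃ p * kap p z ^ 3
    with hQ
  have hkap : ∀ p ∈ S, ∀ s ∈ Set.Icc (0 : ℝ) 1, ∀ t : ℝ, a + s + t * ω ≠ p →
      AnalyticAt ℂ (kap p) (a + s + t * ω) := by
    intro p hp s hs t hne
    obtain ⟨α, hα, β, hβ, rfl⟩ := hS p hp
    exact analyticAt_kap (ee_sub_ne_one_of_cell hω hα hs hne)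
  have hQa : ∀ p ∈ S, ∀ s ∈ Set.Icc (0 : ℝ) 1, ∀ t : ℝ, a + s + t * ω ≠ p →
      AnalyticAt ℂ (Q p) (a + s + t * ω) := fun p hp s hs t hne => by
    have := hkap p hp s hs t hne
    exact ((analyticAt_const.mul this).add (analyticAt_const.mul (this.pow 2))).add
      (analyticAt_const.mul (this.pow 3))
  have z0 : (0 : ℝ) ∈ Set.Icc (0 : ℝ) 1 := by simp
  have z1 : (1 : ℝ) ∈ Set.Icc (0 : ℝ) 1 := by simp
  have hform (t : ℝ) : a + t = a + t + (0 : ℝ) * ω ∧ a + ω + t = a + t + (1 : ℝ) * ω ∧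
      a + t * ω = a + (0 : ℝ) + t * ω ∧ a + 1 + t * ω = a + (1 : ℝ) + t * ω := by
    refine ⟨?_, ?_, ?_, ?_⟩ <;> push_cast <;> ring
  have hne : ∀ p ∈ S, ∀ t ∈ Set.Icc (0 : ℝ) 1, a + t ≠ p ∧ a + ω + t ≠ p ∧ a + t * ω ≠ p ∧
      a + 1 + t * ω ≠ p := by
    intro p hp t ht
    obtain ⟨α, hα, β, hβ, rfl⟩ := hS p hp
    have key (s' t' : ℝ) (h : a + s' + t' * ω = a + α + β * ω) : s' = α ∧ t' = β :=
      coords_unique hω.ne (by linear_combination h)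
    obtain ⟨f1, f2, f3, f4⟩ := hform t
    rw [f1, f2, f3, f4]
    refine ⟨fun h => ?_, fun h => ?_, fun h => ?_, fun h => ?_⟩
    · exact hβ.1.ne (key _ _ h).2
    · exact hβ.2.ne' (key _ _ h).2
    · exact hα.1.ne (key _ _ h).1
    · exact hα.2.ne' (key _ _ h).1
  have hbd (φ : ℂ → ℂ) (hφ : ∀ s ∈ Set.Icc (0 : ℝ) 1, ∀ t ∈ Set.Icc (0 : ℝ) 1,
      a + s + t * ω ∉ S → ContinuousAt φ (a + s + t * ω)) : BdryCont a ω φ := fun t ht => by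
    obtain ⟨f1, f2, f3, f4⟩ := hform t
    have hn (x : ℂ) (hx : ∀ p ∈ S, x ≠ p) : x ∉ S := fun h => hx x h rfl
    have n1 := hn _ fun p hp => (hne p hp t ht).1
    have n2 := hn _ fun p hp => (hne p hp t ht).2.1
    have n3 := hn _ fun p hp => (hne p hp t ht).2.2.1
    have n4 := hn _ fun p hp => (hne p hp t ht).2.2.2
    rw [f1] at n1 ⊢
    rw [f2] at n2 ⊢
    rw [f3] at n3 ⊢
    rw [f4] at n4 ⊢
    exact ⟨hφ t ht 0 z0 n1, hφ t ht 1 z1 n2, hφ 0 z0 t ht n3, hφ 1 z1 t ht n4⟩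
  have hbG : BdryCont a ω G := hbd G fun s hs t ht h => (hG s hs t ht h).continuousAt
  have hbk (k : ℕ) (c : ℂ) (p : ℂ) (hp : p ∈ S) : BdryCont a ω (fun z => c * kap p z ^ k) :=
    hbd _ fun s hs t ht h => continuousAt_const.mul
      ((hkap p hp s hs t fun h' => h (h' ▸ hp)).continuousAt.pow k)
  have hbQ (p : ℂ) (hp : p ∈ S) : BdryCont a ω (Q p) :=
    hbd _ fun s hs t ht h => (hQa p hp s hs t fun h' => h (h' ▸ hp)).continuousAt
  have hzero : perInt a ω (fun z => G z + (-1) * ∑ p ∈ S, Q p z) = 0 := by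
    refine perInt_eq_zero_of_removable S hne (fun s hs t ht h => ?_) fun p hp => ?_
    · refine (hG s hs t ht h).add ((DifferentiableAt.fun_sum fun p hp => ?_).const_mul _)
      exact (hQa p hp s hs t fun h' => h (h' ▸ hp)).differentiableAt
    · obtain ⟨ψ, hψ, he⟩ := hr p hp
      refine ⟨fun z => ψ z - ∑ p' ∈ S.erase p, Q p' z, hψ.sub ?_, ?_⟩
      · refine Finset.analyticAt_fun_sum _ fun p' hp' => ?_
        obtain ⟨α, hα, β, hβ, hpe⟩ := hS p hp
        have h1 := hQa p' (Finset.mem_of_mem_erase hp') α ⟨hα.1.le, hα.2.le⟩ β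
          (by rw [← hpe]; exact (Finset.ne_of_mem_erase hp').symm)
        rwa [← hpe] at h1
      · filter_upwards [he] with z hz
        rw [hz, ← Finset.add_sum_erase S (fun p => Q p z) hp]
        simp only [hQ]
        ring
  rw [perInt_add hbG ((BdryCont.sum S hbQ).const_mul _), perInt_const_mul, perInt_sum S hbQ]
    at hzero
  have hQ1 : ∀ p ∈ S, perInt a ω (Q p) = c₁ p + c₂ p + c₃ p := fun p hp => by
    have e : Q p = fun z => c₁ p * kap p z ^ 1 + c₂ p * kap p z ^ 2 + c₃ p * kap p z ^ 3 := by
      funext z; simp [hQ]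
    rw [e, perInt_add ((hbk 1 _ p hp).add (hbk 2 _ p hp)) (hbk 3 _ p hp),
      perInt_add (hbk 1 _ p hp) (hbk 2 _ p hp), perInt_const_mul, perInt_const_mul,
      perInt_const_mul]
    obtain ⟨α, hα, β, hβ, rfl⟩ := hS p hp
    have h1 := perInt_kap_pow (a := a) hω (α := α) hβ 0
    have h2 := perInt_kap_pow (a := a) hω (α := α) hβ 1
    have h3 := perInt_kap_pow (a := a) hω (α := α) hβ 2
    simp only [zero_add, Nat.reduceAdd] at h1 h2 h3
    rw [h1, h2, h3]
    ring
  rw [Finset.sum_congr rfl hQ1] at hzero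
  linear_combination hzero

lemma analyticAt_dslope {M : ℂ → ℂ} {p : ℂ} (hM : AnalyticAt ℂ M p) :
    AnalyticAt ℂ (dslope M p) p := by
  obtain ⟨P, hP⟩ := hM
  exact ⟨_, hP.has_fpower_series_dslope_fslope⟩

lemma hasDerivAt_one_sub_ee_sub (p z : ℂ) :
    HasDerivAt (fun z => 1 - ee (z - p)) (-(2 * Real.pi * I * ee (z - p))) z :=
  ((hasDerivAt_ee (z - p)).comp_sub_const z p).const_sub 1

lemma eventually_ee_sub_ne_one (p : ℂ) : ∀ᶠ z in 𝓝[≠] p, ee (z - p) ≠ 1 := by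
  have h := (hasDerivAt_one_sub_ee_sub p p).eventually_ne (c := 0)
    (by simp [ee_zero])
  exact h.mono fun z hz => by
    rw [sub_ne_zero] at hz
    exact hz.symm

/-- Division by the local parameter `1 - exp(2πi(z - p))`. -/
lemma exists_eq_add_mul {M : ℂ → ℂ} {p : ℂ} (hM : AnalyticAt ℂ M p) :
    ∃ N, AnalyticAt ℂ N p ∧ ∀ᶠ z in 𝓝 p, M z = M p + (1 - ee (z - p)) * N z := by
  have hD : AnalyticAt ℂ (fun z => 1 - ee (z - p)) p :=
    analyticAt_const.sub (analyticAt_ee (by fun_prop))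
  have hne : dslope (fun z => 1 - ee (z - p)) p p ≠ 0 := by
    rw [dslope_same, (hasDerivAt_one_sub_ee_sub p p).deriv]
    simp [ee_zero]
  refine ⟨fun z => dslope M p z / dslope (fun z => 1 - ee (z - p)) p z,
    (analyticAt_dslope hM).div (analyticAt_dslope hD) hne, ?_⟩
  filter_upwards [(analyticAt_dslope hD).continuousAt.eventually_ne hne] with z hz
  have h1 := sub_smul_dslope M p z
  have h2 := sub_smul_dslope (fun z => 1 - ee (z - p)) p z
  simp only [sub_self, ee_zero, sub_zero, smul_eq_mul] at h1 h2
  rw [← h2, mul_assoc, mul_div_cancel₀ _ hz, h1]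
  ring

lemma exists_principal_part_one {M G : ℂ → ℂ} {p : ℂ} (hM : AnalyticAt ℂ M p)
    (hG : G =ᶠ[𝓝[≠] p] fun z => M z * kap p z) :
    ∃ ψ, AnalyticAt ℂ ψ p ∧ G =ᶠ[𝓝[≠] p] fun z => ψ z + M p * kap p z := by
  obtain ⟨N, hN, h⟩ := exists_eq_add_mul hM
  refine ⟨N, hN, ?_⟩
  filter_upwards [hG, h.filter_mono nhdsWithin_le_nhds, eventually_ee_sub_ne_one p]
    with z hz hz2 hz3
  rw [hz, hz2, kap]
  have := sub_ne_zero.2 hz3.symm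
  field_simp
  ring

/-- The principal part at a triple pole. The sum of its coefficients is what the pole contributes
to `perInt`. -/
lemma exists_principal_part_three {M G : ℂ → ℂ} {p : ℂ} (hM : AnalyticAt ℂ M p)
    (hG : G =ᶠ[𝓝[≠] p] fun z => M z * kap p z ^ 3) :
    ∃ c₁ c₂ c₃ : ℂ, c₁ + c₂ + c₃ = M p - 3 / 2 / (2 * Real.pi * I) * deriv M p +
        deriv (deriv M) p / (2 * (2 * Real.pi * I) ^ 2) ∧
      ∃ ψ, AnalyticAt ℂ ψ p ∧ G =ᶠ[𝓝[≠] p] fun z =>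
        ψ z + (c₁ * kap p z + c₂ * kap p z ^ 2 + c₃ * kap p z ^ 3) := by
  obtain ⟨N, hN, h⟩ := exists_eq_add_mul hM
  obtain ⟨N', hN', h'⟩ := exists_eq_add_mul hN
  obtain ⟨ψ, hψ, h''⟩ := exists_eq_add_mul hN'
  refine ⟨N' p, N p, M p, ?_, ψ, hψ, ?_⟩
  · have hd (F : ℂ → ℂ) (F' : ℂ → ℂ) (hF' : AnalyticAt ℂ F' p)
        (hF : ∀ᶠ z in 𝓝 p, F z = F p + (1 - ee (z - p)) * F' z) :
        ∀ᶠ z in 𝓝 p, deriv F z = -(2 * Real.pi * I * ee (z - p)) * F' z +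
          (1 - ee (z - p)) * deriv F' z := by
      filter_upwards [hF.eventually_nhds, hF'.eventually_analyticAt] with z hz hz2
      have h1 := ((hasDerivAt_one_sub_ee_sub p z).mul hz2.differentiableAt.hasDerivAt).const_add
        (F p)
      exact (h1.congr_of_eventuallyEq hz).deriv
    have d1 := hd M N hN h
    have d2 := hd N N' hN' h'
    have e1 := d1.self_of_nhds
    have e2 := d2.self_of_nhds
    have h3 : HasDerivAt (fun z => -(2 * Real.pi * I * ee (z - p)) * N z +
          (1 - ee (z - p)) * deriv N z)
        (-(2 * Real.pi * I * (2 * Real.pi * I * ee (p - p))) * N p +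
          -(2 * Real.pi * I * ee (p - p)) * deriv N p +
          (-(2 * Real.pi * I * ee (p - p)) * deriv N p + (1 - ee (p - p)) * deriv (deriv N) p)) p :=
      ((((hasDerivAt_ee (p - p)).comp_sub_const p p).const_mul (2 * Real.pi * I : ℂ)).fun_neg.mul
        hN.differentiableAt.hasDerivAt).add ((hasDerivAt_one_sub_ee_sub p p).mul
        hN.deriv.differentiableAt.hasDerivAt)
    have e3 := (h3.congr_of_eventuallyEq d1).deriv
    simp only [sub_self, ee_zero, zero_mul, add_zero, mul_one] at e1 e2 e3
    rw [e3, e1, e2]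
    have := two_pi_I_ne_zero
    field_simp
    ring
  · filter_upwards [hG, h.filter_mono nhdsWithin_le_nhds, h'.filter_mono nhdsWithin_le_nhds,
      h''.filter_mono nhdsWithin_le_nhds, eventually_ee_sub_ne_one p] with z hz h1 h2 h3 h4
    rw [hz, h1, h2, h3, kap]
    have := sub_ne_zero.2 h4.symm
    field_simp
    ring

/-! ### Shifting the integrand by the periods -/

lemma ee_natCast (n : ℕ) : ee n = 1 := by exact_mod_cast ee_int n

/-- Reversal of the order of the factors of a finite q-Pochhammer symbol. -/
lemma qPoch_ee_add_mul (r z : ℂ) (n : ℕ) :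
    qPoch (ee (z + n * r)) (ee (-r)) n =
      (-1) ^ n * ee (n * z + n * (n + 1) / 2 * r) * qPoch (ee (-r - z)) (ee (-r)) n := by
  induction n with
  | zero => simp [qPoch, ee_zero]
  | succ n ih =>
    rw [qPoch_succ', ← ee_add]
    have e1 : z + ((n + 1 : ℕ) : ℂ) * r + -r = z + n * r := by push_cast; ring
    rw [e1, ih]
    have e2 : qPoch (ee (-r - z)) (ee (-r)) (n + 1) =
        qPoch (ee (-r - z)) (ee (-r)) n * (1 - (ee (z + (n + 1 : ℕ) * r))⁻¹) := by
      rw [qPoch, Finset.prod_range_succ, ← qPoch, ← ee_nat_mul, ← ee_add, ← ee_neg]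
      congr 3
      push_cast
      ring
    have e3 : ee ((n + 1 : ℕ) * z + (n + 1 : ℕ) * ((n + 1 : ℕ) + 1) / 2 * r) =
        ee (n * z + n * (n + 1) / 2 * r) * ee (z + (n + 1 : ℕ) * r) := by
      rw [← ee_add]; congr 1; push_cast; ring
    rw [e2, e3]
    have := ee_ne_zero (z + (n + 1 : ℕ) * r)
    field_simp
    ring

lemma phi_add_nat {τ : ℂ} (hτ : 0 < τ.im) (z : ℂ) (n : ℕ)
    (h : qPoch (ee (τ * (z + 1))) (ee τ) n ≠ 0) :
    phi τ (z + n) = phi τ z / qPoch (ee (τ * (z + 1))) (ee τ) n := by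
  rw [phi, phi, qPochInf_eq_qPoch_mul (ee (τ * (z + 1))) (norm_ee_lt_one hτ) n, ← ee_nat_mul,
    ← ee_add, ee_add z, ee_natCast, mul_one,
    show τ * (z + 1) + n * τ = τ * (z + n + 1) by ring]
  field_simp

lemma phi_add_nat_mul_inv {τ : ℂ} (hτ : 0 < τ.im) (z : ℂ) (n : ℕ) :
    phi τ (z + n * τ⁻¹) = phi τ z / qPoch (ee (z + n * τ⁻¹)) (ee (-τ⁻¹)) n := by
  have hτ0 := ne_zero_of_im_pos hτ
  rw [phi, phi, qPochInf_eq_qPoch_mul (ee (z + n * τ⁻¹)) (norm_ee_neg_inv_lt_one hτ) n,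
    ← ee_nat_mul, ← ee_add, show τ * (z + n * τ⁻¹ + 1) = τ * (z + 1) + n by field_simp; ring,
    ee_add _ (n : ℂ), ee_natCast, mul_one, show z + n * τ⁻¹ + n * -τ⁻¹ = z by ring, div_div,
    mul_comm (qPochInf _ _)]

/-- The sum over the translates of the integrand by `1`, divided by the integrand. -/
def Usum (τ z : ℂ) : ℂ :=
  qSum 2 (ee τ) (ee (τ * (4 * z + 1))) (ee (τ * (z + 1))) (ee (τ * (2 * z + 1)))

/-- The sum over the translates of the integrand by `τ⁻¹`, divided by the integrand. -/
def Vsum (τ z : ℂ) : ℂ :=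
  qSum 1 (ee (-τ⁻¹)) (ee (-τ⁻¹ - 2 * z)) (ee (-τ⁻¹ - z)) (ee (-τ⁻¹ - 2 * z))

lemma gauss_two_mul_add_nat {τ : ℂ} (hτ : τ ≠ 0) (z : ℂ) (n : ℕ) :
    gauss τ (2 * (z + n)) =
      gauss τ (2 * z) * (ee τ ^ (2 * n ^ 2) * ee (τ * (4 * z + 1)) ^ n) := by
  have : ee (n : ℂ) = 1 := ee_natCast n
  rw [show ee τ ^ (2 * n ^ 2) * ee (τ * (4 * z + 1)) ^ n =
      ee τ ^ (2 * n ^ 2) * ee (τ * (4 * z + 1)) ^ n * ee n by rw [this, mul_one], ← ee_nat_mul, ← ee_nat_mul, ← ee_add, ← ee_add, gauss,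
    gauss, ee, ← Complex.exp_add]
  congr 1
  push_cast
  field_simp
  ring

lemma gauss_two_mul_add_nat_mul_inv {τ : ℂ} (hτ : τ ≠ 0) (z : ℂ) (n : ℕ) :
    gauss τ (2 * (z + n * τ⁻¹)) =
      gauss τ (2 * z) * ee (4 * n * z + n * τ⁻¹ + 2 * n ^ 2 * τ⁻¹) := by
  have : ee (n : ℂ) = 1 := ee_natCast n
  rw [← mul_one (ee (4 * n * z + _ + _)), ← this, ← ee_add, gauss,
    gauss, ee, ← Complex.exp_add]
  congr 1
  field_simp
  ring

lemma f₀_add_nat {τ : ℂ} (hτ : 0 < τ.im) {z : ℂ} (h1 : 0 < (τ * (z + 1)).im)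
    (h2 : 0 < (τ * (2 * z + 1)).im) (n : ℕ) :
    f₀ τ (z + n) = f₀ τ z * qTerm 2 (ee τ) (ee (τ * (4 * z + 1))) (ee (τ * (z + 1)))
      (ee (τ * (2 * z + 1))) n := by
  have hq := norm_ee_lt_one hτ
  have n1 := qPoch_ne_zero_of_norm_lt hq (norm_ee_lt_one h1) n
  have n2 := qPoch_ne_zero_of_norm_lt hq (norm_ee_lt_one h2) (2 * n)
  have e : 2 * (z + n) = 2 * z + (2 * n : ℕ) := by push_cast; ring
  rw [f₀, f₀, gauss_two_mul_add_nat (ne_zero_of_im_pos hτ), e, phi_add_nat hτ _ _ n1,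
    phi_add_nat hτ _ _ n2, qTerm]
  field_simp

lemma f₀_add_nat_mul_inv {τ : ℂ} (hτ : 0 < τ.im) (z : ℂ) (n : ℕ) :
    f₀ τ (z + n * τ⁻¹) = f₀ τ z * qTerm 1 (ee (-τ⁻¹)) (ee (-τ⁻¹ - 2 * z)) (ee (-τ⁻¹ - z))
      (ee (-τ⁻¹ - 2 * z)) n := by
  have e : 2 * (z + n * τ⁻¹) = 2 * z + (2 * n : ℕ) * τ⁻¹ := by push_cast; ring
  rw [f₀, f₀, gauss_two_mul_add_nat_mul_inv (ne_zero_of_im_pos hτ), e, phi_add_nat_mul_inv hτ,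
    phi_add_nat_mul_inv hτ, qTerm, qPoch_ee_add_mul, qPoch_ee_add_mul]
  set A := ee (n * z + n * (n + 1) / 2 * τ⁻¹)
  set B := ee ((2 * n : ℕ) * (2 * z) + (2 * n : ℕ) * ((2 * n : ℕ) + 1) / 2 * τ⁻¹)
  have hA : A ≠ 0 := ee_ne_zero _
  have hB : B ≠ 0 := ee_ne_zero _
  have key : ee (4 * n * z + n * τ⁻¹ + 2 * n ^ 2 * τ⁻¹) =
      ee (-τ⁻¹) ^ (1 * n ^ 2) * ee (-τ⁻¹ - 2 * z) ^ n * (A ^ 2 * B) := by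
    rw [← ee_nat_mul, ← ee_nat_mul, ← ee_two_mul, ← ee_add, ← ee_add, ← ee_add]
    congr 1
    push_cast
    ring
  have s1 : ((-1 : ℂ) ^ n) ^ 2 = 1 := by rw [← pow_mul, mul_comm, pow_mul]; simp
  have s2 : (-1 : ℂ) ^ (2 * n) = 1 := by rw [pow_mul]; simp
  rw [key, div_pow, mul_pow, mul_pow, s1, s2]
  simp only [div_eq_mul_inv, mul_inv, one_mul]
  field_simp

lemma hasSum_f₀_add_nat {τ : ℂ} (hτ : 0 < τ.im) {z : ℂ} (h1 : 0 < (τ * (z + 1)).im)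
    (h2 : 0 < (τ * (2 * z + 1)).im) :
    HasSum (fun n : ℕ => f₀ τ (z + n)) (f₀ τ z * Usum τ z) := by
  simp only [f₀_add_nat hτ h1 h2]
  exact (summable_qTerm one_le_two _ (norm_ee_lt_one hτ) (norm_ee_lt_one h1)
    (norm_ee_lt_one h2)).hasSum.mul_left _

lemma hasSum_f₀_add_nat_mul_inv {τ : ℂ} (hτ : 0 < τ.im) {z : ℂ} (h1 : 0 < (-τ⁻¹ - z).im)
    (h2 : 0 < (-τ⁻¹ - 2 * z).im) :
    HasSum (fun n : ℕ => f₀ τ (z + n * τ⁻¹)) (f₀ τ z * Vsum τ z) := by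
  simp only [f₀_add_nat_mul_inv hτ]
  exact (summable_qTerm le_rfl _ (norm_ee_neg_inv_lt_one hτ) (norm_ee_lt_one h1)
    (norm_ee_lt_one h2)).hasSum.mul_left _

/-- A translation by `1` removes the first summand of the sum over the translates. -/
lemma f₀_mul_Usum_add_one {τ : ℂ} (hτ : 0 < τ.im) {z : ℂ} (h1 : 0 < (τ * (z + 1)).im)
    (h2 : 0 < (τ * (2 * z + 1)).im) :
    f₀ τ (z + 1) * Usum τ (z + 1) = f₀ τ z * Usum τ z - f₀ τ z := by
  have h1' : 0 < (τ * (z + 1 + 1)).im := by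
    rw [show τ * (z + 1 + 1) = τ * (z + 1) + τ by ring, add_im]; linarith
  have h2' : 0 < (τ * (2 * (z + 1) + 1)).im := by
    rw [show τ * (2 * (z + 1) + 1) = τ * (2 * z + 1) + τ + τ by ring, add_im, add_im]; linarith
  have a1 := hasSum_f₀_add_nat hτ h1' h2'
  have a2 := (hasSum_nat_add_iff' 1).2 (hasSum_f₀_add_nat hτ h1 h2)
  simp only [Finset.sum_range_one, Nat.cast_zero, add_zero] at a2
  refine a1.unique (a2.congr_fun ?_)
  intro n
  push_cast
  congr 1
  ring

/-- A translation by `τ⁻¹` removes the first summand of the sum over the translates. -/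
lemma f₀_mul_Vsum_add_inv {τ : ℂ} (hτ : 0 < τ.im) {z : ℂ} (h1 : 0 < (-τ⁻¹ - z).im)
    (h2 : 0 < (-τ⁻¹ - 2 * z).im) :
    f₀ τ (z + τ⁻¹) * Vsum τ (z + τ⁻¹) = f₀ τ z * Vsum τ z - f₀ τ z := by
  have hr := inv_im_neg hτ
  have h1' : 0 < (-τ⁻¹ - (z + τ⁻¹)).im := by
    rw [show -τ⁻¹ - (z + τ⁻¹) = (-τ⁻¹ - z) - τ⁻¹ by ring, sub_im]; linarith
  have h2' : 0 < (-τ⁻¹ - 2 * (z + τ⁻¹)).im := by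
    rw [show -τ⁻¹ - 2 * (z + τ⁻¹) = (-τ⁻¹ - 2 * z) - τ⁻¹ - τ⁻¹ by ring, sub_im, sub_im]; linarith
  have a1 := hasSum_f₀_add_nat_mul_inv hτ h1' h2'
  have a2 := (hasSum_nat_add_iff' 1).2 (hasSum_f₀_add_nat_mul_inv hτ h1 h2)
  simp only [Finset.sum_range_one, Nat.cast_zero, add_zero, zero_mul] at a2
  refine a1.unique (a2.congr_fun ?_)
  intro n
  push_cast
  congr 1
  ring

lemma Vsum_add_one (τ z : ℂ) : Vsum τ (z + 1) = Vsum τ z := by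
  have e1 : ee (-τ⁻¹ - 2 * (z + 1)) = ee (-τ⁻¹ - 2 * z) := by
    rw [← ee_add_one, ← ee_add_one]; congr 1; ring
  have e2 : ee (-τ⁻¹ - (z + 1)) = ee (-τ⁻¹ - z) := by
    rw [← ee_add_one]; congr 1; ring
  rw [Vsum, Vsum, e1, e2]

lemma Usum_add_inv {τ : ℂ} (hτ : τ ≠ 0) (z : ℂ) : Usum τ (z + τ⁻¹) = Usum τ z := by
  have e (n : ℕ) (w : ℂ) : ee (τ * (n * (z + τ⁻¹) + w)) = ee (τ * (n * z + w)) := by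
    rw [show τ * (n * (z + τ⁻¹) + w) = τ * (n * z + w) + n by field_simp; ring, ee_add,
      ee_natCast, mul_one]
  have e1 := e 1 1
  have e2 := e 2 1
  have e4 := e 4 1
  push_cast [one_mul] at e1 e2 e4
  rw [Usum, Usum, e1, e2, e4]

/-! ### From the horizontal contour to the period parallelogram -/

lemma bOf_sq (τ : ℂ) : bOf τ ^ 2 = τ := by
  rw [bOf, ← Complex.cpow_nat_mul]; simp

lemma bOf_re_pos {τ : ℂ} (hτ : 0 < τ.im) : 0 < (bOf τ).re := by
  rw [bOf, one_div, cpow_inv_two_re]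
  refine Real.sqrt_pos.2 (half_pos ?_)
  have h1 : -τ.re < ‖τ‖ := by
    refine lt_of_le_of_ne ((neg_le_abs _).trans (abs_re_le_norm τ)) fun h => ?_
    have h2 := Complex.sq_norm τ
    rw [← h, normSq_apply] at h2
    nlinarith
  linarith

lemma inv_re_pos {b : ℂ} (hb : 0 < b.re) : 0 < (b⁻¹).re := by
  rw [inv_re]
  exact div_pos hb (normSq_pos.2 fun h => by simp [h] at hb)

lemma norm_gauss (τ z : ℂ) :
    ‖gauss τ z‖ = Real.exp (-(Real.pi * (τ * (z + (1 + τ⁻¹) / 2) ^ 2).im)) := by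
  rw [gauss, norm_exp]
  congr 1
  rw [show (Real.pi * I * τ * (z + (1 + τ⁻¹) / 2) ^ 2 : ℂ) =
    (Real.pi : ℂ) * (I * (τ * (z + (1 + τ⁻¹) / 2) ^ 2)) by ring, re_ofReal_mul, I_mul_re]
  ring

lemma norm_ee_le_one {z : ℂ} (hz : 0 ≤ z.im) : ‖ee z‖ ≤ 1 := by
  rw [norm_ee, Real.exp_le_one_iff]
  have := mul_nonneg Real.pi_pos.le hz
  linarith

lemma norm_ee_le {z : ℂ} {η : ℝ} (hz : η ≤ z.im) : ‖ee z‖ ≤ Real.exp (-(2 * Real.pi * η)) := by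
  rw [norm_ee]
  have := Real.pi_pos
  gcongr

lemma exp_neg_lt_one {η : ℝ} (hη : 0 < η) : Real.exp (-(2 * Real.pi * η)) < 1 := by
  rw [Real.exp_lt_one_iff]
  have := mul_pos Real.pi_pos hη
  linarith

lemma norm_qPochInf_ee_le {w z : ℂ} (hw : 0 < w.im) (hz : 0 ≤ z.im) :
    ‖qPochInf (ee z) (ee w)‖ ≤ Real.exp (1 / (1 - ‖ee w‖)) := by
  have := norm_ee_lt_one hw
  refine (norm_qPochInf_le _ this).trans ?_
  have h1 := norm_ee_le_one hz
  have : 0 < 1 - ‖ee w‖ := by linarith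
  gcongr

lemma norm_inv_qPochInf_ee_le {w z : ℂ} {η : ℝ} (hw : 0 < w.im) (hη : 0 < η) (hz : η ≤ z.im) :
    ‖(qPochInf (ee z) (ee w))⁻¹‖ ≤
      Real.exp ((1 - Real.exp (-(2 * Real.pi * η)))⁻¹ / (1 - ‖ee w‖)) :=
  norm_inv_qPochInf_le (norm_ee_lt_one hw) (exp_neg_lt_one hη) (norm_ee_le hz)

lemma analyticAt_qPochInf_ee {f : ℂ → ℂ} {w z : ℂ} (hw : 0 < w.im) (hf : AnalyticAt ℂ f z) :
    AnalyticAt ℂ (fun z => qPochInf (ee (f z)) (ee w)) z :=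
  analyticAt_qPochInf (analyticAt_ee hf) analyticAt_const (norm_ee_lt_one hw)

lemma neg_inv_im_pos {τ : ℂ} (hτ : 0 < τ.im) : 0 < (-τ⁻¹).im := by
  simpa using inv_im_neg hτ

lemma analyticAt_phi {f : ℂ → ℂ} {τ z : ℂ} (hτ : 0 < τ.im) (hf : AnalyticAt ℂ f z)
    (hz : 0 < (f z).im) : AnalyticAt ℂ (fun z => phi τ (f z)) z :=
  (analyticAt_qPochInf_ee hτ (by fun_prop)).div
    (analyticAt_qPochInf_ee (neg_inv_im_pos hτ) hf)
    (qPochInf_ne_zero_of_norm_lt (norm_ee_neg_inv_lt_one hτ) (norm_ee_lt_one hz))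

lemma analyticAt_gauss {f : ℂ → ℂ} {z : ℂ} (τ : ℂ) (hf : AnalyticAt ℂ f z) :
    AnalyticAt ℂ (fun z => gauss τ (f z)) z := by
  unfold gauss
  fun_prop

/-- Exponential decay of the integrand in the sector to the left of its poles. -/
lemma exists_bound_left {τ : ℂ} (hτ : 0 < τ.im) {δ : ℝ} (h0 : 0 < δ) (h1 : δ < 1 / 4) :
    ∃ C κ : ℝ, 0 < κ ∧ ∀ s t : ℝ, 0 ≤ s → 0 ≤ t →
      DifferentiableAt ℂ (f₀ τ) (-δ * (1 + τ⁻¹) + s * (I * (bOf τ)⁻¹) + t * 1) ∧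
      ‖f₀ τ (-δ * (1 + τ⁻¹) + s * (I * (bOf τ)⁻¹) + t * 1)‖ ≤ C * Real.exp (-κ * (s + t)) := by
  have hτ0 := ne_zero_of_im_pos hτ
  have hr := inv_im_neg hτ
  have hb := bOf_re_pos hτ
  have hb2 := bOf_sq τ
  set b := bOf τ
  have hb0 : b ≠ 0 := fun h => by simp [h] at hb
  have hbi := inv_re_pos hb
  set h : ℂ := (1 + τ⁻¹) / 2 with hh
  set d : ℂ := I * b⁻¹ with hd
  have H1 : τ * h = (τ + 1) / 2 := by rw [hh]; field_simp
  have H2 : τ * d = I * b := by rw [hd, ← hb2]; field_simp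
  have H3 : τ * d ^ 2 = -1 := by rw [hd, ← hb2, mul_pow, I_sq]; field_simp
  set A : ℝ := (b + b⁻¹).re with hA
  have hApos : 0 < A := by rw [hA, add_re]; linarith
  -- on the left `gauss τ (2 * z)` is centred at `-h`, and `2 * z + h = lam * h + 2 * (s * d + t)`
  set lam : ℝ := 1 - 4 * δ with hlam
  have hlpos : 0 < lam := by linarith
  set η : ℝ := δ * -(τ⁻¹).im with hη
  have hηpos : 0 < η := mul_pos h0 (by linarith)
  set K : ℝ := Real.exp (1 / (1 - ‖ee τ‖)) *
    Real.exp ((1 - Real.exp (-(2 * Real.pi * η)))⁻¹ / (1 - ‖ee (-τ⁻¹)‖)) with hK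
  have hphi (z : ℂ) (hz1 : 0 ≤ (τ * (z + 1)).im) (hz2 : η ≤ z.im) : ‖phi τ z‖ ≤ K := by
    rw [phi, div_eq_mul_inv, norm_mul]
    exact mul_le_mul (norm_qPochInf_ee_le hτ hz1)
      (norm_inv_qPochInf_ee_le (neg_inv_im_pos hτ) hηpos hz2) (norm_nonneg _) (Real.exp_pos _).le
  refine ⟨K ^ 3 * Real.exp (-(Real.pi * (lam ^ 2 * (τ * h ^ 2).im))),
    Real.pi * (2 * lam * min A τ.im), by positivity, fun s t hs ht => ?_⟩
  set z : ℂ := -δ * (1 + τ⁻¹) + s * d + t * 1 with hz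
  have im1 : (τ * (z + 1)).im = (1 - δ) * τ.im + s * b.re + t * τ.im := by
    have : τ * (z + 1) = ((1 - δ : ℝ) : ℂ) * τ - (δ : ℝ) + (s : ℝ) * (I * b) + (t : ℝ) * τ := by
      have : τ * τ⁻¹ = 1 := mul_inv_cancel₀ hτ0
      rw [hz]; push_cast
      linear_combination s * H2 - δ * this
    rw [this]; simp
  have im2 : (τ * (2 * z + 1)).im = (1 - 2 * δ) * τ.im + 2 * s * b.re + 2 * t * τ.im := by
    have : τ * (2 * z + 1) = ((1 - 2 * δ : ℝ) : ℂ) * τ - (2 * δ : ℝ) + (2 * s : ℝ) * (I * b) +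
        (2 * t : ℝ) * τ := by
      have : τ * τ⁻¹ = 1 := mul_inv_cancel₀ hτ0
      rw [hz]; push_cast
      linear_combination 2 * s * H2 - 2 * δ * this
    rw [this]; simp
  have im3 : z.im = η + s * (b⁻¹).re := by
    rw [hz, hd, hη]; simp
  have hz3 : η ≤ z.im := by rw [im3]; nlinarith
  have hz4 : η ≤ (2 * z).im := by
    rw [show (2 * z).im = 2 * z.im by simp]; linarith
  have n1 : 0 ≤ (τ * (z + 1)).im := by
    rw [im1]
    have := mul_nonneg hs hb.le
    have := mul_nonneg ht hτ.le
    nlinarith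
  have n2 : 0 ≤ (τ * (2 * z + 1)).im := by
    rw [im2]
    have := mul_nonneg hs hb.le
    have := mul_nonneg ht hτ.le
    nlinarith
  constructor
  · have a1 := analyticAt_phi (f := fun z => z) (z := z) hτ analyticAt_id (by linarith)
    have a2 := analyticAt_phi (f := fun z => 2 * z) (z := z) hτ (by fun_prop) (by linarith)
    have a3 := analyticAt_gauss (f := fun z => 2 * z) (z := z) τ (by fun_prop)
    exact (((a1.pow 2).mul a2).mul a3).differentiableAt
  · have e : τ * (2 * z + h) ^ 2 = ((lam ^ 2 : ℝ) : ℂ) * (τ * h ^ 2) +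
        ((2 * lam * s : ℝ) : ℂ) * (I * (b + b⁻¹)) + ((2 * lam * t : ℝ) : ℂ) * (τ + 1) +
        ((8 * s * t : ℝ) : ℂ) * (I * b) + ((4 * t ^ 2 : ℝ) : ℂ) * τ - ((4 * s ^ 2 : ℝ) : ℂ) := by
      have e1 : 2 * z + h = lam * h + 2 * s * d + 2 * t := by
        rw [hz, hlam, hh]; push_cast; ring
      rw [e1]
      push_cast
      linear_combination 4 * lam * (s * d + t) * H1 + (2 * lam * s + 8 * s * t) * H2 +
        2 * lam * s * hd + 4 * s ^ 2 * H3
    have ime : (τ * (2 * z + h) ^ 2).im = lam ^ 2 * (τ * h ^ 2).im + 2 * lam * s * A +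
        2 * lam * t * τ.im + 8 * s * t * b.re + 4 * t ^ 2 * τ.im := by
      rw [e]
      simp only [add_im, sub_im, im_ofReal_mul, I_mul_im, ofReal_im, one_im, hA]
      ring
    rw [f₀, norm_mul, norm_mul, norm_pow, norm_gauss]
    have p1 := hphi z n1 hz3
    have p2 := hphi (2 * z) n2 hz4
    have hmin1 := min_le_left A τ.im
    have hmin2 := min_le_right A τ.im
    have hst := mul_nonneg hs ht
    have q1 : min A τ.im * (s + t) ≤ s * A + t * τ.im := by nlinarith
    have q2 : 0 ≤ 8 * s * t * b.re + 4 * t ^ 2 * τ.im := by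
      have := mul_nonneg hst hb.le
      have := mul_nonneg (sq_nonneg t) hτ.le
      nlinarith
    have p3 : Real.exp (-(Real.pi * (τ * (2 * z + h) ^ 2).im)) ≤
        Real.exp (-(Real.pi * (lam ^ 2 * (τ * h ^ 2).im))) *
          Real.exp (-(Real.pi * (2 * lam * min A τ.im)) * (s + t)) := by
      rw [← Real.exp_add, Real.exp_le_exp, ime]
      have q3 : 2 * lam * (min A τ.im * (s + t)) ≤ 2 * lam * (s * A + t * τ.im) := by gcongr
      have := mul_le_mul_of_nonneg_left (add_le_add q3 q2) Real.pi_pos.le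
      linarith
    calc _ ≤ K ^ 2 * K * (Real.exp (-(Real.pi * (lam ^ 2 * (τ * h ^ 2).im))) *
          Real.exp (-(Real.pi * (2 * lam * min A τ.im)) * (s + t))) := by gcongr
      _ = _ := by ring

/-- The integrand in the form valid to the right of its zeros and poles. -/
def fRight (τ C z : ℂ) : ℂ :=
  C ^ 3 * (qPochInf (ee (-τ⁻¹ - z)) (ee (-τ⁻¹)) ^ 2 *
    qPochInf (ee (-τ⁻¹ - 2 * z)) (ee (-τ⁻¹))) *
    ((qPochInf (ee (-(τ * z))) (ee τ))⁻¹ ^ 2 * (qPochInf (ee (-(τ * (2 * z)))) (ee τ))⁻¹) *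
    (gauss τ z)⁻¹ ^ 2

/-- The lattice of zeros and poles of the quantum dilogarithm. -/
def lattice (τ : ℂ) : Set ℂ := Set.range fun p : ℤ × ℤ => (p.1 : ℂ) + p.2 * τ⁻¹

lemma exists_f₀_eq_fRight {τ : ℂ} (hτ : 0 < τ.im) : ∃ C : ℂ, ∀ z, z ∉ lattice τ →
    2 * z ∉ lattice τ → f₀ τ z = fRight τ C z := by
  obtain ⟨C, hC⟩ := exists_phi_eq_right hτ
  refine ⟨C, fun z h1 h2 => ?_⟩
  rw [f₀, hC z fun ⟨m, n, h⟩ => h1 ⟨(m, n), h.symm⟩, hC (2 * z) fun ⟨m, n, h⟩ => h2 ⟨(m, n), h.symm⟩,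
    fRight]
  have := gauss_ne_zero τ (2 * z)
  generalize gauss τ (2 * z) = g at *
  simp only [div_eq_mul_inv, mul_inv]
  linear_combination C ^ 3 * (qPochInf (ee (-τ⁻¹ - z)) (ee (-τ⁻¹)) ^ 2 *
    qPochInf (ee (-τ⁻¹ - 2 * z)) (ee (-τ⁻¹))) *
    ((qPochInf (ee (-(τ * z))) (ee τ))⁻¹ ^ 2 * (qPochInf (ee (-(τ * (2 * z)))) (ee τ))⁻¹) *
    (gauss τ z)⁻¹ ^ 2 * inv_mul_cancel₀ this

/-- Exponential decay of the integrand in the sector to the right of its poles. -/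
lemma exists_bound_right {τ : ℂ} (hτ : 0 < τ.im) (C₀ : ℂ) {δ : ℝ} (h0 : 0 < δ)
    (h1 : δ < 1 / 4) : ∃ C κ : ℝ, 0 < κ ∧ ∀ s t : ℝ, 0 ≤ s → 0 ≤ t →
      DifferentiableAt ℂ (fRight τ C₀) (-δ * (1 + τ⁻¹) + s * -(I * (bOf τ)⁻¹) + t * τ⁻¹) ∧
      ‖fRight τ C₀ (-δ * (1 + τ⁻¹) + s * -(I * (bOf τ)⁻¹) + t * τ⁻¹)‖ ≤
        C * Real.exp (-κ * (s + t)) := by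
  have hτ0 := ne_zero_of_im_pos hτ
  have hr := inv_im_neg hτ
  have hb := bOf_re_pos hτ
  have hb2 := bOf_sq τ
  set b := bOf τ
  have hb0 : b ≠ 0 := fun h => by simp [h] at hb
  have hbi := inv_re_pos hb
  set h : ℂ := (1 + τ⁻¹) / 2 with hh
  set d : ℂ := I * b⁻¹ with hd
  have H1 : τ * h = (τ + 1) / 2 := by rw [hh]; field_simp
  have H2 : τ * d = I * b := by rw [hd, ← hb2]; field_simp
  have H3 : τ * d ^ 2 = -1 := by rw [hd, ← hb2, mul_pow, I_sq]; field_simp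
  have H5 : τ * τ⁻¹ = 1 := mul_inv_cancel₀ hτ0
  set A : ℝ := (b + b⁻¹).re with hA
  have hApos : 0 < A := by rw [hA, add_re]; linarith
  -- on the right the Gaussian is that of `z`, and `z + h = lam * h - s * d + t * τ⁻¹`
  set lam : ℝ := 1 - 2 * δ with hlam
  have hlpos : 0 < lam := by linarith
  set ρ : ℝ := -(τ⁻¹).im with hρ
  have hρpos : 0 < ρ := by linarith
  set η : ℝ := δ * τ.im with hη
  have hηpos : 0 < η := mul_pos h0 hτ
  set K₁ : ℝ := Real.exp (1 / (1 - ‖ee (-τ⁻¹)‖)) with hK₁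
  set K₂ : ℝ := Real.exp ((1 - Real.exp (-(2 * Real.pi * η)))⁻¹ / (1 - ‖ee τ‖)) with hK₂
  refine ⟨‖C₀‖ ^ 3 * (K₁ ^ 2 * K₁) * (K₂ ^ 2 * K₂) *
    Real.exp (2 * Real.pi * (lam ^ 2 * (τ * h ^ 2).im)),
    2 * Real.pi * (lam * min A ρ), by positivity, fun s t hs ht => ?_⟩
  set z : ℂ := -δ * (1 + τ⁻¹) + s * -d + t * τ⁻¹ with hz
  have imd : d.im = (b⁻¹).re := by rw [hd]; simp
  have im1 : (-τ⁻¹ - z).im = (1 - δ) * ρ + s * d.im + t * ρ := by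
    have : -τ⁻¹ - z = ((δ : ℝ) : ℂ) + ((δ - 1 - t : ℝ) : ℂ) * τ⁻¹ + (s : ℝ) * d := by
      rw [hz]; push_cast; ring
    rw [this, add_im, add_im, im_ofReal_mul, im_ofReal_mul, ofReal_im, hρ]
    ring
  have im2 : (-τ⁻¹ - 2 * z).im = (1 - 2 * δ) * ρ + 2 * s * d.im + 2 * t * ρ := by
    have : -τ⁻¹ - 2 * z = ((2 * δ : ℝ) : ℂ) + ((2 * δ - 1 - 2 * t : ℝ) : ℂ) * τ⁻¹ +
        ((2 * s : ℝ) : ℂ) * d := by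
      rw [hz]; push_cast; ring
    rw [this, add_im, add_im, im_ofReal_mul, im_ofReal_mul, ofReal_im, hρ]
    ring
  have im3 : (-(τ * z)).im = η + s * b.re := by
    have : -(τ * z) = ((δ : ℝ) : ℂ) * τ + ((δ - t : ℝ) : ℂ) + (s : ℝ) * (I * b) := by
      rw [hz]; push_cast
      linear_combination s * H2 + (δ - t) * H5
    rw [this, add_im, add_im, im_ofReal_mul, im_ofReal_mul, ofReal_im, I_mul_im]
    ring
  have im3' : η ≤ (-(τ * z)).im := by rw [im3]; nlinarith
  have im4 : η ≤ (-(τ * (2 * z))).im := by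
    rw [show -(τ * (2 * z)) = ((2 : ℝ) : ℂ) * (-(τ * z)) by push_cast; ring, im_ofReal_mul]
    linarith
  have n1 : 0 ≤ (-τ⁻¹ - z).im := by
    rw [im1, imd]
    have := mul_nonneg hs hbi.le
    have := mul_nonneg ht hρpos.le
    nlinarith
  have n2 : 0 ≤ (-τ⁻¹ - 2 * z).im := by
    rw [im2, imd]
    have := mul_nonneg hs hbi.le
    have := mul_nonneg ht hρpos.le
    nlinarith
  have hti := neg_inv_im_pos hτ
  constructor
  · have a1 := analyticAt_qPochInf_ee (f := fun z => -τ⁻¹ - z) (z := z) hti (by fun_prop)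
    have a2 := analyticAt_qPochInf_ee (f := fun z => -τ⁻¹ - 2 * z) (z := z) hti (by fun_prop)
    have a3 := (analyticAt_qPochInf_ee (f := fun z => -(τ * z)) (z := z) hτ (by fun_prop)).inv
      (qPochInf_ne_zero_of_norm_lt (norm_ee_lt_one hτ) (norm_ee_lt_one (hηpos.trans_le im3')))
    have a4 := (analyticAt_qPochInf_ee (f := fun z => -(τ * (2 * z))) (z := z) hτ
      (by fun_prop)).inv
      (qPochInf_ne_zero_of_norm_lt (norm_ee_lt_one hτ) (norm_ee_lt_one (hηpos.trans_le im4)))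
    have a5 := (analyticAt_gauss (f := fun z => z) (z := z) τ (by fun_prop)).inv
      (gauss_ne_zero _ _)
    exact (((analyticAt_const.mul ((a1.pow 2).mul a2)).mul ((a3.pow 2).mul a4)).mul
      (a5.pow 2)).differentiableAt
  · have e : τ * (z + h) ^ 2 = ((lam ^ 2 : ℝ) : ℂ) * (τ * h ^ 2) -
        ((lam * s : ℝ) : ℂ) * (I * (b + b⁻¹)) + ((lam * t : ℝ) : ℂ) * (1 + τ⁻¹) -
        ((2 * s * t : ℝ) : ℂ) * d + ((t ^ 2 : ℝ) : ℂ) * τ⁻¹ - ((s ^ 2 : ℝ) : ℂ) := by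
      have e1 : z + h = lam * h - s * d + t * τ⁻¹ := by
        rw [hz, hlam, hh]; push_cast; ring
      rw [e1]
      push_cast
      linear_combination 2 * lam * (-s * d + t * τ⁻¹) * H1 - lam * s * H2 - lam * s * hd +
        s ^ 2 * H3 + (lam * t - 2 * s * t * d + t ^ 2 * τ⁻¹) * H5
    have ime : (τ * (z + h) ^ 2).im = lam ^ 2 * (τ * h ^ 2).im - lam * (s * A + t * ρ) -
        (2 * s * t * d.im + t ^ 2 * ρ) := by
      rw [e]
      simp only [add_im, sub_im, im_ofReal_mul, I_mul_im, ofReal_im, one_im, hA, hρ]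
      ring
    have hmin1 := min_le_left A ρ
    have hmin2 := min_le_right A ρ
    have hst := mul_nonneg hs ht
    have q1 : min A ρ * (s + t) ≤ s * A + t * ρ := by nlinarith
    have q2 : 0 ≤ 2 * s * t * d.im + t ^ 2 * ρ := by
      rw [imd]
      have := mul_nonneg hst hbi.le
      have := mul_nonneg (sq_nonneg t) hρpos.le
      nlinarith
    have p3 : ‖(gauss τ z)⁻¹ ^ 2‖ ≤ Real.exp (2 * Real.pi * (lam ^ 2 * (τ * h ^ 2).im)) *
          Real.exp (-(2 * Real.pi * (lam * min A ρ)) * (s + t)) := by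
      rw [norm_pow, norm_inv, norm_gauss, ← Real.exp_neg, ← Real.exp_nat_mul, ← Real.exp_add,
        Real.exp_le_exp, ime]
      have q3 : lam * (min A ρ * (s + t)) ≤ lam * (s * A + t * ρ) := by gcongr
      have := mul_le_mul_of_nonneg_left (add_le_add q3 q2) Real.pi_pos.le
      push_cast
      linarith
    rw [fRight, norm_mul, norm_mul, norm_mul, norm_mul, norm_mul, norm_pow, norm_pow, norm_pow]
    have p1 := norm_qPochInf_ee_le hti n1
    have p2 := norm_qPochInf_ee_le hti n2
    have p4 := norm_inv_qPochInf_ee_le hτ hηpos im3'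
    have p5 := norm_inv_qPochInf_ee_le hτ hηpos im4
    calc _ ≤ ‖C₀‖ ^ 3 * (K₁ ^ 2 * K₁) * (K₂ ^ 2 * K₂) *
          (Real.exp (2 * Real.pi * (lam ^ 2 * (τ * h ^ 2).im)) *
          Real.exp (-(2 * Real.pi * (lam * min A ρ)) * (s + t))) := by gcongr
      _ = _ := by ring

/-- The integral of `g` along a ray, folded up to its first unit segment. -/
lemma tendsto_integral_ray_of_hasSum {g : ℂ → ℂ} {a v : ℂ} {C κ : ℝ} (hκ : 0 < κ)
    (hd : ∀ t : ℝ, 0 ≤ t → ContinuousAt g (a + t * v))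
    (hb : ∀ t : ℝ, 0 ≤ t → ‖g (a + t * v)‖ ≤ C * Real.exp (-κ * t)) {H : ℝ → ℂ}
    (hH : ∀ t ∈ Set.Icc (0 : ℝ) 1, HasSum (fun n : ℕ => g (a + t * v + n * v)) (H t)) :
    Tendsto (fun n : ℕ => ∫ t in (0 : ℝ)..n, g (a + t * v)) atTop
      (𝓝 (∫ t in (0 : ℝ)..1, H t)) := by
  have hC : 0 ≤ C := by simpa using (norm_nonneg _).trans (hb 0 le_rfl)
  have hcont : ContinuousOn (fun t : ℝ => g (a + t * v)) (Set.Ici 0) := fun t ht =>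
    (ContinuousAt.comp (f := fun t : ℝ => a + t * v) (g := g) (hd t ht)
      (by fun_prop)).continuousWithinAt
  have hcn (n : ℕ) : ContinuousOn (fun t : ℝ => g (a + t * v + n * v)) (Set.Icc 0 1) := by
    have : ContinuousOn (fun t : ℝ => g (a + (t + n : ℝ) * v)) (Set.Icc 0 1) :=
      hcont.comp (f := fun t : ℝ => t + n) (by fun_prop) fun t ht => by
        simp only [Set.mem_Ici]; have := ht.1; positivity
    refine this.congr fun t _ => ?_
    congr 1; push_cast; ring
  have key := intervalIntegral.hasSum_integral_of_dominated_convergence (a := (0 : ℝ)) (b := 1)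
    (F := fun (n : ℕ) (t : ℝ) => g (a + t * v + n * v)) (f := H) (μ := volume)
    (fun n _ => C * Real.exp (-κ) ^ n)
    (fun n => by
      rw [Set.uIoc_of_le zero_le_one]
      exact ((hcn n).mono Set.Ioc_subset_Icc_self).aestronglyMeasurable measurableSet_Ioc)
    (fun n => .of_forall fun t ht => by
      rw [Set.uIoc_of_le zero_le_one] at ht
      have h1 := hb (t + n) (by have := ht.1; positivity)
      rw [show a + t * v + n * v = a + (t + n : ℝ) * v by push_cast; ring]
      refine h1.trans ?_
      rw [← Real.exp_nat_mul]
      exact mul_le_mul_of_nonneg_left (Real.exp_le_exp.2 (by nlinarith [ht.1])) hC)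
    (.of_forall fun t _ => (summable_geometric_of_lt_one (Real.exp_pos _).le
      (by rw [Real.exp_lt_one_iff]; linarith)).mul_left _)
    (by simp)
    (.of_forall fun t ht => by
      rw [Set.uIoc_of_le zero_le_one] at ht
      exact hH t ⟨ht.1.le, ht.2⟩)
  refine key.tendsto_sum_nat.congr fun N => ?_
  have hadj := intervalIntegral.sum_integral_adjacent_intervals (a := fun k : ℕ => (k : ℝ))
    (f := fun t : ℝ => g (a + t * v)) (n := N) (μ := volume) fun k _ => by
      refine (hcont.mono fun x hx => ?_).intervalIntegrable
      rw [Set.uIcc_of_le (by simp)] at hx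
      exact (Nat.cast_nonneg k).trans hx.1
  rw [Nat.cast_zero] at hadj
  rw [← hadj]
  refine Finset.sum_congr rfl fun k _ => ?_
  have := intervalIntegral.integral_comp_add_right (fun t : ℝ => g (a + t * v)) (a := 0) (b := 1)
    (k : ℝ)
  rw [zero_add, add_comm (1 : ℝ)] at this
  push_cast
  rw [← this]
  refine intervalIntegral.integral_congr fun t _ => ?_
  congr 1; push_cast; ring

lemma countable_lattice (τ : ℂ) : (lattice τ).Countable := Set.countable_range _

lemma not_mem_lattice {τ : ℂ} (hτ : 0 < τ.im) {x y : ℝ} (hx : -1 < x) (hx0 : x < 0) :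
    (x + y * τ⁻¹ : ℂ) ∉ lattice τ := by
  rintro ⟨⟨m, n⟩, h⟩
  have h1 := coords_unique (inv_im_neg hτ).ne (s := m) (t := n) (s' := x) (t' := y)
    (by exact_mod_cast h)
  have h2 : (m : ℝ) < 0 := h1.1 ▸ hx0
  have h3 : (-1 : ℝ) < m := h1.1 ▸ hx
  have h4 : m < 0 := by exact_mod_cast h2
  have h5 : -1 < m := by exact_mod_cast h3
  omega

lemma integrable_of_integrableOn_Ioi {g p : ℝ → ℂ} (hp : IntegrableOn p (Set.Ioi 0))
    (hgp : ∀ s, g (-s) = p s) (hg : IntegrableOn g (Set.Ioi 0)) :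
    Integrable g ∧ ∫ s, g s = (∫ s in Set.Ioi (0 : ℝ), p s) + ∫ s in Set.Ioi (0 : ℝ), g s := by
  have h1 : IntegrableOn p (Set.Ici (-0)) := by
    rwa [neg_zero, integrableOn_Ici_iff_integrableOn_Ioi]
  have h2 : IntegrableOn g (Set.Iic 0) :=
    h1.comp_neg_Iic.congr_fun (fun s _ => by simp [← hgp]) measurableSet_Iic
  refine ⟨?_, ?_⟩
  · rw [← integrableOn_univ, ← Set.Iic_union_Ioi (a := (0 : ℝ))]
    exact h2.union hg
  · rw [← intervalIntegral.integral_Iic_add_Ioi h2 hg]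
    congr 1
    have := integral_comp_neg_Iic (0 : ℝ) p
    rw [neg_zero] at this
    rw [← this]
    exact integral_congr_ae (.of_forall fun s => by simp [← hgp])

/-- The summation of the integrand over all translates by the lattice points of the positive
cone, whose boundary integral over a fundamental cell is the state integral. -/
def cellFun (τ z : ℂ) : ℂ := f₀ τ z * Usum τ z * Vsum τ z

/-- The state integral as the integral of `cellFun` around a period parallelogram: the two halves
of the contour are rotated onto the rays in the directions of the periods, and the integrals along
these rays are folded up to the sides of the parallelogram. -/
theorem integral_f₀_eq_perInt {τ : ℂ} (hτ : 0 < τ.im) {δ : ℝ} (h0 : 0 < δ) (h1 : δ < 1 / 4) :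
    Integrable (fun s : ℝ => f₀ τ (-δ * (1 + τ⁻¹) - s * (I * (bOf τ)⁻¹))) ∧
    I * (bOf τ)⁻¹ * ∫ s : ℝ, f₀ τ (-δ * (1 + τ⁻¹) - s * (I * (bOf τ)⁻¹)) =
      perInt (-δ * (1 + τ⁻¹)) τ⁻¹ (cellFun τ) := by
  have hτ0 := ne_zero_of_im_pos hτ
  have hr := inv_im_neg hτ
  have hb0 : bOf τ ≠ 0 := fun h => by have := bOf_re_pos hτ; simp [h] at this
  obtain ⟨C₁, κ₁, hκ₁, hL⟩ := exists_bound_left hτ h0 h1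
  obtain ⟨C₀, hC₀⟩ := exists_f₀_eq_fRight hτ
  obtain ⟨C₂, κ₂, hκ₂, hR⟩ := exists_bound_right hτ C₀ h0 h1
  set a : ℂ := -δ * (1 + τ⁻¹) with ha
  set d : ℂ := I * (bOf τ)⁻¹ with hd
  have hd0 : d ≠ 0 := mul_ne_zero I_ne_zero (inv_ne_zero hb0)
  have hai : a.im = -(δ * (τ⁻¹).im) := by rw [ha]; simp
  -- positivity conditions on the two sides through `a`
  have bot1 (t : ℝ) : 0 < (-τ⁻¹ - (a + t)).im := by
    simp only [sub_im, add_im, neg_im, ofReal_im, hai]; nlinarith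
  have bot2 (t : ℝ) : 0 < (-τ⁻¹ - 2 * (a + t)).im := by
    rw [show -τ⁻¹ - 2 * (a + t) = -τ⁻¹ - a - a - (2 * t : ℝ) by push_cast; ring]
    simp only [sub_im, neg_im, ofReal_im, hai]; nlinarith
  have hta : τ * a = -(δ : ℝ) * τ - (δ : ℝ) := by rw [ha]; field_simp; ring
  have left1 (t : ℝ) : 0 < (τ * (a + t * τ⁻¹ + 1)).im := by
    rw [show τ * (a + t * τ⁻¹ + 1) = ((1 - δ : ℝ) : ℂ) * τ + ((t - δ : ℝ) : ℂ) by
      rw [mul_add, mul_add, hta]; push_cast; field_simp; ring, add_im, im_ofReal_mul, ofReal_im]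
    nlinarith
  have left2 (t : ℝ) : 0 < (τ * (2 * (a + t * τ⁻¹) + 1)).im := by
    rw [show τ * (2 * (a + t * τ⁻¹) + 1) = ((1 - 2 * δ : ℝ) : ℂ) * τ + ((2 * t - 2 * δ : ℝ) : ℂ) by
      rw [show τ * (2 * (a + t * τ⁻¹) + 1) = 2 * (τ * a) + 2 * t * (τ * τ⁻¹) + τ by ring, hta,
        mul_inv_cancel₀ hτ0]; push_cast; ring, add_im, im_ofReal_mul, ofReal_im]
    nlinarith
  have bot3 (t : ℝ) (ht : 0 ≤ t) : 0 < (τ * (a + t + 1)).im := by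
    rw [show τ * (a + t + 1) = ((1 - δ + t : ℝ) : ℂ) * τ - (δ : ℝ) by
      rw [mul_add, mul_add, hta]; push_cast; ring, sub_im, im_ofReal_mul, ofReal_im]
    nlinarith
  have bot4 (t : ℝ) (ht : 0 ≤ t) : 0 < (τ * (2 * (a + t) + 1)).im := by
    rw [show τ * (2 * (a + t) + 1) = ((1 - 2 * δ + 2 * t : ℝ) : ℂ) * τ - (2 * δ : ℝ) by
      rw [show τ * (2 * (a + t) + 1) = 2 * (τ * a) + 2 * t * τ + τ by ring, hta]; push_cast; ring,
      sub_im, im_ofReal_mul, ofReal_im]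
    nlinarith
  have left3 (t : ℝ) (ht : 0 ≤ t) : 0 < (-τ⁻¹ - (a + t * τ⁻¹)).im := by
    simp only [sub_im, add_im, neg_im, im_ofReal_mul, hai]; nlinarith
  have left4 (t : ℝ) (ht : 0 ≤ t) : 0 < (-τ⁻¹ - 2 * (a + t * τ⁻¹)).im := by
    rw [show -τ⁻¹ - 2 * (a + t * τ⁻¹) = -τ⁻¹ - a - a - (2 * t : ℝ) * τ⁻¹ by push_cast; ring]
    simp only [sub_im, neg_im, im_ofReal_mul, hai]; nlinarith
  -- the left half of the contour
  have A1 := tendsto_integral_sector (g := f₀ τ) hκ₁ (fun s t hs ht => (hL s t hs ht).1)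
    (fun s t hs ht => (hL s t hs ht).2)
  have A2 := tendsto_integral_ray_of_hasSum (g := f₀ τ) (a := a) (v := 1) (C := C₁) hκ₁
    (fun t ht => by simpa using (hL 0 t le_rfl ht).1.continuousAt)
    (fun t ht => by simpa using (hL 0 t le_rfl ht).2)
    (H := fun t => f₀ τ (a + t) * Usum τ (a + t))
    (fun t ht => by simpa using hasSum_f₀_add_nat hτ (bot3 t ht.1) (bot4 t ht.1))
  have A3 : d * ∫ s in Set.Ioi (0 : ℝ), f₀ τ (a + s * d) =
      ∫ t in (0 : ℝ)..1, f₀ τ (a + t) * Usum τ (a + t) :=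
    tendsto_nhds_unique A1 (by simpa using A2)
  have A4 := integrableOn_ray (g := f₀ τ) (a := a) (u := d) (C := C₁) hκ₁
    (fun s hs => by simpa using (hL s 0 hs le_rfl).1)
    (fun s hs => by simpa using (hL s 0 hs le_rfl).2)
  -- the right half of the contour
  have heq (t : ℝ) : f₀ τ (a + t * τ⁻¹) = fRight τ C₀ (a + t * τ⁻¹) := by
    refine hC₀ _ ?_ ?_
    · rw [show a + t * τ⁻¹ = ((-δ : ℝ) : ℂ) + ((t - δ : ℝ) : ℂ) * τ⁻¹ by
        rw [ha]; push_cast; ring]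
      exact not_mem_lattice hτ (by linarith) (by linarith)
    · rw [show 2 * (a + t * τ⁻¹) = ((-(2 * δ) : ℝ) : ℂ) + ((2 * t - 2 * δ : ℝ) : ℂ) * τ⁻¹ by
        rw [ha]; push_cast; ring]
      exact not_mem_lattice hτ (by linarith) (by linarith)
  have B1 := tendsto_integral_sector (g := fRight τ C₀) hκ₂ (fun s t hs ht => (hR s t hs ht).1)
    (fun s t hs ht => (hR s t hs ht).2)
  have B2 := tendsto_integral_ray_of_hasSum (g := fRight τ C₀) (a := a) (v := τ⁻¹) (C := C₂) hκ₂
    (fun t ht => by simpa using (hR 0 t le_rfl ht).1.continuousAt)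
    (fun t ht => by simpa using (hR 0 t le_rfl ht).2)
    (H := fun t => f₀ τ (a + t * τ⁻¹) * Vsum τ (a + t * τ⁻¹))
    (fun t ht => by
      refine (hasSum_f₀_add_nat_mul_inv hτ (left3 t ht.1) (left4 t ht.1)).congr_fun fun n => ?_
      have := heq (t + n)
      push_cast at this
      rw [show a + t * τ⁻¹ + n * τ⁻¹ = a + (t + n) * τ⁻¹ by ring, this])
  have B3 : -d * ∫ s in Set.Ioi (0 : ℝ), fRight τ C₀ (a + s * -d) =
      τ⁻¹ * ∫ t in (0 : ℝ)..1, f₀ τ (a + t * τ⁻¹) * Vsum τ (a + t * τ⁻¹) :=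
    tendsto_nhds_unique B1 (B2.const_mul τ⁻¹)
  have B4 := integrableOn_ray (g := fRight τ C₀) (a := a) (u := -d) (C := C₂) hκ₂
    (fun s hs => by simpa using (hR s 0 hs le_rfl).1)
    (fun s hs => by simpa using (hR s 0 hs le_rfl).2)
  have hae : ∀ᵐ s : ℝ, fRight τ C₀ (a + s * -d) = f₀ τ (a - s * d) := by
    have hinj (c : ℂ) (hc : c ≠ 0) : Function.Injective fun s : ℝ => c * (a - s * d) := by
      intro s t hst
      have h1 := mul_left_cancel₀ hc hst
      have h2 : (s : ℂ) * d = t * d := by linear_combination -h1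
      exact_mod_cast mul_right_cancel₀ hd0 h2
    have c1 := ((countable_lattice τ).preimage (hinj 1 one_ne_zero)).ae_notMem volume
    have c2 := ((countable_lattice τ).preimage (hinj 2 two_ne_zero)).ae_notMem volume
    filter_upwards [c1, c2] with s h1 h2
    rw [hC₀ (a - s * d) (by simpa using h1) h2]
    congr 1
    ring
  have B5 : IntegrableOn (fun s : ℝ => f₀ τ (a - s * d)) (Set.Ioi 0) :=
    B4.congr_fun_ae (ae_restrict_of_ae hae)
  have B6 : ∫ s in Set.Ioi (0 : ℝ), fRight τ C₀ (a + s * -d) =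
      ∫ s in Set.Ioi (0 : ℝ), f₀ τ (a - s * d) :=
    integral_congr_ae (ae_restrict_of_ae hae)
  obtain ⟨hint, hsplit⟩ := integrable_of_integrableOn_Ioi (g := fun s : ℝ => f₀ τ (a - s * d))
    (p := fun s : ℝ => f₀ τ (a + s * d)) A4 (fun s => by congr 1; push_cast; ring) B5
  refine ⟨hint, ?_⟩
  rw [hsplit, ← B6, mul_add, A3, perInt]
  have P1 : (∫ t in (0 : ℝ)..1, (cellFun τ (a + t) - cellFun τ (a + τ⁻¹ + t))) =
      ∫ t in (0 : ℝ)..1, f₀ τ (a + t) * Usum τ (a + t) := by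
    refine intervalIntegral.integral_congr fun t _ => ?_
    rw [cellFun, cellFun, add_right_comm a, Usum_add_inv hτ0,
      mul_right_comm (f₀ τ (a + t + τ⁻¹)), f₀_mul_Vsum_add_inv hτ (bot1 t) (bot2 t)]
    ring
  have P2 : (∫ t in (0 : ℝ)..1, (cellFun τ (a + t * τ⁻¹) - cellFun τ (a + 1 + t * τ⁻¹))) =
      ∫ t in (0 : ℝ)..1, f₀ τ (a + t * τ⁻¹) * Vsum τ (a + t * τ⁻¹) := by
    refine intervalIntegral.integral_congr fun t _ => ?_
    rw [cellFun, cellFun, add_right_comm a, Vsum_add_one,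
      f₀_mul_Usum_add_one hτ (left1 t) (left2 t)]
    ring
  rw [P1, P2, ← B3]
  ring

/-! ### The integrand in the coordinate `z` -/

lemma faddeev_eq_phi {τ : ℂ} (hτ : 0 < τ.im) (z : ℂ) :
    faddeev (bOf τ) (cb τ + I * bOf τ * z) = phi τ z := by
  have hb2 := bOf_sq τ
  have hb0 : bOf τ ≠ 0 := fun h => by have := bOf_re_pos hτ; simp [h] at this
  rw [faddeev, phi, cb, hb2]
  set b := bOf τ
  have hτ0 := ne_zero_of_im_pos hτ
  have e1 : -(exp (Real.pi * I * τ) * exp (2 * Real.pi * b * (I / 2 * (b + b⁻¹) + I * b * z))) =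
      ee (τ * (z + 1)) := by
    rw [neg_eq_neg_one_mul, ← ee_half, ee, ← Complex.exp_add, ← Complex.exp_add,
      ← ee_add_one (τ * (z + 1)), ee]
    congr 1
    rw [← hb2]
    field_simp
    ring
  have e2 : exp (2 * Real.pi * I * τ) = ee τ := rfl
  have e3 : exp (-(2 * Real.pi * I / τ)) = ee (-τ⁻¹) := by
    rw [ee]; congr 1; field_simp
  have e4 : -(exp (-(Real.pi * I / τ)) *
      exp (2 * Real.pi * b⁻¹ * (I / 2 * (b + b⁻¹) + I * b * z))) = ee z := by
    rw [neg_eq_neg_one_mul, ← ee_half, ee, ← Complex.exp_add, ← Complex.exp_add, ← ee_add_one z, ee]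
    congr 1
    rw [← hb2]
    field_simp
    ring
  rw [e1, e2, e3, e4]

lemma integrand_eq_f₀ {τ : ℂ} (hτ : 0 < τ.im) (z : ℂ) :
    integrand τ (cb τ + I * bOf τ * z) = f₀ τ z := by
  have hb2 := bOf_sq τ
  have hb0 : bOf τ ≠ 0 := fun h => by have := bOf_re_pos hτ; simp [h] at this
  have e : 2 * (cb τ + I * bOf τ * z) - cb τ = cb τ + I * bOf τ * (2 * z) := by ring
  rw [integrand, e, faddeev_eq_phi hτ, faddeev_eq_phi hτ, f₀, gauss]
  congr 2
  rw [cb]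
  set b := bOf τ
  rw [← hb2]
  field_simp
  linear_combination (-1 * (1 + b ^ 2 * (1 + 4 * z)) ^ 2) * I_sq

/-- The state integral over the contour at height `ε` is an integral around a period
parallelogram; the height of the contour fixes the position of the parallelogram. -/
theorem integral_contour_eq_perInt {τ : ℂ} (hτ : 0 < τ.im) {ε : ℝ} (h0 : 0 < ε)
    (h1 : ε < (bOf τ + (bOf τ)⁻¹).re / 4) :
    ∃ δ : ℝ, 0 < δ ∧ δ < 1 / 4 ∧ Integrable (fun t : ℝ => integrand τ (contour τ ε t)) ∧
      ∫ t : ℝ, integrand τ (contour τ ε t) =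
        -(I * bOf τ) * perInt (-δ * (1 + τ⁻¹)) τ⁻¹ (cellFun τ) := by
  have hb0 : bOf τ ≠ 0 := fun h => by have := bOf_re_pos hτ; simp [h] at this
  have hτ0 := ne_zero_of_im_pos hτ
  set y : ℝ := (cb τ).im with hy
  have hy1 : y = (bOf τ + (bOf τ)⁻¹).re / 2 := by
    rw [hy, cb, show I / 2 * (bOf τ + (bOf τ)⁻¹) =
      I * (((1 / 2 : ℝ) : ℂ) * (bOf τ + (bOf τ)⁻¹)) by push_cast; ring, I_mul_im, re_ofReal_mul]
    ring
  have hy0 : 0 < y := by linarith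
  have hδ : ε / (2 * y) < 1 / 4 := by rw [div_lt_iff₀ (by linarith)]; linarith
  have hδ' : 0 < ε / (2 * y) := by positivity
  set δ : ℝ := 1 / 4 - ε / (2 * y) with hδd
  obtain ⟨hi, he⟩ := integral_f₀_eq_perInt hτ (δ := δ) (by linarith) (by linarith)
  set c : ℝ := ε / y * (cb τ).re with hc
  have hcb : ((cb τ).re : ℂ) + y * I = cb τ := re_add_im _
  have hcontour (s : ℝ) : contour τ ε (s + c) =
      cb τ + I * bOf τ * (-δ * (1 + τ⁻¹) - s * (I * (bOf τ)⁻¹)) := by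
    have e1 : I * bOf τ * (1 + τ⁻¹) = 2 * cb τ := by
      have hinv : τ⁻¹ = (bOf τ)⁻¹ ^ 2 := by rw [inv_pow, bOf_sq]
      rw [cb, hinv]
      field_simp
    have e2 : I * bOf τ * (I * (bOf τ)⁻¹) = -1 := by
      field_simp
      rw [I_sq]
    have e3 : cb τ + I * bOf τ * (-δ * (1 + τ⁻¹) - s * (I * (bOf τ)⁻¹)) =
        cb τ / 2 + ε / y * cb τ + s := by
      have hyc : (y : ℂ) ≠ 0 := by exact_mod_cast hy0.ne'
      have : (δ : ℂ) = 1 / 4 - ε / (2 * y) := by rw [hδd]; push_cast; ring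
      linear_combination (-(δ : ℂ)) * e1 - s * e2 - 2 * cb τ * this
    have e4 : (ε : ℂ) / y * cb τ = c + I * ε := by
      have hyc : (y : ℂ) ≠ 0 := by exact_mod_cast hy0.ne'
      rw [← hcb, hc]
      push_cast
      field_simp
    rw [e3, e4, contour]
    push_cast
    ring
  have hfun : (fun s : ℝ => f₀ τ (-δ * (1 + τ⁻¹) - s * (I * (bOf τ)⁻¹))) =
      fun s : ℝ => integrand τ (contour τ ε (s + c)) := by
    funext s
    rw [hcontour, integrand_eq_f₀ hτ]
  rw [hfun] at hi he
  refine ⟨δ, by linarith, by linarith, ?_, ?_⟩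
  · simpa using hi.comp_sub_right c
  · rw [integral_add_right_eq_self (fun s : ℝ => integrand τ (contour τ ε s)) c] at he
    rw [← he]
    have : -(I * bOf τ) * (I * (bOf τ)⁻¹) = 1 := by
      field_simp
      rw [I_sq]; ring
    rw [← mul_assoc, this, one_mul]

/-! ### Modular transformation of the constants -/

lemma E₂_ee (z : UpperHalfPlane) : E₂ (ee z) = EisensteinSeries.E2 z := by
  have hq : ‖ee (z : ℂ)‖ < 1 := norm_ee_lt_one z.im_pos
  have h1 : EisensteinSeries.E2 z =
      1 - 24 * ∑' n : ℕ+, (ArithmeticFunction.sigma 1 n : ℂ) * ee z ^ (n : ℕ) := by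
    rw [EisensteinSeries.E2_eq_tsum_cexp]
    rfl
  rw [h1, E₂, ← tsum_prod_pow_eq_tsum_sigma 1 hq,
    tsum_pnat_eq_tsum_succ (f := fun d => ∑' c : ℕ+, (c : ℂ) ^ 1 * ee z ^ (d * c : ℕ))]
  congr 2
  refine tsum_congr fun n => ?_
  have hn : ‖ee (z : ℂ) ^ (n + 1)‖ < 1 := by
    rw [norm_pow]; exact pow_lt_one₀ (norm_nonneg _) hq (by simp)
  rw [← tsum_coe_mul_geometric_of_norm_lt_one hn,
    ← tsum_zero_pnat_eq_tsum_nat (f := fun k : ℕ => (k : ℂ) * (ee z ^ (n + 1)) ^ k)]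
  · simp [pow_mul]
  · exact (hasSum_coe_mul_geometric_of_norm_lt_one hn).summable

/-- The quasimodularity of `E₂` under `τ ↦ -1 / τ`. -/
lemma sq_mul_E₂_sub {τ : ℂ} (hτ : 0 < τ.im) :
    τ ^ 2 * E₂ (ee τ) - E₂ (ee (-τ⁻¹)) = -(6 * τ / (Real.pi * I)) := by
  set z : UpperHalfPlane := ⟨τ, hτ⟩ with hz
  have hτ0 := ne_zero_of_im_pos hτ
  have h := EisensteinSeries.G2_S_transform z
  have hS : ((ModularGroup.S • z : UpperHalfPlane) : ℂ) = -τ⁻¹ := by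
    rw [UpperHalfPlane.modular_S_smul]
    simp [hz, inv_neg]
  have e1 : E₂ (ee τ) = EisensteinSeries.E2 z := E₂_ee z
  have e2 : E₂ (ee (-τ⁻¹)) = EisensteinSeries.E2 (ModularGroup.S • z) := by rw [← E₂_ee, hS]
  have e3 (w : UpperHalfPlane) : EisensteinSeries.G2 w = Real.pi ^ 2 / 3 * EisensteinSeries.E2 w := by
    have : (Real.pi : ℂ) ≠ 0 := by exact_mod_cast Real.pi_ne_zero
    rw [EisensteinSeries.E2, Pi.smul_apply, smul_eq_mul, riemannZeta_two]
    field_simp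
    ring
  rw [e3, e3, ← e1, ← e2, show (z : ℂ) = τ from rfl] at h
  have hpi : (Real.pi : ℂ) ≠ 0 := by exact_mod_cast Real.pi_ne_zero
  field_simp at h ⊢
  linear_combination I * h + 6 * τ * I_sq

/-- The constant that all residues have in common. -/
def residueConst (τ : ℂ) : ℂ :=
  qPochInf (ee τ) (ee τ) ^ 3 / qPochInf (ee (-τ⁻¹)) (ee (-τ⁻¹)) ^ 3 * gauss τ 0

/-- The Dedekind eta function as a q-Pochhammer symbol. -/
lemma eta_eq {τ : ℂ} (hτ : 0 < τ.im) :
    ModularForm.eta τ = ee (τ / 24) * qPochInf (ee τ) (ee τ) := by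
  rw [ModularForm.eta, qPochInf_eq_tprod _ (norm_ee_lt_one hτ)]
  congr 1
  · rw [Function.Periodic.qParam, ee]; congr 1; push_cast; ring
  · refine tprod_congr fun n => ?_
    rw [ModularForm.eta_q_eq_pow, pow_succ', ee]

/-- The transformation law of the Dedekind eta function, as it enters the state integral. -/
lemma residueConst_eq {τ : ℂ} (hτ : 0 < τ.im) :
    2 * exp (Real.pi * I / 4) * (-(I * bOf τ) * residueConst τ) = -(2 / τ) := by
  have hτ0 := ne_zero_of_im_pos hτ
  have hb0 : bOf τ ≠ 0 := fun h => by have := bOf_re_pos hτ; simp [h] at this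
  have hη := ModularForm.eta_comp_eq_csqrt_I_inv (show τ ∈ UpperHalfPlane.upperHalfPlaneSet from hτ)
  have hs (z : ℂ) : sqrt z = bOf z := by
    rw [bOf, sqrt]
    norm_num
  have hI : bOf I = exp (Real.pi * I / 4) := by
    rw [bOf, cpow_def_of_ne_zero I_ne_zero, log_I]
    congr 1
    ring
  have hη' : ee (-τ⁻¹ / 24) * qPochInf (ee (-τ⁻¹)) (ee (-τ⁻¹)) =
      (bOf I)⁻¹ * (bOf τ * (ee (τ / 24) * qPochInf (ee τ) (ee τ))) := by
    rw [← eta_eq hτ, ← eta_eq (neg_inv_im_pos hτ), ← hs, ← hs]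
    simpa [neg_div] using hη
  have hP0 : qPochInf (ee (-τ⁻¹)) (ee (-τ⁻¹)) ≠ 0 :=
    qPochInf_ne_zero_of_norm_lt (norm_ee_lt_one (neg_inv_im_pos hτ))
      (norm_ee_lt_one (neg_inv_im_pos hτ))
  have hI0 : bOf I ≠ 0 := by rw [hI]; exact exp_ne_zero _
  have hI2 : bOf I ^ 2 = I := bOf_sq I
  have hb2 := bOf_sq τ
  have hg : gauss τ 0 * ee (-τ⁻¹ / 24) ^ 3 = I * ee (τ / 24) ^ 3 := by
    calc _ = exp (Real.pi / 2 * I) * ee (τ / 24) ^ 3 := by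
          rw [gauss, ← ee_nat_mul, ← ee_nat_mul, ee, ee, ← Complex.exp_add, ← Complex.exp_add]
          congr 1
          field_simp
          push_cast
          ring
      _ = _ := by rw [exp_pi_div_two_mul_I]
  rw [← hI, residueConst]
  generalize bOf I = ι at *
  generalize bOf τ = β at *
  set P := qPochInf (ee τ) (ee τ)
  set P' := qPochInf (ee (-τ⁻¹)) (ee (-τ⁻¹))
  set u := ee (τ / 24)
  set v := ee (-τ⁻¹ / 24)
  have hv : v ≠ 0 := ee_ne_zero _
  have hu : u ≠ 0 := ee_ne_zero _
  have hvP : v * P' * ι = β * (u * P) := by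
    rw [hη']; field_simp
  have hg' : gauss τ 0 = I * u ^ 3 / v ^ 3 := by
    rw [eq_div_iff (pow_ne_zero _ hv), hg]
  have h3 : v ^ 3 * P' ^ 3 * (ι * I) = β * τ * (u ^ 3 * P ^ 3) := by
    calc _ = (v * P' * ι) ^ 3 := by rw [← hI2]; ring
      _ = _ := by rw [hvP, ← hb2]; ring
  rw [hg']
  field_simp
  linear_combination (-ι) * h3 + v ^ 3 * P' ^ 3 * I * hI2 +
    (v ^ 3 * P' ^ 3 - ι * β * τ * P ^ 3 * u ^ 3) * I_sq

/-! ### The twelve series in terms of `qSum` -/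

lemma Fplus_eq (q ε : ℂ) : Fplus q ε =
    qPochInf (q * exp ε) q ^ 2 * qPochInf (q * exp (2 * ε)) q / qPochInf q q ^ 3 *
      (exp ε * qSum 2 q (q * exp ε ^ 4) (q * exp ε) (q * exp (2 * ε))) := by
  rw [Fplus]
  congr 1
  rw [qSum, ← tsum_mul_left]
  refine tsum_congr fun m => ?_
  rw [qTerm, show exp (ε * (4 * m + 1)) = exp ε * (exp ε ^ 4) ^ m by
    rw [← pow_mul, ← Complex.exp_nat_mul, ← Complex.exp_add]; congr 1; push_cast; ring]
  ring

lemma Fminus_eq (q ε : ℂ) : Fminus q ε =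
    qPochInf q q ^ 3 / (qPochInf (q * exp (-ε)) q ^ 2 * qPochInf (q * exp (-(2 * ε))) q) *
      (exp ε * qSum 1 q (q * exp ε ^ 2) (q * exp ε) (q * exp (2 * ε))) := by
  rw [Fminus]
  congr 1
  rw [qSum, ← tsum_mul_left]
  refine tsum_congr fun m => ?_
  rw [qTerm, show exp (ε * (2 * m + 1)) = exp ε * (exp ε ^ 2) ^ m by
    rw [← pow_mul, ← Complex.exp_nat_mul, ← Complex.exp_add]; congr 1; push_cast; ring]
  ring

lemma tsum_plus_odd (x q : ℂ) :
    ∑' m : ℕ, q ^ ((2 * m + 1) * (m + 1)) / (qPoch x q m ^ 2 * qPoch q q (2 * m + 1)) =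
      q / (1 - q) * qSum 2 q (q ^ 3) x (q ^ 2) := by
  rw [qSum, ← tsum_mul_left]
  congr 1
  funext m
  rw [qTerm, qPoch_succ', ← pow_two]
  generalize 1 - q = w
  ring

lemma tsum_minus_odd (x q : ℂ) :
    ∑' n : ℕ, q ^ (n * (n + 2)) / (qPoch x q n ^ 2 * qPoch q q (2 * n + 1)) =
      1 / (1 - q) * qSum 1 q (q ^ 2) x (q ^ 2) := by
  rw [qSum, ← tsum_mul_left]
  congr 1
  funext m
  rw [qTerm, qPoch_succ', ← pow_two]
  generalize 1 - q = w
  ring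

lemma tsum_plus_even (x q : ℂ) :
    ∑' m : ℕ, q ^ ((2 * m + 1) * m) / (qPoch x q m ^ 2 * qPoch q q (2 * m)) =
      qSum 2 q q x q := by
  rw [qSum]
  congr 1
  funext m
  rw [qTerm]
  ring

lemma tsum_minus_even (x q : ℂ) :
    ∑' n : ℕ, q ^ (n * (n + 1)) / (qPoch x q n ^ 2 * qPoch q q (2 * n)) =
      qSum 1 q q x q := by
  rw [qSum]
  congr 1
  funext m
  rw [qTerm]
  ring

lemma Hplus_three (s : ℂ) : Hplus s 3 = qPochInf (s ^ 3) (s ^ 2) ^ 2 / qPochInf (s ^ 2) (s ^ 2) ^ 2 *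
    (s ^ 2 / (1 - s ^ 2) * qSum 2 (s ^ 2) ((s ^ 2) ^ 3) (s ^ 3) ((s ^ 2) ^ 2)) := by
  rw [← tsum_plus_odd]; rfl

lemma Hplus_four (s : ℂ) : Hplus s 4 =
    qPochInf (-s ^ 2) (s ^ 2) ^ 2 / qPochInf (s ^ 2) (s ^ 2) ^ 2 *
      qSum 2 (s ^ 2) (s ^ 2) (-s ^ 2) (s ^ 2) := by
  rw [← tsum_plus_even]; rfl

lemma Hplus_five (s : ℂ) : Hplus s 5 = Hplus (-s) 3 := by
  rw [Hplus_three, neg_sq, Odd.neg_pow (by decide), ← tsum_plus_odd]; rfl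

lemma Hminus_three (s : ℂ) : Hminus s 3 =
    qPochInf (s ^ 2) (s ^ 2) ^ 2 / qPochInf s⁻¹ (s ^ 2) ^ 2 *
      (1 / (1 - s ^ 2) * qSum 1 (s ^ 2) ((s ^ 2) ^ 2) (s ^ 3) ((s ^ 2) ^ 2)) := by
  rw [← tsum_minus_odd]; rfl

lemma Hminus_four (s : ℂ) : Hminus s 4 =
    qPochInf (s ^ 2) (s ^ 2) ^ 2 / qPochInf (-1) (s ^ 2) ^ 2 *
      qSum 1 (s ^ 2) (s ^ 2) (-s ^ 2) (s ^ 2) := by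
  rw [← tsum_minus_even]; rfl

lemma Hminus_five (s : ℂ) : Hminus s 5 = Hminus (-s) 3 := by
  rw [Hminus_three, neg_sq, Odd.neg_pow (by decide), inv_neg, ← tsum_minus_odd]; rfl

lemma analyticAt_Fplus {f g : ℂ → ℂ} {w : ℂ} (hf : AnalyticAt ℂ f w) (hg : AnalyticAt ℂ g w)
    (hq : ‖f w‖ < 1) (h1 : ‖f w * exp (g w)‖ < 1) (h2 : ‖f w * exp (2 * g w)‖ < 1) :
    AnalyticAt ℂ (fun z => Fplus (f z) (g z)) w := by
  simp only [Fplus_eq]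
  have e1 : AnalyticAt ℂ (fun z => f z * exp (g z)) w := hf.mul hg.cexp
  have e2 : AnalyticAt ℂ (fun z => f z * exp (2 * g z)) w := hf.mul (analyticAt_const.mul hg).cexp
  refine ((((analyticAt_qPochInf e1 hf hq).pow 2).mul (analyticAt_qPochInf e2 hf hq)).div
    ((analyticAt_qPochInf hf hf hq).pow 3)
    (pow_ne_zero _ (qPochInf_ne_zero_of_norm_lt hq hq))).mul (hg.cexp.mul
    (analyticAt_qSum one_le_two hf (hf.mul (hg.cexp.pow 4)) e1 e2 hq h1 h2))

lemma analyticAt_Fminus {f g : ℂ → ℂ} {w : ℂ} (hf : AnalyticAt ℂ f w) (hg : AnalyticAt ℂ g w)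
    (hq : ‖f w‖ < 1) (h1 : ‖f w * exp (g w)‖ < 1) (h2 : ‖f w * exp (2 * g w)‖ < 1)
    (h3 : ‖f w * exp (-g w)‖ < 1) (h4 : ‖f w * exp (-(2 * g w))‖ < 1) :
    AnalyticAt ℂ (fun z => Fminus (f z) (g z)) w := by
  simp only [Fminus_eq]
  have e1 : AnalyticAt ℂ (fun z => f z * exp (g z)) w := hf.mul hg.cexp
  have e2 : AnalyticAt ℂ (fun z => f z * exp (2 * g z)) w := hf.mul (analyticAt_const.mul hg).cexp
  have e3 : AnalyticAt ℂ (fun z => f z * exp (-g z)) w := hf.mul hg.fun_neg.cexp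
  have e4 : AnalyticAt ℂ (fun z => f z * exp (-(2 * g z))) w :=
    hf.mul (analyticAt_const.mul hg).fun_neg.cexp
  refine (((analyticAt_qPochInf hf hf hq).pow 3).div
    (((analyticAt_qPochInf e3 hf hq).pow 2).mul (analyticAt_qPochInf e4 hf hq))
    (mul_ne_zero (pow_ne_zero _ (qPochInf_ne_zero_of_norm_lt hq h3))
      (qPochInf_ne_zero_of_norm_lt hq h4))).mul (hg.cexp.mul
    (analyticAt_qSum le_rfl hf (hf.mul (hg.cexp.pow 2)) e1 e2 hq h1 h2))

/-! ### The summed integrand near its poles -/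

/-- The numerator of `cellFun`, which has no poles in the period parallelogram. -/
def cellNum (τ z : ℂ) : ℂ :=
  qPochInf (ee (τ * (z + 1))) (ee τ) ^ 2 * qPochInf (ee (τ * (2 * z + 1))) (ee τ) * Usum τ z *
    gauss τ (2 * z) * Vsum τ z /
    (qPochInf (ee (z - τ⁻¹)) (ee (-τ⁻¹)) ^ 2 * qPochInf (ee (2 * z - 2 * τ⁻¹)) (ee (-τ⁻¹)))

lemma qPochInf_ee_eq {τ : ℂ} (hτ : 0 < τ.im) (z : ℂ) :
    qPochInf (ee z) (ee (-τ⁻¹)) = (1 - ee z) * qPochInf (ee (z - τ⁻¹)) (ee (-τ⁻¹)) := by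
  rw [qPochInf_eq_one_sub_mul _ (norm_ee_neg_inv_lt_one hτ), ← ee_add, ← sub_eq_add_neg]

lemma cellFun_eq {τ : ℂ} (hτ : 0 < τ.im) (z : ℂ) : cellFun τ z =
    cellNum τ z / ((1 - ee z) ^ 3 * (1 + ee z) * (1 - ee (2 * z - τ⁻¹))) := by
  rw [cellFun, f₀, phi, phi, qPochInf_ee_eq hτ z, qPochInf_ee_eq hτ (2 * z),
    qPochInf_ee_eq hτ (2 * z - τ⁻¹), cellNum, show 2 * z - τ⁻¹ - τ⁻¹ = 2 * z - 2 * τ⁻¹ by ring,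
    ee_two_mul z, show 1 - ee z ^ 2 = (1 - ee z) * (1 + ee z) by ring]
  generalize 1 - ee z = w
  generalize 1 + ee z = w'
  generalize 1 - ee (2 * z - τ⁻¹) = w''
  ring

lemma analyticAt_cellNum {τ z : ℂ} (hτ : 0 < τ.im) {x y : ℝ} (hz : z = x + y * τ⁻¹)
    (hx : -(1 / 2) < x) (hy : -(1 / 2) < y) (hy1 : y < 1) : AnalyticAt ℂ (cellNum τ) z := by
  have hτ0 := ne_zero_of_im_pos hτ
  have hr := inv_im_neg hτ
  have i1 : (τ * (z + 1)).im = (x + 1) * τ.im := by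
    rw [hz, show τ * (x + y * τ⁻¹ + 1) = ((x + 1 : ℝ) : ℂ) * τ + (y : ℝ) by
      push_cast; field_simp; ring, add_im, im_ofReal_mul, ofReal_im, add_zero]
  have i2 : (τ * (2 * z + 1)).im = (2 * x + 1) * τ.im := by
    rw [hz, show τ * (2 * (x + y * τ⁻¹) + 1) = ((2 * x + 1 : ℝ) : ℂ) * τ + (2 * y : ℝ) by
      push_cast; field_simp; ring, add_im, im_ofReal_mul, ofReal_im, add_zero]
  have i3 : (z - τ⁻¹).im = (y - 1) * τ⁻¹.im := by
    rw [hz, show x + y * τ⁻¹ - τ⁻¹ = ((y - 1 : ℝ) : ℂ) * τ⁻¹ + (x : ℝ) by push_cast; ring,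
      add_im, im_ofReal_mul, ofReal_im, add_zero]
  have i4 : (2 * z - 2 * τ⁻¹).im = 2 * (y - 1) * τ⁻¹.im := by
    rw [hz, show 2 * (x + y * τ⁻¹) - 2 * τ⁻¹ = ((2 * (y - 1) : ℝ) : ℂ) * τ⁻¹ + (2 * x : ℝ) by
      push_cast; ring, add_im, im_ofReal_mul, ofReal_im, add_zero]
  have i5 : (-τ⁻¹ - z).im = -(1 + y) * τ⁻¹.im := by
    rw [hz, show -τ⁻¹ - (x + y * τ⁻¹) = ((-(1 + y) : ℝ) : ℂ) * τ⁻¹ + (-x : ℝ) by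
      push_cast; ring, add_im, im_ofReal_mul, ofReal_im, add_zero]
  have i6 : (-τ⁻¹ - 2 * z).im = -(1 + 2 * y) * τ⁻¹.im := by
    rw [hz, show -τ⁻¹ - 2 * (x + y * τ⁻¹) = ((-(1 + 2 * y) : ℝ) : ℂ) * τ⁻¹ + (-(2 * x) : ℝ) by
      push_cast; ring, add_im, im_ofReal_mul, ofReal_im, add_zero]
  have hq := norm_ee_lt_one hτ
  have hq' := norm_ee_neg_inv_lt_one hτ
  have a1 := analyticAt_qPochInf (f := fun z => ee (τ * (z + 1))) (g := fun _ => ee τ) (w := z)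
    (analyticAt_ee (by fun_prop)) analyticAt_const hq
  have a2 := analyticAt_qPochInf (f := fun z => ee (τ * (2 * z + 1))) (g := fun _ => ee τ) (w := z)
    (analyticAt_ee (by fun_prop)) analyticAt_const hq
  have a3 : AnalyticAt ℂ (Usum τ) z := analyticAt_qSum one_le_two analyticAt_const
    (analyticAt_ee (by fun_prop)) (analyticAt_ee (by fun_prop)) (analyticAt_ee (by fun_prop)) hq
    (norm_ee_lt_one (by rw [i1]; nlinarith)) (norm_ee_lt_one (by rw [i2]; nlinarith))
  have a4 : AnalyticAt ℂ (Vsum τ) z := analyticAt_qSum le_rfl analyticAt_const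
    (analyticAt_ee (by fun_prop)) (analyticAt_ee (by fun_prop)) (analyticAt_ee (by fun_prop)) hq'
    (norm_ee_lt_one (by rw [i5]; nlinarith)) (norm_ee_lt_one (by rw [i6]; nlinarith))
  have a5 := analyticAt_qPochInf (f := fun z => ee (z - τ⁻¹)) (g := fun _ => ee (-τ⁻¹)) (w := z)
    (analyticAt_ee (by fun_prop)) analyticAt_const hq'
  have a6 := analyticAt_qPochInf (f := fun z => ee (2 * z - 2 * τ⁻¹)) (g := fun _ => ee (-τ⁻¹))
    (w := z) (analyticAt_ee (by fun_prop)) analyticAt_const hq'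
  refine (((((a1.pow 2).mul a2).mul a3).mul (analyticAt_gauss τ (by fun_prop))).mul a4).div
    ((a5.pow 2).mul a6) (mul_ne_zero (pow_ne_zero _ ?_) ?_)
  · exact qPochInf_ne_zero_of_norm_lt hq' (norm_ee_lt_one (by rw [i3]; nlinarith))
  · exact qPochInf_ne_zero_of_norm_lt hq' (norm_ee_lt_one (by rw [i4]; nlinarith))

lemma gauss_eq_mul (τ w : ℂ) :
    gauss τ w = gauss τ 0 * exp (Real.pi * I * τ * (w ^ 2 + w * (1 + τ⁻¹))) := by
  rw [gauss, gauss, ← Complex.exp_add]; congr 1; ring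

/-! ### The values at the poles -/

lemma exp_two_mul_two_pi (w : ℂ) : exp (2 * (2 * Real.pi * I * w)) = ee (2 * w) := by
  rw [ee]; congr 1; ring

lemma Fplus_ee (τ z : ℂ) : Fplus (ee τ) (2 * Real.pi * I * (τ * z)) =
    qPochInf (ee (τ * (z + 1))) (ee τ) ^ 2 * qPochInf (ee (τ * (2 * z + 1))) (ee τ) /
      qPochInf (ee τ) (ee τ) ^ 3 * (ee (τ * z) * Usum τ z) := by
  rw [Fplus_eq, exp_two_mul_two_pi, ← ee, Usum, ← ee_nat_mul, ← ee_add, ← ee_add, ← ee_add]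
  push_cast
  ring_nf

lemma Fminus_ee (τ z : ℂ) : Fminus (ee (-τ⁻¹)) (2 * Real.pi * I * -z) =
    qPochInf (ee (-τ⁻¹)) (ee (-τ⁻¹)) ^ 3 /
      (qPochInf (ee (z - τ⁻¹)) (ee (-τ⁻¹)) ^ 2 * qPochInf (ee (2 * z - τ⁻¹)) (ee (-τ⁻¹))) *
      (ee (-z) * Vsum τ z) := by
  rw [Fminus_eq, ← mul_neg, ← mul_neg, ← mul_neg, exp_two_mul_two_pi, exp_two_mul_two_pi, ← ee,
    ← ee, Vsum, ← ee_nat_mul, ← ee_add, ← ee_add, ← ee_add, ← ee_add, ← ee_add]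
  push_cast
  ring_nf

/-- The identification of `cellFun`, up to its factor `(1 - exp(2πiz))⁻³`, with the two deformed
series, through which `H₀`, `H₁` and `H₂` enter. -/
lemma cellNum_div_eq {τ : ℂ} (hτ : 0 < τ.im) (z : ℂ) :
    cellNum τ z / ((1 + ee z) * (1 - ee (2 * z - τ⁻¹))) =
      residueConst τ * (Fplus (ee τ) (2 * Real.pi * I * (τ * z)) *
        Fminus (ee (-τ⁻¹)) (2 * Real.pi * I * -z) * ee (2 * τ * z ^ 2) *
        (ee z ^ 2 / (1 + ee z))) := by
  have hτ0 := ne_zero_of_im_pos hτ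
  have hq := norm_ee_lt_one hτ
  have hq' := norm_ee_neg_inv_lt_one hτ
  have h1 := qPochInf_ne_zero_of_norm_lt hq hq
  have h2 := qPochInf_ne_zero_of_norm_lt hq' hq'
  have hg : gauss τ (2 * z) = gauss τ 0 * (ee (2 * τ * z ^ 2) * ee (τ * z) * ee z) := by
    rw [gauss_eq_mul, ← ee_add, ← ee_add, ee]
    congr 2
    field_simp
    ring
  rw [Fplus_ee, Fminus_ee, qPochInf_ee_eq hτ (2 * z - τ⁻¹),
    show 2 * z - τ⁻¹ - τ⁻¹ = 2 * z - 2 * τ⁻¹ by ring, cellNum, hg, residueConst, ee_neg z]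
  have hX := ee_ne_zero (τ * z)
  have hY := ee_ne_zero z
  generalize 1 - ee (2 * z - τ⁻¹) = w
  generalize 1 + ee z = w'
  generalize qPochInf (ee (z - τ⁻¹)) (ee (-τ⁻¹)) = A
  generalize qPochInf (ee (2 * z - 2 * τ⁻¹)) (ee (-τ⁻¹)) = B
  generalize qPochInf (ee (-τ⁻¹)) (ee (-τ⁻¹)) = C at *
  generalize qPochInf (ee τ) (ee τ) = D at *
  field_simp

/-- The factors of `cellNum` that depend on `q = exp(2πiτ)`. -/
def upperPart (τ z : ℂ) : ℂ :=
  qPochInf (ee (τ * (z + 1))) (ee τ) ^ 2 * qPochInf (ee (τ * (2 * z + 1))) (ee τ) * Usum τ z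

/-- The factors of `cellNum` that depend on `q̃ = exp(-2πi/τ)`. -/
def lowerPart (τ z : ℂ) : ℂ :=
  Vsum τ z / (qPochInf (ee (z - τ⁻¹)) (ee (-τ⁻¹)) ^ 2 * qPochInf (ee (2 * z - 2 * τ⁻¹)) (ee (-τ⁻¹)))

lemma cellNum_eq (τ z : ℂ) : cellNum τ z = upperPart τ z * gauss τ (2 * z) * lowerPart τ z := by
  rw [cellNum, upperPart, lowerPart]; ring

/-- The `q`-factors at the half periods with `exp(2πiτz) = s = ± q^(1/2)`, which give `H₃⁺` and
`H₅⁺`. -/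
lemma upperPart_odd {τ z s : ℂ} (hτ : 0 < τ.im) (hq : ee τ = s ^ 2) (hX : ee (τ * z) = s) :
    upperPart τ z = qPochInf (s ^ 2) (s ^ 2) ^ 3 / s ^ 2 * Hplus s 3 := by
  have hs : s ≠ 0 := hX ▸ ee_ne_zero _
  have hq1 : ‖s ^ 2‖ < 1 := hq ▸ norm_ee_lt_one hτ
  have h1 := qPochInf_ne_zero_of_norm_lt hq1 hq1
  have e1 : ee (τ * (z + 1)) = s ^ 3 := by rw [mul_add, mul_one, ee_add, hX, hq]; ring
  have e2 : ee (τ * (2 * z + 1)) = (s ^ 2) ^ 2 := by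
    rw [show τ * (2 * z + 1) = 2 * (τ * z) + τ by ring, ee_add, ee_two_mul, hX, hq]; ring
  have e3 : ee (τ * (4 * z + 1)) = (s ^ 2) ^ 3 := by
    rw [show τ * (4 * z + 1) = 2 * (2 * (τ * z)) + τ by ring, ee_add, ee_two_mul, ee_two_mul, hX,
      hq]; ring
  rw [upperPart, Usum, e1, e2, e3, hq, Hplus_three]
  have h2 : qPochInf (s ^ 2) (s ^ 2) = (1 - s ^ 2) * qPochInf ((s ^ 2) ^ 2) (s ^ 2) := by
    rw [qPochInf_eq_one_sub_mul _ hq1, ← pow_two]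
  have h3 : 1 - s ^ 2 ≠ 0 := fun h => h1 (by rw [h2, h, zero_mul])
  rw [← mul_right_inj' h3]
  have : qPochInf ((s ^ 2) ^ 2) (s ^ 2) = qPochInf (s ^ 2) (s ^ 2) / (1 - s ^ 2) := by
    rw [h2]; field_simp
  rw [this]
  generalize 1 - s ^ 2 = w at *
  generalize qPochInf (s ^ 2) (s ^ 2) = D at *
  field_simp

/-- The `q`-factors at `z = 1 / (2τ)`, which give `H₄⁺`. -/
lemma upperPart_even {τ z s : ℂ} (hτ : 0 < τ.im) (hq : ee τ = s ^ 2) (hX : ee (τ * z) = -1) :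
    upperPart τ z = qPochInf (s ^ 2) (s ^ 2) ^ 3 * Hplus s 4 := by
  have hq1 : ‖s ^ 2‖ < 1 := hq ▸ norm_ee_lt_one hτ
  have h1 := qPochInf_ne_zero_of_norm_lt hq1 hq1
  have e1 : ee (τ * (z + 1)) = -s ^ 2 := by rw [mul_add, mul_one, ee_add, hX, hq]; ring
  have e2 : ee (τ * (2 * z + 1)) = s ^ 2 := by
    rw [show τ * (2 * z + 1) = 2 * (τ * z) + τ by ring, ee_add, ee_two_mul, hX, hq]; ring
  have e3 : ee (τ * (4 * z + 1)) = s ^ 2 := by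
    rw [show τ * (4 * z + 1) = 2 * (2 * (τ * z)) + τ by ring, ee_add, ee_two_mul, ee_two_mul, hX,
      hq]; ring
  rw [upperPart, Usum, e1, e2, e3, hq, Hplus_four]
  field_simp

/-- The `q̃`-factors at the half periods with `exp(-2πiz) = s = ± q̃^(1/2)`, which give `H₃⁻` and
`H₅⁻`. -/
lemma lowerPart_odd {τ z s : ℂ} (hτ : 0 < τ.im) (hq : ee (-τ⁻¹) = s ^ 2) (hY : ee z = s⁻¹) :
    lowerPart τ z / ((1 - ee z) ^ 3 * (1 + ee z)) =
      -(s ^ 2 * Hminus s 3 / qPochInf (s ^ 2) (s ^ 2) ^ 3) := by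
  have hs : s ≠ 0 := by
    rintro rfl
    exact ee_ne_zero z (by rw [hY, inv_zero])
  have hq1 : ‖s ^ 2‖ < 1 := hq ▸ norm_ee_neg_inv_lt_one hτ
  have h1 := qPochInf_ne_zero_of_norm_lt hq1 hq1
  have e1 : ee (z - τ⁻¹) = s := by rw [sub_eq_add_neg, ee_add, hY, hq]; field_simp
  have e2 : ee (2 * z - 2 * τ⁻¹) = s ^ 2 := by rw [← mul_sub, ee_two_mul, e1]
  have e3 : ee (-τ⁻¹ - z) = s ^ 3 := by rw [ee_sub, hY, hq]; field_simp
  have e4 : ee (-τ⁻¹ - 2 * z) = (s ^ 2) ^ 2 := by rw [ee_sub, ee_two_mul, hY, hq]; field_simp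
  have h2 : qPochInf s⁻¹ (s ^ 2) = (1 - s⁻¹) * qPochInf s (s ^ 2) := by
    rw [qPochInf_eq_one_sub_mul _ hq1]
    congr 2
    field_simp
  have h3 : (1 - s⁻¹) ^ 3 * (1 + s⁻¹) = -((1 - s⁻¹) ^ 2 * (1 - s ^ 2) / s ^ 2) := by
    field_simp
    ring
  rw [lowerPart, Vsum, e1, e2, e3, e4, hq, Hminus_three, h2, hY, h3]
  generalize 1 - s⁻¹ = w
  generalize 1 - s ^ 2 = w'
  generalize qPochInf s (s ^ 2) = A
  generalize qPochInf (s ^ 2) (s ^ 2) = D at *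
  field_simp

/-- The `q̃`-factors at `z = 1 / 2`, which give `H₄⁻`. -/
lemma lowerPart_even {τ z s : ℂ} (hτ : 0 < τ.im) (hq : ee (-τ⁻¹) = s ^ 2) (hY : ee z = -1) :
    lowerPart τ z / ((1 - ee z) ^ 3 * (1 - ee (2 * z - τ⁻¹))) =
      1 / 2 * (Hminus s 4 / qPochInf (s ^ 2) (s ^ 2) ^ 3) := by
  have hq1 : ‖s ^ 2‖ < 1 := hq ▸ norm_ee_neg_inv_lt_one hτ
  have h1 := qPochInf_ne_zero_of_norm_lt hq1 hq1
  have e1 : ee (z - τ⁻¹) = -s ^ 2 := by rw [sub_eq_add_neg, ee_add, hY, hq]; ring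
  have e3 : ee (-τ⁻¹ - z) = -s ^ 2 := by rw [ee_sub, hY, hq]; ring
  have e4 : ee (-τ⁻¹ - 2 * z) = s ^ 2 := by rw [ee_sub, ee_two_mul, hY, hq]; ring
  have e5 : ee (2 * z - τ⁻¹) = s ^ 2 := by rw [sub_eq_add_neg, ee_add, ee_two_mul, hY, hq]; ring
  have h2 : qPochInf (s ^ 2) (s ^ 2) =
      (1 - ee (2 * z - τ⁻¹)) * qPochInf (ee (2 * z - 2 * τ⁻¹)) (s ^ 2) := by
    have := qPochInf_ee_eq hτ (2 * z - τ⁻¹)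
    rw [show 2 * z - τ⁻¹ - τ⁻¹ = 2 * z - 2 * τ⁻¹ by ring, hq] at this
    rw [← this, e5]
  have h3 : qPochInf (-1) (s ^ 2) = 2 * qPochInf (-s ^ 2) (s ^ 2) := by
    rw [qPochInf_eq_one_sub_mul _ hq1]
    norm_num
  rw [lowerPart, Vsum, e1, e3, e4, hq, Hminus_four, h3, hY]
  have h4 : 1 - ee (2 * z - τ⁻¹) ≠ 0 := fun h => h1 (by rw [h2, h, zero_mul])
  have h5 : qPochInf (ee (2 * z - 2 * τ⁻¹)) (s ^ 2) ≠ 0 := fun h => h1 (by rw [h2, h, mul_zero])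
  generalize qPochInf (-s ^ 2) (s ^ 2) = A
  rw [h2]
  generalize 1 - ee (2 * z - τ⁻¹) = w at *
  field_simp
  norm_num

/-! ### The residues -/

lemma deriv_deriv_mul {f g : ℂ → ℂ} {p : ℂ} (hf : AnalyticAt ℂ f p) (hg : AnalyticAt ℂ g p) :
    deriv (fun z => f z * g z) p = deriv f p * g p + f p * deriv g p ∧
    deriv (deriv fun z => f z * g z) p =
      deriv (deriv f) p * g p + 2 * deriv f p * deriv g p + f p * deriv (deriv g) p := by
  have h : ∀ᶠ z in 𝓝 p, deriv (fun z => f z * g z) z = deriv f z * g z + f z * deriv g z := by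
    filter_upwards [hf.eventually_analyticAt, hg.eventually_analyticAt] with z h1 h2
    exact deriv_fun_mul h1.differentiableAt h2.differentiableAt
  refine ⟨h.self_of_nhds, ?_⟩
  rw [EventuallyEq.deriv_eq h]
  have h1 := (hf.deriv.differentiableAt.hasDerivAt.mul hg.differentiableAt.hasDerivAt).add
    (hf.differentiableAt.hasDerivAt.mul hg.deriv.differentiableAt.hasDerivAt)
  refine h1.deriv.trans ?_
  ring

lemma deriv_deriv_comp_mul_left (c : ℂ) (f : ℂ → ℂ) :
    deriv (fun z => f (c * z)) 0 = c * deriv f 0 ∧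
    deriv (deriv fun z => f (c * z)) 0 = c ^ 2 * deriv (deriv f) 0 := by
  have h (f : ℂ → ℂ) : deriv (fun z => f (c * z)) = fun z => c * deriv f (c * z) := by
    funext z
    rw [deriv_comp_mul_left, smul_eq_mul]
  refine ⟨by simp [h], ?_⟩
  rw [h, deriv_const_mul_field, h]
  simp only [mul_zero]
  ring

/-- The contribution of the triple pole, where the factor `Y² / (1 + Y)`, `Y = exp(2πiz)`, and the
Gaussian are expanded to second order. -/
lemma triple_pole_contribution {A B : ℂ → ℂ} (hA : AnalyticAt ℂ A 0) (hB : AnalyticAt ℂ B 0)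
    (τ c : ℂ) {M : ℂ → ℂ} (hM : ∀ z, M z = c * (A (2 * Real.pi * I * (τ * z)) *
      B (2 * Real.pi * I * -z) * ee (2 * τ * z ^ 2) * (ee z ^ 2 / (1 + ee z)))) :
    AnalyticAt ℂ M 0 ∧
    M 0 - 3 / 2 / (2 * Real.pi * I) * deriv M 0 + deriv (deriv M) 0 / (2 * (2 * Real.pi * I) ^ 2) =
      c * (1 / 4 * (τ ^ 2 * deriv (deriv A) 0 * B 0 - 2 * τ * deriv A 0 * deriv B 0 +
        A 0 * deriv (deriv B) 0) + τ / (2 * Real.pi * I) * (A 0 * B 0) - A 0 * B 0 / 8) := by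
  set ω : ℂ := 2 * Real.pi * I with hω
  have hω0 : ω ≠ 0 := two_pi_I_ne_zero
  have a1 : AnalyticAt ℂ (fun z => A (ω * τ * z)) 0 :=
    AnalyticAt.comp_of_eq hA (f := fun z => ω * τ * z) (by fun_prop) (by simp)
  have a2 : AnalyticAt ℂ (fun z => B (-ω * z)) 0 :=
    AnalyticAt.comp_of_eq hB (f := fun z => -ω * z) (by fun_prop) (by simp)
  have a3 : AnalyticAt ℂ (fun z => ee (2 * τ * z ^ 2)) 0 := analyticAt_ee (by fun_prop)
  have hne : ∀ᶠ z in 𝓝 (0 : ℂ), 1 + ee z ≠ 0 := by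
    refine ContinuousAt.eventually_ne (continuousAt_const.add continuous_ee.continuousAt) ?_
    rw [ee_zero]; norm_num
  have a4 : AnalyticAt ℂ (fun z => ee z ^ 2 / (1 + ee z)) 0 :=
    ((analyticAt_ee analyticAt_id).pow 2).div (analyticAt_const.add (analyticAt_ee analyticAt_id))
      hne.self_of_nhds
  obtain ⟨d1, d1'⟩ := deriv_deriv_comp_mul_left (ω * τ) A
  obtain ⟨d2, d2'⟩ := deriv_deriv_comp_mul_left (-ω) B
  have d3 : deriv (fun z => ee (2 * τ * z ^ 2)) = fun z => ω * (4 * τ) * (z * ee (2 * τ * z ^ 2)) := by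
    funext z
    have h1 : HasDerivAt (fun z : ℂ => 2 * τ * z ^ 2) (2 * τ * (2 * z)) z := by
      simpa using (hasDerivAt_pow 2 z).const_mul (2 * τ)
    refine ((hasDerivAt_ee _).comp z h1).deriv.trans ?_
    rw [← hω]
    ring
  have d3' : deriv (deriv fun z => ee (2 * τ * z ^ 2)) 0 = ω * (4 * τ) := by
    rw [d3, deriv_const_mul_field, deriv_fun_mul differentiableAt_fun_id a3.differentiableAt]
    simp [ee_zero]
  have d4 : ∀ᶠ z in 𝓝 (0 : ℂ), deriv (fun z => ee z ^ 2 / (1 + ee z)) z =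
      ω * (2 * ee z ^ 2 + ee z ^ 3) / (1 + ee z) ^ 2 := by
    filter_upwards [hne] with z hz
    refine ((((hasDerivAt_ee z).fun_pow 2).fun_div ((hasDerivAt_ee z).const_add 1) hz).deriv).trans ?_
    rw [← hω]
    field_simp
    push_cast
    ring
  have d4' : deriv (deriv fun z => ee z ^ 2 / (1 + ee z)) 0 = ω ^ 2 := by
    rw [EventuallyEq.deriv_eq d4]
    refine ((((((hasDerivAt_ee 0).fun_pow 2).const_mul 2).add ((hasDerivAt_ee 0).fun_pow 3)).const_mul
      ω |>.fun_div (((hasDerivAt_ee 0).const_add 1).fun_pow 2)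
      (pow_ne_zero _ hne.self_of_nhds)).deriv).trans ?_
    simp only [ee_zero, ← hω, Pi.add_apply]
    push_cast
    ring
  have d4 := d4.self_of_nhds
  have d3 := congrFun d3 0
  simp only [ee_zero] at d4 d3
  obtain ⟨p1, p1'⟩ := deriv_deriv_mul a1 a2
  obtain ⟨p2, p2'⟩ := deriv_deriv_mul (a1.fun_mul a2) a3
  obtain ⟨p3, p3'⟩ := deriv_deriv_mul ((a1.fun_mul a2).fun_mul a3) a4
  have hMf : M = fun z => c * (A (ω * τ * z) * B (-ω * z) * ee (2 * τ * z ^ 2) *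
      (ee z ^ 2 / (1 + ee z))) := by
    funext z
    rw [hM, mul_assoc ω, neg_mul, mul_neg]
  refine ⟨hMf ▸ analyticAt_const.mul (((a1.mul a2).mul a3).mul a4), ?_⟩
  rw [hMf]
  rw [show (deriv fun z => c * (A (ω * τ * z) * B (-ω * z) * ee (2 * τ * z ^ 2) *
      (ee z ^ 2 / (1 + ee z)))) = fun z => c * deriv (fun z => A (ω * τ * z) * B (-ω * z) *
      ee (2 * τ * z ^ 2) * (ee z ^ 2 / (1 + ee z))) z from
    funext fun z => deriv_const_mul_field c, deriv_const_mul_field]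
  beta_reduce
  rw [p3, p3', p2, p2', p1, p1', d1, d1', d2, d2', d3, d3', d4, d4']
  simp only [mul_zero, ee_zero, ne_eq, OfNat.ofNat_ne_zero, not_false_eq_true, zero_pow]
  field_simp
  ring

lemma ee_div_two (z : ℂ) : ee (z / 2) = exp (Real.pi * I * z) := by
  rw [ee]; congr 1; ring

/-- The value of the boundary integral of `cellFun`: the pole at `0` is triple, the poles at
`1 / 2`, `1 / (2τ)` and `(1 + 1 / τ) / 2` are simple. -/
theorem perInt_cellFun {τ : ℂ} (hτ : 0 < τ.im) {δ : ℝ} (h0 : 0 < δ) (h1 : δ < 1 / 4)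
    {A B : ℂ → ℂ} (hA : A = Fplus (ee τ)) (hB : B = Fminus (ee (-τ⁻¹))) {s s' : ℂ}
    (hs : s = exp (Real.pi * I * τ)) (hs' : s' = exp (-(Real.pi * I * τ⁻¹))) :
    perInt (-δ * (1 + τ⁻¹)) τ⁻¹ (cellFun τ) = residueConst τ *
      (1 / 4 * (τ ^ 2 * deriv (deriv A) 0 * B 0 - 2 * τ * deriv A 0 * deriv B 0 +
        A 0 * deriv (deriv B) 0) + τ / (2 * Real.pi * I) * (A 0 * B 0) - A 0 * B 0 / 8 -
        1 / 2 * (Hplus s 3 * Hminus s' 4 - Hplus s 4 * Hminus s' 3 +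
          Hplus s 5 * Hminus s' 5)) := by
  have hτ0 := ne_zero_of_im_pos hτ
  have hω := inv_im_neg hτ
  have hq := norm_ee_lt_one hτ
  have hq' := norm_ee_neg_inv_lt_one hτ
  have hs0 : s ≠ 0 := hs ▸ exp_ne_zero _
  have hs0' : s' ≠ 0 := hs' ▸ exp_ne_zero _
  have es : ee (τ / 2) = s := by rw [ee_div_two, hs]
  have es' : ee (-τ⁻¹ / 2) = s' := by rw [ee_div_two, hs']; congr 1; ring
  have eY : ee (τ⁻¹ / 2) = s'⁻¹ := by rw [← es', ← ee_neg]; congr 1; ring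
  have eq1 : ee τ = s ^ 2 := by rw [← es, ← ee_two_mul]; congr 1; ring
  have eq2 : ee (-τ⁻¹) = s' ^ 2 := by rw [← es', ← ee_two_mul]; congr 1; ring
  have eneg (z : ℂ) : ee (1 / 2 + z) = -ee z := by rw [ee_add, ee_half]; ring
  set ω : ℂ := τ⁻¹ with hωd
  set c := residueConst τ with hc
  -- the three simple poles
  set M₁ : ℂ → ℂ := fun z => cellNum τ z / ((1 - ee z) ^ 3 * (1 - ee (2 * z - ω))) with hM₁
  set M₂ : ℂ → ℂ := fun z =>
    cellNum τ z / ((1 - ee z) ^ 3 * (1 + ee z) * (1 + ee (z - ω / 2))) with hM₂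
  set M₃ : ℂ → ℂ := fun z =>
    cellNum τ z / ((1 - ee z) ^ 3 * (1 + ee z) * (1 - ee (z - ω / 2))) with hM₃
  have hss : ‖s'‖ < 1 := by
    rw [← es']
    refine norm_ee_lt_one ?_
    rw [show -ω / 2 = ((-(1 / 2) : ℝ) : ℂ) * ω by push_cast; ring, im_ofReal_mul]
    nlinarith
  have hne1 : ∀ x : ℂ, ‖x‖ = ‖s'‖ → 1 - x⁻¹ ≠ 0 := fun x hx h => by
    have : x = 1 := by rw [sub_eq_zero, eq_comm, inv_eq_one] at h; exact h
    rw [this, norm_one] at hx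
    linarith
  have n1 := hne1 s' rfl
  have n2 := hne1 (-s') (norm_neg _)
  have n2' : 1 + s'⁻¹ ≠ 0 := by simpa [inv_neg] using n2
  have n2'' : 1 - -s'⁻¹ ≠ 0 := by simpa using n2'
  have n1' : 1 + -s'⁻¹ ≠ 0 := by simpa [sub_eq_add_neg] using n1
  have n3 : 1 - s' ^ 2 ≠ 0 := by
    rw [sub_ne_zero]
    intro h
    have : ‖s' ^ 2‖ < 1 := by rw [← eq2]; exact hq'
    rw [← h, norm_one] at this
    exact lt_irrefl _ this
  have half : (1 / 2 : ℂ) = ((1 / 2 : ℝ) : ℂ) + ((0 : ℝ) : ℂ) * ω := by push_cast; ring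
  have halfω : ω / 2 = ((0 : ℝ) : ℂ) + ((1 / 2 : ℝ) : ℂ) * ω := by push_cast; ring
  have halfs : 1 / 2 + ω / 2 = ((1 / 2 : ℝ) : ℂ) + ((1 / 2 : ℝ) : ℂ) * ω := by push_cast; ring
  have zero' : (0 : ℂ) = ((0 : ℝ) : ℂ) + ((0 : ℝ) : ℂ) * ω := by push_cast; ring
  have N0 := analyticAt_cellNum hτ (z := 0) zero' (by norm_num) (by norm_num) (by norm_num)
  have N1 := analyticAt_cellNum hτ (z := 1 / 2) half (by norm_num) (by norm_num) (by norm_num)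
  have N2 := analyticAt_cellNum hτ (z := ω / 2) halfω (by norm_num) (by norm_num) (by norm_num)
  have N3 := analyticAt_cellNum hτ (z := 1 / 2 + ω / 2) halfs (by norm_num) (by norm_num)
    (by norm_num)
  have e2ω : ee (2 * (1 / 2) - ω) = s' ^ 2 := by
    rw [show 2 * (1 / 2) - ω = -ω + 1 by ring, ee_add_one, eq2]
  have A1 : AnalyticAt ℂ M₁ (1 / 2) := by
    refine N1.div ((analyticAt_const.sub (analyticAt_ee (by fun_prop))).pow 3 |>.mul
      (analyticAt_const.sub (analyticAt_ee (by fun_prop)))) ?_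
    rw [ee_half, e2ω]
    exact mul_ne_zero (by norm_num) n3
  have A2 : AnalyticAt ℂ M₂ (ω / 2) := by
    refine N2.div ((analyticAt_const.sub (analyticAt_ee (by fun_prop))).pow 3 |>.mul
      (analyticAt_const.add (analyticAt_ee (by fun_prop))) |>.mul
      (analyticAt_const.add (analyticAt_ee (by fun_prop)))) ?_
    rw [sub_self, ee_zero, eY]
    exact mul_ne_zero (mul_ne_zero (pow_ne_zero _ n1) n2') (by norm_num)
  have A3 : AnalyticAt ℂ M₃ (1 / 2 + ω / 2) := by
    refine N3.div ((analyticAt_const.sub (analyticAt_ee (by fun_prop))).pow 3 |>.mul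
      (analyticAt_const.add (analyticAt_ee (by fun_prop))) |>.mul
      (analyticAt_const.sub (analyticAt_ee (by fun_prop)))) ?_
    rw [add_sub_cancel_right, ee_half, eneg, eY]
    exact mul_ne_zero (mul_ne_zero (pow_ne_zero _ n2'') n1') (by norm_num)
  have g1 : gauss τ 1 = gauss τ 0 * -s ^ 2 := by
    rw [gauss_eq_mul, ← eq1, ← neg_one_mul, ← ee_half, ← ee_add, ee]
    congr 2; field_simp; ring
  have g2 : gauss τ ω = gauss τ 0 * -(s' ^ 2)⁻¹ := by
    rw [gauss_eq_mul, ← eq2, ← ee_neg, ← neg_one_mul, ← ee_half, ← ee_add, ee]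
    congr 2; rw [hωd]; field_simp; ring
  have g3 : gauss τ (1 + ω) = gauss τ 0 * (s ^ 2 * (s' ^ 2)⁻¹) := by
    rw [gauss_eq_mul, ← eq2, ← eq1, ← ee_neg, ← ee_add, ← ee_add_one, ← ee_add_one, ee]
    congr 2; rw [hωd]; field_simp; ring
  have hP : qPochInf (s ^ 2) (s ^ 2) ≠ 0 := eq1 ▸ qPochInf_ne_zero_of_norm_lt hq hq
  have hP' : qPochInf (s' ^ 2) (s' ^ 2) ≠ 0 := eq2 ▸ qPochInf_ne_zero_of_norm_lt hq' hq'
  have hc' : c = qPochInf (s ^ 2) (s ^ 2) ^ 3 / qPochInf (s' ^ 2) (s' ^ 2) ^ 3 * gauss τ 0 := by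
    rw [hc, residueConst, eq1, ← hωd, eq2]
  have V1 : M₁ (1 / 2) = c * (-(1 / 2) * (Hplus s 3 * Hminus s' 4)) := by
    have u := upperPart_odd hτ (z := 1 / 2) eq1 (by rw [← es]; congr 1; ring)
    have l := lowerPart_even hτ (z := 1 / 2) eq2 ee_half
    have : M₁ (1 / 2) = upperPart τ (1 / 2) * gauss τ 1 *
        (lowerPart τ (1 / 2) / ((1 - ee (1 / 2)) ^ 3 * (1 - ee (2 * (1 / 2) - ω)))) := by
      simp only [hM₁]
      rw [cellNum_eq, mul_div_assoc]
      norm_num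
    rw [this, u, l, g1, hc']
    field_simp
  have V2 : M₂ (ω / 2) = c * (1 / 2 * (Hplus s 4 * Hminus s' 3)) := by
    have u := upperPart_even hτ (z := ω / 2) eq1 (by
      rw [← ee_half, hωd]; congr 1; field_simp)
    have l := lowerPart_odd hτ (z := ω / 2) eq2 eY
    have : M₂ (ω / 2) = upperPart τ (ω / 2) * gauss τ ω *
        (lowerPart τ (ω / 2) / ((1 - ee (ω / 2)) ^ 3 * (1 + ee (ω / 2)))) / 2 := by
      simp only [hM₂]
      rw [cellNum_eq, sub_self, ee_zero, mul_div_cancel₀ _ two_ne_zero]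
      generalize 1 - ee (ω / 2) = w
      generalize 1 + ee (ω / 2) = w'
      ring
    rw [this, u, l, g2, hc']
    field_simp
  have V3 : M₃ (1 / 2 + ω / 2) = c * (-(1 / 2) * (Hplus s 5 * Hminus s' 5)) := by
    have u := upperPart_odd hτ (z := 1 / 2 + ω / 2) (s := -s) (by rw [neg_sq, eq1]) (by
      rw [show τ * (1 / 2 + ω / 2) = 1 / 2 + τ / 2 by rw [hωd]; field_simp; ring, eneg, es])
    have l := lowerPart_odd hτ (z := 1 / 2 + ω / 2) (s := -s') (by rw [neg_sq, eq2])
      (by rw [eneg, eY, inv_neg])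
    have : M₃ (1 / 2 + ω / 2) = upperPart τ (1 / 2 + ω / 2) * gauss τ (1 + ω) *
        (lowerPart τ (1 / 2 + ω / 2) /
          ((1 - ee (1 / 2 + ω / 2)) ^ 3 * (1 + ee (1 / 2 + ω / 2)))) / 2 := by
      simp only [hM₃]
      rw [cellNum_eq, add_sub_cancel_right, ee_half, show 2 * (1 / 2 + ω / 2) = 1 + ω by ring]
      generalize 1 - ee (1 / 2 + ω / 2) = w
      generalize 1 + ee (1 / 2 + ω / 2) = w'
      ring
    rw [this, u, l, g3, hc', ← Hplus_five, ← Hminus_five, neg_sq, neg_sq]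
    field_simp
  -- the triple pole
  have hA' : AnalyticAt ℂ A 0 := hA ▸ analyticAt_Fplus (f := fun _ => ee τ) (g := fun z => z)
    analyticAt_const analyticAt_id hq (by simpa using hq) (by simpa using hq)
  have hB' : AnalyticAt ℂ B 0 := hB ▸ analyticAt_Fminus (f := fun _ => ee (-ω)) (g := fun z => z)
    analyticAt_const analyticAt_id hq' (by simpa using hq') (by simpa using hq')
    (by simpa using hq') (by simpa using hq')
  obtain ⟨A0, V0⟩ := triple_pole_contribution hA' hB' τ c
    (M := fun z => cellNum τ z / ((1 + ee z) * (1 - ee (2 * z - ω))))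
    (fun z => by rw [hA, hB]; exact cellNum_div_eq hτ z)
  have hG0 : cellFun τ =ᶠ[𝓝[≠] 0] fun z =>
      cellNum τ z / ((1 + ee z) * (1 - ee (2 * z - ω))) * kap 0 z ^ 3 :=
    .of_forall fun z => by
      beta_reduce
      rw [cellFun_eq hτ, kap, sub_zero, ← hωd]
      generalize 1 - ee z = w
      generalize 1 + ee z = w'
      generalize 1 - ee (2 * z - ω) = w''
      ring
  have hG1 : cellFun τ =ᶠ[𝓝[≠] (1 / 2)] fun z => M₁ z * kap (1 / 2) z :=
    .of_forall fun z => by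
      simp only [hM₁]
      rw [cellFun_eq hτ, kap, ee_sub z (1 / 2), ee_half, div_neg, div_one, sub_neg_eq_add, ← hωd]
      generalize 1 - ee z = w
      generalize 1 + ee z = w'
      generalize 1 - ee (2 * z - ω) = w''
      ring
  have esq (z : ℂ) : 1 - ee (2 * z - ω) = (1 - ee (z - ω / 2)) * (1 + ee (z - ω / 2)) := by
    rw [show 2 * z - ω = 2 * (z - ω / 2) by ring, ee_two_mul]; ring
  have hG2 : cellFun τ =ᶠ[𝓝[≠] (ω / 2)] fun z => M₂ z * kap (ω / 2) z :=
    .of_forall fun z => by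
      simp only [hM₂]
      rw [cellFun_eq hτ, kap, ← hωd, esq]
      generalize 1 - ee z = w
      generalize 1 + ee z = w'
      generalize 1 + ee (z - ω / 2) = w₁
      generalize 1 - ee (z - ω / 2) = w₂
      ring
  have hG3 : cellFun τ =ᶠ[𝓝[≠] (1 / 2 + ω / 2)] fun z => M₃ z * kap (1 / 2 + ω / 2) z :=
    .of_forall fun z => by
      simp only [hM₃]
      rw [cellFun_eq hτ, kap, ← hωd, esq, show z - (1 / 2 + ω / 2) = -(1 / 2) + (z - ω / 2) by ring,
        ee_add, ee_neg, ee_half, inv_neg, inv_one, neg_one_mul, sub_neg_eq_add]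
      generalize 1 - ee z = w
      generalize 1 + ee z = w'
      generalize 1 + ee (z - ω / 2) = w₁
      generalize 1 - ee (z - ω / 2) = w₂
      ring
  obtain ⟨k₁, k₂, k₃, hk, ψ₀, hψ₀, E0⟩ := exists_principal_part_three A0 hG0
  obtain ⟨ψ₁, hψ₁, E1⟩ := exists_principal_part_one A1 hG1
  obtain ⟨ψ₂, hψ₂, E2⟩ := exists_principal_part_one A2 hG2
  obtain ⟨ψ₃, hψ₃, E3⟩ := exists_principal_part_one A3 hG3
  -- the four poles are distinct
  have him : ω.im ≠ 0 := hω.ne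
  have ne1 : (1 / 2 : ℂ) ≠ 0 := by norm_num
  have hω0 : ω ≠ 0 := fun h => him (by rw [h]; rfl)
  have ne2 : ω / 2 ≠ 0 := div_ne_zero hω0 two_ne_zero
  have ne3 : ω / 2 ≠ 1 / 2 := fun h => by
    rw [halfω, half] at h
    have := (coords_unique him h).1
    norm_num at this
  have ne4 : 1 / 2 + ω / 2 ≠ 0 := fun h => by
    rw [halfs, zero'] at h
    have := (coords_unique him h).1
    norm_num at this
  have ne5 : 1 / 2 + ω / 2 ≠ 1 / 2 := fun h => ne2 (by linear_combination h)
  have ne6 : 1 / 2 + ω / 2 ≠ ω / 2 := fun h => ne1 (by linear_combination h)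
  set S : Finset ℂ := {0, 1 / 2, ω / 2, 1 / 2 + ω / 2} with hSd
  have key := perInt_eq_sum (a := -δ * (1 + ω)) hω S ?_ (G := cellFun τ) ?_
    (fun p => if p = 0 then k₁ else if p = 1 / 2 then M₁ (1 / 2) else
      if p = ω / 2 then M₂ (ω / 2) else M₃ (1 / 2 + ω / 2))
    (fun p => if p = 0 then k₂ else 0) (fun p => if p = 0 then k₃ else 0) ?_
  · rw [key, hSd, Finset.sum_insert (by
        simp only [mem_insert, mem_singleton]; push Not; exact ⟨ne1.symm, ne2.symm, ne4.symm⟩),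
      Finset.sum_insert (by
        simp only [mem_insert, mem_singleton]; push Not; exact ⟨ne3.symm, ne5.symm⟩),
      Finset.sum_insert (by simp only [mem_singleton]; exact ne6.symm), Finset.sum_singleton]
    simp only [if_true, if_neg ne1, if_neg ne2, if_neg ne3, if_neg ne4, if_neg ne5, if_neg ne6]
    rw [hk, V0, V1, V2, V3]
    ring
  · intro p hp
    simp only [hSd, mem_insert, mem_singleton] at hp
    rcases hp with rfl | rfl | rfl | rfl
    · exact ⟨δ, ⟨h0, by linarith⟩, δ, ⟨h0, by linarith⟩, by ring⟩
    · exact ⟨δ + 1 / 2, ⟨by linarith, by linarith⟩, δ, ⟨h0, by linarith⟩, by push_cast; ring⟩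
    · exact ⟨δ, ⟨h0, by linarith⟩, δ + 1 / 2, ⟨by linarith, by linarith⟩, by push_cast; ring⟩
    · exact ⟨δ + 1 / 2, ⟨by linarith, by linarith⟩, δ + 1 / 2, ⟨by linarith, by linarith⟩,
        by push_cast; ring⟩
  · intro x hx y hy hz
    have ez : -δ * (1 + ω) + x + y * ω = ((x - δ : ℝ) : ℂ) + ((y - δ : ℝ) : ℂ) * ω := by
      push_cast; ring
    rw [ez] at hz ⊢
    set z : ℂ := ((x - δ : ℝ) : ℂ) + ((y - δ : ℝ) : ℂ) * ω with hzd
    simp only [hSd, mem_insert, mem_singleton, not_or] at hz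
    obtain ⟨hz0, hz1, hz2, hz3⟩ := hz
    obtain ⟨hx0, hx1⟩ := hx
    obtain ⟨hy0, hy1⟩ := hy
    have d1 : 1 - ee z ≠ 0 := fun h => by
      obtain ⟨n, hn⟩ := (ee_eq_one_iff z).1 (sub_eq_zero.1 h).symm
      have := coords_unique him (s' := n) (t' := 0) (by rw [← hzd, hn]; push_cast; ring)
      have b1 : (n : ℝ) < 1 := by linarith [this.1]
      have b2 : (-1 : ℝ) < n := by linarith [this.1]
      have b3 : n < 1 := by exact_mod_cast b1
      have b4 : -1 < n := by exact_mod_cast b2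
      obtain rfl : n = 0 := by omega
      exact hz0 (by rw [hn]; simp)
    have d2 : 1 + ee z ≠ 0 := fun h => by
      obtain ⟨n, hn⟩ := (ee_eq_one_iff (1 / 2 + z)).1 (by rw [eneg]; linear_combination -h)
      have := coords_unique him (s := x - δ) (t := y - δ) (s' := n - 1 / 2) (t' := 0)
        (by rw [← hzd]; push_cast; linear_combination hn)
      have b1 : (n : ℝ) < 2 := by linarith [this.1]
      have b2 : (0 : ℝ) < n := by linarith [this.1]
      have b3 : n < 2 := by exact_mod_cast b1
      have b4 : 0 < n := by exact_mod_cast b2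
      obtain rfl : n = 1 := by omega
      exact hz1 (by push_cast at hn; linear_combination hn)
    have d3 : 1 - ee (2 * z - ω) ≠ 0 := fun h => by
      obtain ⟨n, hn⟩ := (ee_eq_one_iff (2 * z - ω)).1 (sub_eq_zero.1 h).symm
      have := coords_unique him (s := x - δ) (t := y - δ) (s' := n / 2) (t' := 1 / 2)
        (by rw [← hzd]; push_cast; linear_combination hn / 2)
      have b1 : (n : ℝ) < 2 := by linarith [this.1]
      have b2 : (-1 : ℝ) < n := by linarith [this.1]
      have b3 : n < 2 := by exact_mod_cast b1
      have b4 : -1 < n := by exact_mod_cast b2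
      have : n = 0 ∨ n = 1 := by omega
      rcases this with rfl | rfl
      · exact hz2 (by push_cast at hn; linear_combination hn / 2)
      · exact hz3 (by push_cast at hn; linear_combination hn / 2)
    have hN := analyticAt_cellNum hτ (z := z) hzd (by linarith) (by linarith) (by linarith)
    rw [show cellFun τ = fun z => cellNum τ z /
      ((1 - ee z) ^ 3 * (1 + ee z) * (1 - ee (2 * z - ω))) from funext (cellFun_eq hτ)]
    have de (f : ℂ → ℂ) (hf : AnalyticAt ℂ f z) : DifferentiableAt ℂ (fun z => ee (f z)) z :=
      (analyticAt_ee hf).differentiableAt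
    exact hN.differentiableAt.fun_div (((((de _ analyticAt_id).const_sub 1).fun_pow 3).fun_mul
      ((de _ analyticAt_id).const_add 1)).fun_mul ((de _ (by fun_prop)).const_sub 1))
      (mul_ne_zero (mul_ne_zero (pow_ne_zero _ d1) d2) d3)
  · intro p hp
    simp only [hSd, mem_insert, mem_singleton] at hp
    rcases hp with rfl | rfl | rfl | rfl
    · exact ⟨ψ₀, hψ₀, by simpa using E0⟩
    · exact ⟨ψ₁, hψ₁, by simpa [ne1] using E1⟩
    · exact ⟨ψ₂, hψ₂, by simpa only [if_neg ne2, if_neg ne3, if_true, zero_mul, add_zero] using E2⟩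
    · exact ⟨ψ₃, hψ₃, by
        simpa only [if_neg ne4, if_neg ne5, if_neg ne6, zero_mul, add_zero] using E3⟩

/-! ### The factorization of the state integral -/

/-- The right-hand side of the factorization of the state integral in the upper half-plane. -/
def bilinear (τ : ℂ) : ℂ :=
  -(1 / (2 * τ)) * (h 0 τ * h 2 τ⁻¹) - h 1 τ * h 1 τ⁻¹ - τ / 2 * (h 2 τ * h 0 τ⁻¹) +
    1 / τ * (h 3 τ * h 4 τ⁻¹ - h 4 τ * h 3 τ⁻¹ + h 5 τ * h 5 τ⁻¹)

lemma qRatioPow_mul_neg (τ : ℂ) (r : ℝ) : qRatioPow τ r * qRatioPow τ (-r) = 1 := by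
  rw [qRatioPow, qRatioPow, ← Complex.exp_add]
  simp

lemma iteratedDeriv_two_eq (f : ℂ → ℂ) : iteratedDeriv 2 f = deriv (deriv f) := by
  rw [iteratedDeriv_succ, iteratedDeriv_one]

lemma stateIntegral_of_im_pos {τ : ℂ} (hτ : 0 < τ.im) {ε : ℝ} (h0 : 0 < ε)
    (h1 : ε < (bOf τ + (bOf τ)⁻¹).re / 4) :
    Integrable (fun t : ℝ => integrand τ (contour τ ε t)) ∧
      2 * exp (Real.pi * I / 4) * qRatioPow τ (1 / 24) * stateIntegral ε τ = bilinear τ := by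
  obtain ⟨δ, hδ0, hδ1, hint, hval⟩ := integral_contour_eq_perInt hτ h0 h1
  refine ⟨hint, ?_⟩
  have hτ0 := ne_zero_of_im_pos hτ
  have hω := inv_im_neg hτ
  set s : ℂ := exp (Real.pi * I * τ) with hs
  set s' : ℂ := exp (-(Real.pi * I * τ⁻¹)) with hs'
  have eq1 : s ^ 2 = ee τ := by rw [hs, ← ee_div_two, ← ee_two_mul]; congr 1; ring
  have eq2 : s' ^ 2 = ee (-τ⁻¹) := by
    rw [hs', ← mul_neg, ← ee_div_two, ← ee_two_mul]; congr 1; ring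
  have hp (j : Fin 6) : h j τ = Hplus s j := if_pos hτ
  have hm (j : Fin 6) : h j τ⁻¹ = (-1) ^ defDegree j * Hminus s' j := if_neg hω.le.not_gt
  have p0 : Hplus s 0 = Fplus (ee τ) 0 := by rw [← eq1]; rfl
  have p1 : Hplus s 1 = deriv (Fplus (ee τ)) 0 := by rw [← eq1]; rfl
  have p2 : Hplus s 2 = deriv (deriv (Fplus (ee τ))) 0 - 1 / 3 * E₂ (ee τ) * Fplus (ee τ) 0 := by
    rw [← eq1, ← iteratedDeriv_two_eq]; rfl
  have m0 : Hminus s' 0 = Fminus (ee (-τ⁻¹)) 0 := by rw [← eq2]; rfl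
  have m1 : Hminus s' 1 = deriv (Fminus (ee (-τ⁻¹))) 0 := by rw [← eq2]; rfl
  have m2 : Hminus s' 2 = deriv (deriv (Fminus (ee (-τ⁻¹)))) 0 -
      (1 / 2 - 1 / 3 * E₂ (ee (-τ⁻¹))) * Fminus (ee (-τ⁻¹)) 0 := by
    rw [← eq2, ← iteratedDeriv_two_eq]; rfl
  have hE := sq_mul_E₂_sub hτ
  have hc := residueConst_eq hτ
  have d : defDegree 0 = 0 ∧ defDegree 1 = 1 ∧ defDegree 2 = 2 ∧ defDegree 3 = 0 ∧
    defDegree 4 = 0 ∧ defDegree 5 = 0 := ⟨rfl, rfl, rfl, rfl, rfl, rfl⟩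
  obtain ⟨d0, d1, d2, d3, d4, d5⟩ := d
  rw [stateIntegral, show (-(1 / 24) : ℝ) = -(1 / 24) from rfl, mul_assoc,
    ← mul_assoc (qRatioPow τ (1 / 24)), qRatioPow_mul_neg, one_mul, hval,
    perInt_cellFun hτ hδ0 hδ1 rfl rfl hs hs', ← mul_assoc, ← mul_assoc,
    mul_assoc (2 * exp (Real.pi * I / 4)), hc, bilinear]
  simp only [hp, hm, d0, d1, d2, d3, d4, d5, p0, p1, p2, m0, m1, m2]
  generalize Fplus (ee τ) 0 = A₀
  generalize deriv (deriv (Fplus (ee τ))) 0 = A₂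
  generalize deriv (Fplus (ee τ)) 0 = A₁
  generalize Fminus (ee (-τ⁻¹)) 0 = B₀
  generalize deriv (deriv (Fminus (ee (-τ⁻¹)))) 0 = B₂
  generalize deriv (Fminus (ee (-τ⁻¹))) 0 = B₁
  have hE' : E₂ (ee (-τ⁻¹)) = τ ^ 2 * E₂ (ee τ) + 6 * τ / (Real.pi * I) := by
    linear_combination -hE
  rw [hE']
  have hpi : (Real.pi : ℂ) ≠ 0 := by exact_mod_cast Real.pi_ne_zero
  have hI := I_ne_zero
  field_simp
  ring

lemma qPochInf_inv (x : ℂ) {q : ℂ} (hq : ‖q‖ < 1) (hq0 : q ≠ 0) :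
    qPochInf x q⁻¹ = (qPochInf (x * q) q)⁻¹ := by
  have : ¬‖q⁻¹‖ < 1 := by
    rw [norm_inv, not_lt]
    exact (one_le_inv₀ (norm_pos_iff.2 hq0)).2 hq.le
  rw [qPochInf, if_neg this, qPochInf, if_pos hq, inv_inv]

lemma bOf_inv {τ : ℂ} (hτ : 0 < τ.im) : bOf τ⁻¹ = (bOf τ)⁻¹ := by
  rw [bOf, bOf, inv_cpow]
  intro h
  rw [arg_eq_pi_iff] at h
  exact hτ.ne' h.2

/-- Faddeev's quantum dilogarithm is invariant under `b ↦ b⁻¹`. -/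
lemma faddeev_inv {τ : ℂ} (hτ : 0 < τ.im) (x : ℂ) :
    faddeev (bOf τ)⁻¹ x = faddeev (bOf τ) x := by
  have hτ0 := ne_zero_of_im_pos hτ
  rw [faddeev, faddeev, inv_pow, bOf_sq, inv_inv]
  have e1 : exp (2 * Real.pi * I * τ⁻¹) = (ee (-τ⁻¹))⁻¹ := by
    rw [← ee_neg, ee, neg_neg]
  have e2 : exp (-(2 * Real.pi * I / τ⁻¹)) = (ee τ)⁻¹ := by
    rw [← ee_neg, ee]; congr 1; field_simp
  have e3 : exp (2 * Real.pi * I * τ) = ee τ := rfl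
  have e4 : exp (-(2 * Real.pi * I / τ)) = ee (-τ⁻¹) := by rw [ee]; congr 1; field_simp
  have e5 : exp (Real.pi * I * τ⁻¹) * ee (-τ⁻¹) = exp (-(Real.pi * I / τ)) := by
    rw [ee, ← Complex.exp_add]; congr 1; field_simp; ring
  have e6 : exp (-(Real.pi * I / τ⁻¹)) * ee τ = exp (Real.pi * I * τ) := by
    rw [ee, ← Complex.exp_add]; congr 1; field_simp; ring
  rw [e1, e2, e3, e4, qPochInf_inv _ (norm_ee_neg_inv_lt_one hτ) (ee_ne_zero _),
    qPochInf_inv _ (norm_ee_lt_one hτ) (ee_ne_zero _), neg_mul, neg_mul,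
    mul_right_comm (exp (Real.pi * I * τ⁻¹)), e5, mul_right_comm (exp (-(Real.pi * I / τ⁻¹))), e6, inv_div_inv]

/-- The state integral at `τ⁻¹`, in the lower half-plane, has the same value as that at `τ`. -/
lemma stateIntegral_inv_of_im_pos {τ : ℂ} (hτ : 0 < τ.im) {ε : ℝ} (h0 : 0 < ε)
    (h1 : ε < (bOf τ⁻¹ + (bOf τ⁻¹)⁻¹).re / 4) :
    Integrable (fun t : ℝ => integrand τ⁻¹ (contour τ⁻¹ ε t)) ∧
      2 * exp (Real.pi * I / 4) * qRatioPow τ⁻¹ (1 / 24) * stateIntegral ε τ⁻¹ = bilinear τ := by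
  have hcb : cb τ⁻¹ = cb τ := by rw [cb, cb, bOf_inv hτ, inv_inv]; ring
  have hq (r : ℝ) : qRatioPow τ⁻¹ r = qRatioPow τ r := by
    rw [qRatioPow, qRatioPow, inv_inv, add_comm]
  have hi : integrand τ⁻¹ = integrand τ := by
    funext x
    rw [integrand, integrand, hcb, bOf_inv hτ, faddeev_inv hτ, faddeev_inv hτ]
  have hct : contour τ⁻¹ ε = contour τ ε := by
    funext t
    rw [contour, contour, hcb]
  rw [bOf_inv hτ, inv_inv, add_comm] at h1
  rw [stateIntegral, hi, hct, hq, hq]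
  exact stateIntegral_of_im_pos hτ h0 h1

/-- The factorization of the state integral for all non-real `τ`. The lower half-plane is reached
through the symmetry `τ ↦ τ⁻¹` of the integrand. -/
theorem stateIntegral_factorization {τ : ℂ} (hτ : τ.im ≠ 0) {ε : ℝ} (h0 : 0 < ε)
    (h1 : ε < (bOf τ + (bOf τ)⁻¹).re / 4) :
    Integrable (fun t : ℝ => integrand τ (contour τ ε t)) ∧
      2 * exp (Real.pi * I / 4) * qRatioPow τ (1 / 24) * stateIntegral ε τ =
        -(1 / (2 * τ)) * (h 0 τ * h 2 τ⁻¹) - h 1 τ * h 1 τ⁻¹ - τ / 2 * (h 2 τ * h 0 τ⁻¹) +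
          (if 0 < τ.im then
            1 / τ * (h 3 τ * h 4 τ⁻¹ - h 4 τ * h 3 τ⁻¹ + h 5 τ * h 5 τ⁻¹)
          else
            τ * (h 4 τ * h 3 τ⁻¹ - h 3 τ * h 4 τ⁻¹ + h 5 τ * h 5 τ⁻¹)) := by
  rcases hτ.lt_or_gt with hneg | hpos
  · have hσ : 0 < (τ⁻¹).im := by
      rw [inv_im]
      exact div_pos (neg_pos.2 hneg) (normSq_pos.2 fun h => by simp [h] at hneg)
    have key := stateIntegral_inv_of_im_pos hσ h0 (by rwa [inv_inv])
    rw [inv_inv] at key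
    refine ⟨key.1, key.2.trans ?_⟩
    rw [if_neg hneg.le.not_gt, bilinear, inv_inv]
    field_simp
    ring
  · rw [if_pos hpos]
    exact stateIntegral_of_im_pos hpos h0 h1

/-! ### Holomorphic dependence of derivatives on a parameter -/

/-- Near the point `p`, the function `F` of two complex variables is bounded and holomorphic in
each variable. -/
def HolAt (F : ℂ → ℂ → ℂ) (p : ℂ × ℂ) : Prop :=
  ∃ M : ℝ, ∀ᶠ x in 𝓝 p, ‖F x.1 x.2‖ ≤ M ∧ DifferentiableAt ℂ (F x.1) x.2 ∧
    DifferentiableAt ℂ (fun q => F q x.2) x.1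

lemma HolAt.eventually {F : ℂ → ℂ → ℂ} {p : ℂ × ℂ} (h : HolAt F p) : ∀ᶠ x in 𝓝 p, HolAt F x := by
  obtain ⟨M, hM⟩ := h
  exact hM.eventually_nhds.mono fun x hx => ⟨M, hx⟩

lemma HolAt.exists_ball {F : ℂ → ℂ → ℂ} {p : ℂ × ℂ} (h : HolAt F p) :
    ∃ M : ℝ, ∃ r > 0, ∀ q ∈ Metric.ball p.1 r, ∀ ε ∈ Metric.ball p.2 r, ‖F q ε‖ ≤ M ∧
      DifferentiableAt ℂ (F q) ε ∧ DifferentiableAt ℂ (fun q => F q ε) q := by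
  obtain ⟨M, hM⟩ := h
  obtain ⟨r, hr, hb⟩ := Metric.eventually_nhds_iff_ball.1 hM
  refine ⟨M, r, hr, fun q hq ε hε => hb (q, ε) ?_⟩
  rw [← ball_prod_same]
  exact ⟨hq, hε⟩

/-- The derivative in the second variable depends holomorphically on the first one: by the Schwarz
lemma the difference quotients converge to it locally uniformly. -/
lemma HolAt.differentiableAt_deriv {F : ℂ → ℂ → ℂ} {q₀ ε₀ : ℂ} (h : HolAt F (q₀, ε₀)) :
    DifferentiableAt ℂ (fun q => deriv (F q) ε₀) q₀ := by
  obtain ⟨M, r, hr, hb⟩ := h.exists_ball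
  have hM0 : 0 ≤ M := (norm_nonneg _).trans (hb q₀ (Metric.mem_ball_self hr) ε₀
    (Metric.mem_ball_self hr)).1
  have hd (q : ℂ) (hq : q ∈ Metric.ball q₀ r) : DifferentiableOn ℂ (F q) (Metric.ball ε₀ r) :=
    fun ε hε => (hb q hq ε hε).2.1.differentiableWithinAt
  have hε₀ : ε₀ ∈ Metric.ball ε₀ r := Metric.mem_ball_self hr
  have hbound (q : ℂ) (hq : q ∈ Metric.ball q₀ r) (ε : ℂ) (hε : ε ∈ Metric.ball ε₀ r) :
      ‖dslope (F q) ε₀ ε‖ ≤ 2 * M / r := by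
    refine norm_dslope_le_div_of_mapsTo_ball (hd q hq) (fun z hz => ?_) hε
    rw [Metric.mem_closedBall, dist_eq_norm]
    have := norm_sub_le (F q z) (F q ε₀)
    have h1 := (hb q hq z hz).1
    have h2 := (hb q hq ε₀ hε₀).1
    linarith
  have hlip (q : ℂ) (hq : q ∈ Metric.ball q₀ r) (ε : ℂ) (hε : ε ∈ Metric.ball ε₀ r) :
      dist (dslope (F q) ε₀ ε) (deriv (F q) ε₀) ≤ 4 * M / r / r * dist ε ε₀ := by
    rw [← dslope_same]
    refine dist_le_div_mul_dist_of_mapsTo_ball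
      ((differentiableOn_dslope (Metric.ball_mem_nhds _ hr)).2 (hd q hq)) (fun z hz => ?_) hε
    rw [Metric.mem_closedBall, dist_eq_norm]
    have := norm_sub_le (dslope (F q) ε₀ z) (dslope (F q) ε₀ ε₀)
    have h1 := hbound q hq z hz
    have h2 := hbound q hq ε₀ hε₀
    have h3 : 4 * M / r = 2 * M / r + 2 * M / r := by ring
    linarith
  set u : ℕ → ℂ := fun n => ε₀ + (r / (n + 2) : ℝ) with hu
  have hun (n : ℕ) : dist (u n) ε₀ = r / (n + 2) := by
    rw [dist_eq_norm, hu, add_sub_cancel_left, norm_real, Real.norm_eq_abs, abs_of_pos]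
    positivity
  have hu_mem (n : ℕ) : u n ∈ Metric.ball ε₀ r := by
    rw [Metric.mem_ball, hun, div_lt_iff₀ (by positivity)]
    nlinarith [(n.cast_nonneg : (0 : ℝ) ≤ n)]
  have hu_ne (n : ℕ) : u n ≠ ε₀ := fun h => by
    have := hun n
    rw [h, dist_self] at this
    have h2 : 0 < r / ((n : ℝ) + 2) := by positivity
    linarith
  have hlim : TendstoUniformlyOn (fun n q => dslope (F q) ε₀ (u n)) (fun q => deriv (F q) ε₀) atTop
      (Metric.ball q₀ r) := by
    rw [Metric.tendstoUniformlyOn_iff]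
    intro e he
    have h1 : Tendsto (fun n : ℕ => 4 * M / r / r * (r / ((n : ℝ) + 2))) atTop (𝓝 0) := by
      have : Tendsto (fun n : ℕ => r / ((n : ℝ) + 2)) atTop (𝓝 0) :=
        tendsto_const_nhds.div_atTop (tendsto_atTop_add_const_right _ _ tendsto_natCast_atTop_atTop)
      simpa using this.const_mul (4 * M / r / r)
    filter_upwards [h1.eventually_lt_const he] with n hn q hq
    rw [dist_comm]
    refine lt_of_le_of_lt ?_ hn
    rw [← hun n]
    exact hlip q hq _ (hu_mem n)
  refine (hlim.tendstoLocallyUniformlyOn.differentiableOn (.of_forall fun n q hq => ?_)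
    Metric.isOpen_ball).differentiableAt (Metric.ball_mem_nhds _ hr)
  refine DifferentiableAt.differentiableWithinAt ?_
  have e : (fun q => dslope (F q) ε₀ (u n)) = fun q => (u n - ε₀)⁻¹ * (F q (u n) - F q ε₀) := by
    funext q
    rw [dslope_of_ne _ (hu_ne n), slope_def_module, smul_eq_mul]
  rw [e]
  exact ((hb q hq _ (hu_mem n)).2.2.fun_sub (hb q hq _ hε₀).2.2).const_mul _

/-- The derivative in the second variable is again bounded and holomorphic in each variable: the
bound is Cauchy's estimate, and holomorphy in the first variable passes to the locally uniform limit
of the difference quotients. -/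
lemma HolAt.deriv {F : ℂ → ℂ → ℂ} {p : ℂ × ℂ} (h : HolAt F p) :
    HolAt (fun q => deriv (F q)) p := by
  obtain ⟨M, r, hr, hb⟩ := h.exists_ball
  have hnear : ∀ᶠ x in 𝓝 p, x.1 ∈ Metric.ball p.1 r ∧ x.2 ∈ Metric.ball p.2 (r / 2) :=
    ((continuous_fst.tendsto p).eventually (Metric.ball_mem_nhds _ hr)).and
      ((continuous_snd.tendsto p).eventually (Metric.ball_mem_nhds _ (half_pos hr)))
  refine ⟨M / (r / 4), ?_⟩
  filter_upwards [h.eventually, hnear] with x hx hx2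
  have hsub : Metric.closedBall x.2 (r / 4) ⊆ Metric.ball p.2 r := by
    refine Metric.closedBall_subset_ball' ?_
    have := hx2.2
    rw [Metric.mem_ball] at this
    linarith
  have hdiff : DifferentiableOn ℂ (F x.1) (Metric.ball p.2 r) :=
    fun ε hε => (hb _ hx2.1 ε hε).2.1.differentiableWithinAt
  refine ⟨?_, ?_, HolAt.differentiableAt_deriv hx⟩
  · refine norm_deriv_le_of_forall_mem_sphere_norm_le (by positivity)
      (hdiff.diffContOnCl_ball hsub) fun z hz => ?_
    exact (hb _ hx2.1 z (hsub (Metric.sphere_subset_closedBall hz))).1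
  · have hmem : x.2 ∈ Metric.ball p.2 r := hsub (Metric.mem_closedBall_self (by positivity))
    exact (hdiff.analyticAt (Metric.isOpen_ball.mem_nhds hmem)).deriv.differentiableAt

/-! ### Power series from asymptotic expansions -/

/-- A function that is holomorphic on the punctured unit disc and has a polynomial expansion at the
origin is the sum of a power series there, which starts with that polynomial. -/
lemma hasExpansion_of_isBigO {H : ℂ → ℂ} {l : List ℂ}
    (hd : ∀ s : ℂ, 0 < ‖s‖ → ‖s‖ < 1 → DifferentiableAt ℂ H s)
    (hO : (fun s => H s - ∑ n ∈ range l.length, l.getD n 0 * s ^ n) =O[𝓝[≠] 0]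
      fun s => s ^ l.length) : HasExpansion H l := by
  set N := l.length with hN
  set P : ℂ → ℂ := fun s => ∑ n ∈ range N, l.getD n 0 * s ^ n with hP
  set k : ℂ → ℂ := fun s => (H s - P s) / s ^ N with hk
  have hPd : Differentiable ℂ P := by
    rw [hP]; fun_prop
  have hkO : k =O[𝓝[≠] 0] fun _ => (1 : ℂ) := by
    have : (fun s : ℂ => s ^ N * (s ^ N)⁻¹) =O[𝓝[≠] 0] fun _ => (1 : ℂ) := by
      refine EventuallyEq.trans_isBigO ?_ (Asymptotics.isBigO_refl _ _)
      filter_upwards [self_mem_nhdsWithin] with s hs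
      exact mul_inv_cancel₀ (pow_ne_zero _ hs)
    exact (hO.mul (Asymptotics.isBigO_refl (fun s : ℂ => (s ^ N)⁻¹) _)).trans this
  have hkd : DifferentiableOn ℂ k (Metric.ball 0 1 \ {0}) := fun s hs => by
    have h0 : s ≠ 0 := hs.2
    exact (((hd s (norm_pos_iff.2 h0) (by simpa using hs.1)).fun_sub hPd.differentiableAt).fun_div
      (differentiableAt_fun_id.fun_pow N) (pow_ne_zero _ h0)).differentiableWithinAt
  have ho : (fun z => k z - k 0) =o[𝓝[≠] 0] fun z => (z - 0)⁻¹ := by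
    refine IsBoundedUnder.isLittleO_sub_self_inv ?_
    exact ((hkO.sub (Asymptotics.isBigO_const_const (k 0) one_ne_zero _)).isBoundedUnder_le)
  have hg := differentiableOn_update_limUnder_of_isLittleO (Metric.ball_mem_nhds (0 : ℂ) one_pos)
    hkd ho
  set g := Function.update k 0 (limUnder (𝓝[≠] 0) k) with hgd
  set b : ℕ → ℂ := fun n => (n.factorial : ℂ)⁻¹ * iteratedDeriv n g 0 with hb
  refine ⟨fun n => if n < N then l.getD n 0 else b (n - N), fun n hn => ?_, fun s hs0 hs1 => ?_⟩
  · have hn' : n < N := hn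
    simp [hn', hn]
  · have hs : s ≠ 0 := norm_pos_iff.1 hs0
    have h1 := hasSum_taylorSeries_on_ball hg (z := s) (by simpa using hs1)
    have hgs : g s = k s := Function.update_of_ne hs _ _
    rw [hgs] at h1
    have h2 := h1.mul_left (s ^ N)
    rw [← hasSum_nat_add_iff' N]
    have e1 : H s - ∑ i ∈ range N, (if i < N then l.getD i 0 else b (i - N)) * s ^ i =
        s ^ N * k s := by
      rw [hk, mul_div_cancel₀ _ (pow_ne_zero _ hs)]
      congr 1
      exact Finset.sum_congr rfl fun i hi => by rw [if_pos (mem_range.1 hi)]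
    rw [e1]
    refine h2.congr_fun fun n => ?_
    beta_reduce
    rw [if_neg (by omega), Nat.add_sub_cancel, hb]
    simp only [sub_zero, smul_eq_mul]
    ring

/-! ### Calculus of truncated expansions -/

/-- `f` agrees with the bounded function `p` up to an error of order `u` along the filter `l`. -/
structure Cong {ι : Type*} (l : Filter ι) (u f p : ι → ℂ) : Prop where
  err : (fun x => f x - p x) =O[l] u
  bdd : p =O[l] fun _ => (1 : ℂ)
  small : Tendsto u l (𝓝 0)

section Cong

variable {ι : Type*} {l : Filter ι} {u f g p r : ι → ℂ}

lemma Cong.isBigO_one (h : Cong l u f p) : f =O[l] fun _ => (1 : ℂ) := by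
  have := (h.err.trans (h.small.isBigO_one ℂ)).add h.bdd
  simpa using this

lemma Cong.refl (hu : Tendsto u l (𝓝 0)) (hp : p =O[l] fun _ => (1 : ℂ)) : Cong l u p p :=
  ⟨by simpa using Asymptotics.isBigO_zero _ _, hp, hu⟩

lemma Cong.add (h : Cong l u f p) (h' : Cong l u g r) :
    Cong l u (fun x => f x + g x) (fun x => p x + r x) :=
  ⟨(h.err.add h'.err).congr_left fun x => by ring, h.bdd.add h'.bdd, h.small⟩

lemma Cong.sub (h : Cong l u f p) (h' : Cong l u g r) :
    Cong l u (fun x => f x - g x) (fun x => p x - r x) :=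
  ⟨(h.err.sub h'.err).congr_left fun x => by ring, h.bdd.sub h'.bdd, h.small⟩

lemma Cong.mul (h : Cong l u f p) (h' : Cong l u g r) :
    Cong l u (fun x => f x * g x) (fun x => p x * r x) := by
  refine ⟨?_, by simpa using h.bdd.mul h'.bdd, h.small⟩
  have h1 := h.err.mul h'.isBigO_one
  have h2 := h.bdd.mul h'.err
  simp only [mul_one, one_mul] at h1 h2
  exact (h1.add h2).congr_left fun x => by ring

lemma Cong.const_mul (h : Cong l u f p) (c : ℂ) :
    Cong l u (fun x => c * f x) (fun x => c * p x) :=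
  (Cong.refl h.small (Asymptotics.isBigO_const_const c one_ne_zero l)).mul h

lemma Cong.const_add (h : Cong l u f p) (c : ℂ) :
    Cong l u (fun x => c + f x) (fun x => c + p x) :=
  (Cong.refl h.small (Asymptotics.isBigO_const_const c one_ne_zero l)).add h

lemma Cong.sq (h : Cong l u f p) : Cong l u (fun x => f x ^ 2) (fun x => p x ^ 2) := by
  simpa only [pow_two] using h.mul h

lemma Cong.congr_left (h : Cong l u f p) (hfg : f =ᶠ[l] g) : Cong l u g p :=
  ⟨h.err.congr' (hfg.mono fun x hx => by simp only [hx]) EventuallyEq.rfl, h.bdd, h.small⟩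

/-- Truncation: a multiple of the error term may be dropped. -/
lemma Cong.congr_right (h : Cong l u f p) {R : ι → ℂ} (hR : R =O[l] fun _ => (1 : ℂ))
    (hpr : ∀ x, p x = r x + u x * R x) : Cong l u f r := by
  have h1 : (fun x => u x * R x) =O[l] u := by
    simpa using (Asymptotics.isBigO_refl u l).mul hR
  refine ⟨(h.err.add h1).congr_left fun x => by rw [hpr]; ring, ?_, h.small⟩
  refine (h.bdd.sub (h1.trans (h.small.isBigO_one ℂ))).congr_left fun x => ?_
  rw [hpr]; ring

/-- Division of expansions: the quotient is recognised by multiplying back. -/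
lemma Cong.div (hN : Cong l u f p) {D d P R : ι → ℂ} (hD : Cong l u D d) {d₀ : ℂ} (hd₀ : d₀ ≠ 0)
    (hd : Tendsto d l (𝓝 d₀)) (hP : P =O[l] fun _ => (1 : ℂ)) (hR : R =O[l] fun _ => (1 : ℂ))
    (h : ∀ x, p x = d x * P x + u x * R x) : Cong l u (fun x => f x / D x) P := by
  have hDd : Tendsto D l (𝓝 d₀) := by
    have h1 : Tendsto (fun x => D x - d x) l (𝓝 0) := hD.err.trans_tendsto hD.small
    simpa using h1.add hd
  have hDinv : (fun x => (D x)⁻¹) =O[l] fun _ => (1 : ℂ) := (hDd.inv₀ hd₀).isBigO_one ℂ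
  have key := (hN.sub (hD.mul (Cong.refl hD.small hP))).congr_right (r := fun _ => 0) hR
    (fun x => by rw [h]; ring)
  refine ⟨?_, hP, hN.small⟩
  have h2 := key.err.mul hDinv
  simp only [mul_one, sub_zero] at h2
  refine h2.congr' ?_ EventuallyEq.rfl
  filter_upwards [hDd.eventually_ne hd₀] with x hx
  field_simp

lemma Cong.comp {κ : Type*} {m : Filter κ} {k : κ → ι} (h : Cong l u f p) (hk : Tendsto k m l) :
    Cong m (fun x => u (k x)) (fun x => f (k x)) (fun x => p (k x)) :=
  ⟨h.err.comp_tendsto hk, h.bdd.comp_tendsto hk, h.small.comp hk⟩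

end Cong

lemma Continuous.isBigO_one_nhds {E : Type*} [TopologicalSpace E] {R : E → ℂ} (h : Continuous R)
    (x : E) : R =O[𝓝 x] fun _ => (1 : ℂ) := h.continuousAt.isBigO_one ℂ

/-- Cauchy's estimate: an asymptotic bound which is uniform in a second variable may be
differentiated with respect to it. -/
lemma isBigO_deriv {G : ℂ → ℂ → ℂ} {N : ℕ}
    (hO : (fun x : ℂ × ℂ => G x.1 x.2) =O[𝓝 (0, 0)] fun x => x.1 ^ N)
    (hd : ∀ᶠ x : ℂ × ℂ in 𝓝 (0, 0), DifferentiableAt ℂ (G x.1) x.2) :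
    (fun x : ℂ × ℂ => deriv (G x.1) x.2) =O[𝓝 (0, 0)] fun x => x.1 ^ N := by
  obtain ⟨C, hC⟩ := hO.bound
  obtain ⟨r, hr, hb⟩ := Metric.eventually_nhds_iff_ball.1 (hC.and hd)
  rw [← ball_prod_same] at hb
  refine Asymptotics.IsBigO.of_bound (C / (r / 4)) ?_
  filter_upwards [((continuous_fst.tendsto ((0 : ℂ), (0 : ℂ))).eventually (Metric.ball_mem_nhds _ hr)),
    ((continuous_snd.tendsto ((0 : ℂ), (0 : ℂ))).eventually (Metric.ball_mem_nhds _ (half_pos hr)))]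
    with x h1 h2
  have hsub : Metric.closedBall x.2 (r / 4) ⊆ Metric.ball 0 r := by
    refine Metric.closedBall_subset_ball' ?_
    have h3 : dist x.2 0 < r / 2 := h2
    linarith
  have hdiff : DifferentiableOn ℂ (G x.1) (Metric.ball 0 r) :=
    fun ε hε => (hb (x.1, ε) ⟨h1, hε⟩).2.differentiableWithinAt
  rw [div_mul_eq_mul_div]
  refine norm_deriv_le_of_forall_mem_sphere_norm_le (by positivity)
    (hdiff.diffContOnCl_ball hsub) fun z hz => ?_
  exact (hb (x.1, z) ⟨h1, hsub (Metric.sphere_subset_closedBall hz)⟩).1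

/-- The Taylor coefficients in the second variable inherit an expansion that is uniform in it. -/
lemma Cong.jet {F P : ℂ → ℂ → ℂ} {N : ℕ}
    (h : Cong (𝓝 (0, 0)) (fun x : ℂ × ℂ => x.1 ^ N) (fun x => F x.1 x.2) (fun x => P x.1 x.2))
    (hF : ∀ᶠ x : ℂ × ℂ in 𝓝 (0, 0), AnalyticAt ℂ (F x.1) x.2)
    (hP : ∀ x : ℂ × ℂ, AnalyticAt ℂ (P x.1) x.2) {P₁ P₂ : ℂ → ℂ}
    (h1 : ∀ q, deriv (P q) 0 = P₁ q) (h2 : ∀ q, deriv (deriv (P q)) 0 = P₂ q)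
    (hb0 : Continuous fun q => P q 0) (hb1 : Continuous P₁) (hb2 : Continuous P₂) :
    Cong (𝓝 0) (fun q => q ^ N) (fun q => F q 0) (fun q => P q 0) ∧
    Cong (𝓝 0) (fun q => q ^ N) (fun q => deriv (F q) 0) P₁ ∧
    Cong (𝓝 0) (fun q => q ^ N) (fun q => deriv (deriv (F q)) 0) P₂ := by
  have ht : Tendsto (fun q : ℂ => (q, (0 : ℂ))) (𝓝 0) (𝓝 (0, 0)) :=
    (continuous_id.prodMk continuous_const).tendsto' _ _ rfl
  have hs : Tendsto (fun q : ℂ => q ^ N) (𝓝 0) (𝓝 0) := h.small.comp ht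
  have hdiff : ∀ᶠ x : ℂ × ℂ in 𝓝 (0, 0),
      deriv (fun ε => F x.1 ε - P x.1 ε) =ᶠ[𝓝 x.2] fun ε => deriv (F x.1) ε - deriv (P x.1) ε := by
    filter_upwards [hF] with x hx
    filter_upwards [hx.eventually_analyticAt, (hP x).eventually_analyticAt] with ε hε hε'
    exact deriv_fun_sub hε.differentiableAt hε'.differentiableAt
  have o1 := isBigO_deriv (G := fun q ε => F q ε - P q ε) h.err
    (hF.mono fun x hx => (hx.fun_sub (hP x)).differentiableAt)
  have o2 := isBigO_deriv (G := fun q => deriv fun ε => F q ε - P q ε) o1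
    (hF.mono fun x hx => (hx.fun_sub (hP x)).deriv.differentiableAt)
  refine ⟨⟨h.err.comp_tendsto ht, hb0.isBigO_one_nhds _, hs⟩,
    ⟨(o1.comp_tendsto ht).congr' ?_ EventuallyEq.rfl, hb1.isBigO_one_nhds _, hs⟩,
    ⟨(o2.comp_tendsto ht).congr' ?_ EventuallyEq.rfl, hb2.isBigO_one_nhds _, hs⟩⟩
  · filter_upwards [ht.eventually hdiff] with q hq
    rw [Function.comp_apply, ← h1]
    exact hq.self_of_nhds
  · filter_upwards [ht.eventually hdiff, ht.eventually hF] with q hq hq2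
    rw [Function.comp_apply, ← h2]
    exact (EventuallyEq.deriv_eq hq).trans (deriv_fun_sub hq2.deriv.differentiableAt
      (hP (q, 0)).deriv.differentiableAt)

/-! ### Expansions of the building blocks -/

section Blocks

variable {ι : Type*} {l : Filter ι} {u q x y L : ι → ℂ}

lemma cong_qPochInf_one (hu : Tendsto u l (𝓝 0)) (hq : Tendsto q l (𝓝 0)) (hx : x =O[l] u) :
    Cong l u (fun i => qPochInf (x i) (q i)) fun _ => 1 := by
  refine ⟨?_, Asymptotics.isBigO_refl _ _, hu⟩
  refine Asymptotics.IsBigO.trans (Asymptotics.IsBigO.of_bound 4 ?_) hx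
  have hx0 : Tendsto (fun i => ‖x i‖) l (𝓝 0) := by simpa using (hx.trans_tendsto hu).norm
  have hq0 : Tendsto (fun i => ‖q i‖) l (𝓝 0) := by simpa using hq.norm
  filter_upwards [hx0.eventually_lt_const (by norm_num : (0 : ℝ) < 1 / 2),
    hq0.eventually_lt_const (by norm_num : (0 : ℝ) < 1 / 2)] with i h1 h2
  refine (norm_qPochInf_sub_one_le (x i) (by linarith)).trans ?_
  have h3 : ‖x i‖ / (1 - ‖q i‖) ≤ 2 * ‖x i‖ := by
    rw [div_le_iff₀ (by linarith)]
    nlinarith [norm_nonneg (x i)]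
  have h4 := Real.abs_exp_sub_one_le (x := 2 * ‖x i‖) (by
    rw [abs_of_nonneg (by positivity)]; linarith)
  rw [abs_of_nonneg (by positivity : 0 ≤ 2 * ‖x i‖)] at h4
  have h5 := (abs_le.1 h4).2
  have h6 := Real.exp_le_exp.2 h3
  linarith

/-- Splitting off the first term of the series leaves a series of the same kind. -/
lemma qSum_eq_one_add {c : ℕ} (hc : 1 ≤ c) {q x y : ℂ} (L : ℂ) (hq : ‖q‖ < 1) (hx : ‖x‖ < 1)
    (hy : ‖y‖ < 1) : qSum c q L x y = 1 + q ^ c * L * ((1 - x) ^ 2 * ((1 - y) * (1 - y * q)))⁻¹ *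
      qSum c q (L * q ^ (2 * c)) (x * q) (y * q ^ 2) := by
  rw [qSum, (summable_qTerm hc L hq hx hy).tsum_eq_zero_add, qSum, ← tsum_mul_left]
  congr 1
  · simp [qTerm, qPoch]
  · refine tsum_congr fun m => ?_
    have h1 : qPoch x q (m + 1) = (1 - x) * qPoch (x * q) q m := by
      rw [add_comm, qPoch_add]; simp [qPoch]
    have h2 : qPoch y q (2 * (m + 1)) = (1 - y) * (1 - y * q) * qPoch (y * q ^ 2) q (2 * m) := by
      rw [show 2 * (m + 1) = 2 + 2 * m by ring, qPoch_add]; simp [qPoch, prod_range_succ]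
    rw [qTerm, qTerm, h1, h2]
    simp only [div_eq_mul_inv, mul_inv, mul_pow]
    ring

lemma isBigO_qPochInf_one {x₀ q₀ : ℂ} (hq : Tendsto q l (𝓝 q₀)) (hq0 : ‖q₀‖ < 1)
    (hx : Tendsto x l (𝓝 x₀)) : (fun i => qPochInf (x i) (q i)) =O[l] fun _ => (1 : ℂ) := by
  obtain ⟨r, hr1, hr2⟩ := exists_between hq0
  refine Asymptotics.IsBigO.of_bound (Real.exp ((‖x₀‖ + 1) / (1 - r))) ?_
  filter_upwards [hq.norm.eventually_lt_const hr1, hx.norm.eventually_lt_const (lt_add_one _)]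
    with i h1 h2
  rw [norm_one, mul_one]
  refine (norm_qPochInf_le _ (h1.trans hr2)).trans ?_
  have : 0 < 1 - r := by linarith
  gcongr

lemma isBigO_inv_qPochInf_one {x₀ q₀ : ℂ} (hq : Tendsto q l (𝓝 q₀)) (hq0 : ‖q₀‖ < 1)
    (hx : Tendsto x l (𝓝 x₀)) (hx0 : ‖x₀‖ < 1) :
    (fun i => (qPochInf (x i) (q i))⁻¹) =O[l] fun _ => (1 : ℂ) := by
  obtain ⟨r, hr1, hr2⟩ := exists_between hq0
  obtain ⟨ρ, hρ1, hρ2⟩ := exists_between hx0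
  refine Asymptotics.IsBigO.of_bound (Real.exp ((1 - ρ)⁻¹ / (1 - r))) ?_
  filter_upwards [hq.norm.eventually_lt_const hr1, hx.norm.eventually_lt_const hρ1] with i h1 h2
  rw [norm_one, mul_one]
  refine (norm_inv_qPochInf_le (h1.trans hr2) hρ2 h2.le).trans ?_
  have : 0 < 1 - r := by linarith
  have : 0 < 1 - ρ := by linarith
  gcongr

lemma isBigO_qSum_one {c : ℕ} (hc : 1 ≤ c) {q₀ x₀ y₀ : ℂ} (hq : Tendsto q l (𝓝 q₀))
    (hq0 : ‖q₀‖ < 1) (hx : Tendsto x l (𝓝 x₀)) (hx0 : ‖x₀‖ < 1) (hy : Tendsto y l (𝓝 y₀))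
    (hy0 : ‖y₀‖ < 1) (hL : L =O[l] fun _ => (1 : ℂ)) :
    (fun i => qSum c (q i) (L i) (x i) (y i)) =O[l] fun _ => (1 : ℂ) := by
  obtain ⟨B, hB⟩ := hL.bound
  obtain ⟨r, hr1, hr2⟩ := exists_between hq0
  obtain ⟨ρ, hρ1, hρ2⟩ := exists_between (max_lt hx0 hy0)
  rw [max_lt_iff] at hρ1
  refine Asymptotics.IsBigO.of_bound (∑' m : ℕ, r ^ m ^ 2 * (B * ((1 - ρ)⁻¹) ^ 4) ^ m) ?_
  filter_upwards [hB, hq.norm.eventually_lt_const hr1, hx.norm.eventually_lt_const hρ1.1,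
    hy.norm.eventually_lt_const hρ1.2] with i h1 h2 h3 h4
  simp only [norm_one, mul_one] at h1 ⊢
  exact norm_qSum_le hc hr2 hρ2 h2.le h1 h3.le h4.le

lemma isBigO_qSum_sub_one {c : ℕ} (hc : 1 ≤ c) (hq : Tendsto q l (𝓝 0)) (hx : Tendsto x l (𝓝 0))
    (hy : Tendsto y l (𝓝 0)) (hL : L =O[l] fun _ => (1 : ℂ)) :
    (fun i => qSum c (q i) (L i) (x i) (y i) - 1) =O[l] fun i => q i ^ c * L i := by
  have hq1 := hq.isBigO_one ℂ
  have hd : Tendsto (fun i => ((1 - x i) ^ 2 * ((1 - y i) * (1 - y i * q i)))⁻¹) l (𝓝 1) := by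
    have h1 : Tendsto (fun i => (1 - x i) ^ 2 * ((1 - y i) * (1 - y i * q i))) l
        (𝓝 ((1 - 0) ^ 2 * ((1 - 0) * (1 - 0 * 0)))) :=
      ((tendsto_const_nhds.sub hx).pow 2).mul ((tendsto_const_nhds.sub hy).mul
        (tendsto_const_nhds.sub (hy.mul hq)))
    simpa using h1.inv₀ (by norm_num)
  have hb := isBigO_qSum_one (L := fun i => L i * q i ^ (2 * c)) hc hq (by simp)
    (hx.mul hq) (by simp) (hy.mul (hq.pow 2)) (by simp)
    (by simpa using hL.mul (hq1.pow (2 * c)))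
  have key := ((Asymptotics.isBigO_refl (fun i => q i ^ c * L i) l).mul (hd.isBigO_one ℂ)).mul hb
  simp only [mul_one] at key
  have hsmall {z : ι → ℂ} (hz : Tendsto z l (𝓝 0)) : ∀ᶠ i in l, ‖z i‖ < 1 :=
    hz.norm.eventually_lt_const (by norm_num)
  refine key.congr' ?_ EventuallyEq.rfl
  filter_upwards [hsmall hq, hsmall hx, hsmall hy] with i h1 h2 h3
  rw [qSum_eq_one_add hc _ h1 h2 h3]
  ring

/-- If `q^(4c) L²` is of the order of the error, two terms of the series matter. The second one has
the expansion `P` as soon as `P` times its denominator agrees with its numerator. -/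
lemma cong_qSum {c : ℕ} (hc : 1 ≤ c) (hu : Tendsto u l (𝓝 0)) (hq : Tendsto q l (𝓝 0))
    (hx : Tendsto x l (𝓝 0)) (hy : Tendsto y l (𝓝 0)) (hL : L =O[l] fun _ => (1 : ℂ))
    (h : (fun i => q i ^ (4 * c) * L i ^ 2) =O[l] u) {P R : ι → ℂ}
    (hP : P =O[l] fun _ => (1 : ℂ)) (hR : R =O[l] fun _ => (1 : ℂ))
    (hPR : ∀ i, q i ^ c * L i = (1 - x i) ^ 2 * ((1 - y i) * (1 - y i * q i)) * P i + u i * R i) :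
    Cong l u (fun i => qSum c (q i) (L i) (x i) (y i)) fun i => 1 + P i := by
  have hq1 := hq.isBigO_one ℂ
  have h1 : Tendsto (fun i => (1 - x i) ^ 2 * ((1 - y i) * (1 - y i * q i))) l (𝓝 1) := by
    have h1 : Tendsto (fun i => (1 - x i) ^ 2 * ((1 - y i) * (1 - y i * q i))) l
        (𝓝 ((1 - 0) ^ 2 * ((1 - 0) * (1 - 0 * 0)))) :=
      ((tendsto_const_nhds.sub hx).pow 2).mul ((tendsto_const_nhds.sub hy).mul
        (tendsto_const_nhds.sub (hy.mul hq)))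
    simpa using h1
  have hNb : (fun i => q i ^ c * L i) =O[l] fun _ => (1 : ℂ) := by
    simpa using (hq1.pow c).mul hL
  have hfrac : Cong l u (fun i => q i ^ c * L i / ((1 - x i) ^ 2 * ((1 - y i) * (1 - y i * q i))))
      P := (Cong.refl hu hNb).div (Cong.refl hu (h1.isBigO_one ℂ)) one_ne_zero h1 hP hR hPR
  have hb := isBigO_qSum_sub_one (L := fun i => L i * q i ^ (2 * c)) hc hq
    (by simpa using hx.mul hq) (by simpa using hy.mul (hq.pow 2))
    (by simpa using hL.mul (hq1.pow (2 * c)))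
  have hN := Asymptotics.isBigO_refl (fun i => q i ^ c * L i) l
  have key := (hN.mul ((h1.inv₀ one_ne_zero).isBigO_one ℂ)).mul hb
  simp only [mul_one] at key
  have htail := (key.congr_right fun i => (by ring :
    _ = q i ^ (4 * c) * L i ^ 2)).trans h
  have hsmall {z : ι → ℂ} (hz : Tendsto z l (𝓝 0)) : ∀ᶠ i in l, ‖z i‖ < 1 :=
    hz.norm.eventually_lt_const (by norm_num)
  have h2 : Cong l u (fun i => q i ^ c * L i * ((1 - x i) ^ 2 * ((1 - y i) * (1 - y i * q i)))⁻¹ *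
      (qSum c (q i) (L i * q i ^ (2 * c)) (x i * q i) (y i * q i ^ 2) - 1)) fun _ => 0 :=
    ⟨by simpa using htail, Asymptotics.isBigO_zero _ _, hu⟩
  have h3 := (hfrac.const_add 1).add h2
  simp only [add_zero] at h3
  refine h3.congr_left ?_
  filter_upwards [hsmall hq, hsmall hx, hsmall hy] with i h4 h5 h6
  rw [qSum_eq_one_add hc _ h4 h5 h6, div_eq_mul_inv]
  ring

end Blocks

lemma tendsto_pow_nhds_zero {n : ℕ} (hn : n ≠ 0) : Tendsto (fun q : ℂ => q ^ n) (𝓝 0) (𝓝 0) :=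
  (continuous_pow n).tendsto' _ _ (zero_pow hn)

lemma norm_eisenstein_term_le {q : ℂ} {r : ℝ} (hr : r < 1) (hq : ‖q‖ ≤ r) (n : ℕ) :
    ‖q ^ (n + 1) / (1 - q ^ (n + 1)) ^ 2‖ ≤ ((1 - r)⁻¹) ^ 2 * ‖q‖ ^ (n + 1) := by
  have h : ‖q ^ (n + 1)‖ ≤ r := by
    rw [norm_pow]
    exact (pow_le_of_le_one (norm_nonneg _) (hq.trans hr.le) n.succ_ne_zero).trans hq
  have := norm_inv_one_sub_le hr h
  rw [div_eq_mul_inv, ← inv_pow, norm_mul, norm_pow, norm_pow, mul_comm]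
  gcongr

lemma differentiableAt_E₂ {q : ℂ} (hq : ‖q‖ < 1) : DifferentiableAt ℂ E₂ q := by
  obtain ⟨r, hr1, hr2⟩ := exists_between hq
  have hr0 : 0 ≤ r := (norm_nonneg q).trans hr1.le
  have key : DifferentiableOn ℂ (fun q : ℂ => ∑' n : ℕ, q ^ (n + 1) / (1 - q ^ (n + 1)) ^ 2)
      (Metric.ball 0 r) := by
    refine differentiableOn_tsum_of_summable_norm (u := fun n => ((1 - r)⁻¹) ^ 2 * r ^ (n + 1))
      (((summable_nat_add_iff 1).2 (summable_geometric_of_lt_one hr0 hr2)).mul_left _)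
      (fun n z hz => ?_) Metric.isOpen_ball fun n z hz => ?_
    · have hz' : ‖z‖ < r := by simpa using hz
      have : 1 - z ^ (n + 1) ≠ 0 := fun h => by
        have h1 : ‖z ^ (n + 1)‖ < 1 := by
          rw [norm_pow]; exact pow_lt_one₀ (norm_nonneg _) (hz'.trans hr2) n.succ_ne_zero
        rw [← sub_eq_zero.1 h, norm_one] at h1
        exact lt_irrefl _ h1
      refine DifferentiableAt.differentiableWithinAt (DifferentiableAt.div (by fun_prop)
        (by fun_prop) ?_)
      exact pow_ne_zero 2 this
    · have hz' : ‖z‖ < r := by simpa using hz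
      refine (norm_eisenstein_term_le hr2 hz'.le n).trans ?_
      gcongr
  have h2 := key.differentiableAt (x := q) (Metric.isOpen_ball.mem_nhds (by simpa using hr1))
  exact (differentiableAt_const _).sub (h2.const_mul 24)

lemma cong_E₂ : Cong (𝓝 0) (fun q : ℂ => q ^ 5) E₂
    fun q => 1 - 24 * q - 72 * q ^ 2 - 96 * q ^ 3 - 168 * q ^ 4 := by
  have hu := tendsto_pow_nhds_zero (n := 5) (by norm_num)
  have hc {R : ℂ → ℂ} (h : Continuous R) : R =O[𝓝 0] fun _ => (1 : ℂ) := h.isBigO_one_nhds 0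
  have hdiv {k : ℕ} (hk : k ≠ 0) {P R : ℂ → ℂ} (hP : Continuous P) (hR : Continuous R)
      (h : ∀ q : ℂ, q ^ k = (1 - q ^ k) ^ 2 * P q + q ^ 5 * R q) :
      Cong (𝓝 0) (fun q : ℂ => q ^ 5) (fun q => q ^ k / (1 - q ^ k) ^ 2) P :=
    (Cong.refl hu (hc (continuous_pow k))).div (Cong.refl hu (hc (by fun_prop))) one_ne_zero
      ((by fun_prop : Continuous fun q : ℂ => (1 - q ^ k) ^ 2).tendsto' _ _ (by simp [hk]))
      (hc hP) (hc hR) h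
  have h1 := hdiv (k := 1) (by norm_num) (P := fun q => q + 2 * q ^ 2 + 3 * q ^ 3 + 4 * q ^ 4)
    (R := fun q => 5 - 4 * q) (by fun_prop) (by fun_prop) fun q => by ring
  have h2 := hdiv (k := 2) (by norm_num) (P := fun q => q ^ 2 + 2 * q ^ 4)
    (R := fun q => 3 * q - 2 * q ^ 3) (by fun_prop) (by fun_prop) fun q => by ring
  have h3 := hdiv (k := 3) (by norm_num) (P := fun q => q ^ 3)
    (R := fun q => 2 * q - q ^ 4) (by fun_prop) (by fun_prop) fun q => by ring
  have h4 := hdiv (k := 4) (by norm_num) (P := fun q => q ^ 4)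
    (R := fun q => 2 * q ^ 3 - q ^ 7) (by fun_prop) (by fun_prop) fun q => by ring
  have htail : (fun q : ℂ => ∑' n : ℕ, q ^ (n + 4 + 1) / (1 - q ^ (n + 4 + 1)) ^ 2) =O[𝓝 0]
      fun q => q ^ 5 := by
    refine Asymptotics.IsBigO.of_bound 8 ?_
    filter_upwards [Metric.ball_mem_nhds (0 : ℂ) (by norm_num : (0 : ℝ) < 1 / 2)] with q hq
    have hq' : ‖q‖ < 1 / 2 := by simpa using hq
    have hs : HasSum (fun n : ℕ => 4 * ‖q‖ ^ 5 * ‖q‖ ^ n) (4 * ‖q‖ ^ 5 * (1 - ‖q‖)⁻¹) :=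
      (hasSum_geometric_of_lt_one (norm_nonneg q) (by linarith)).mul_left _
    refine (tsum_of_norm_bounded hs fun n => ?_).trans ?_
    · refine (norm_eisenstein_term_le (by norm_num) hq'.le (n + 4)).trans (le_of_eq ?_)
      ring
    · have : (1 - ‖q‖)⁻¹ ≤ 2 := by
        rw [inv_le_comm₀ (by linarith) (by norm_num)]; linarith
      rw [norm_pow]
      nlinarith [pow_nonneg (norm_nonneg q) 5]
  have h5 : Cong (𝓝 0) (fun q : ℂ => q ^ 5)
      (fun q : ℂ => ∑' n : ℕ, q ^ (n + 4 + 1) / (1 - q ^ (n + 4 + 1)) ^ 2) fun _ => 0 :=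
    ⟨by simpa using htail, Asymptotics.isBigO_zero _ _, hu⟩
  have key := ((((h1.add h2).add h3).add h4).add h5).const_mul (-24) |>.const_add 1
  refine (key.congr_right (R := 0) (Asymptotics.isBigO_zero _ _) fun q => ?_).congr_left ?_
  · simp only [Pi.zero_apply]; ring
  filter_upwards [Metric.ball_mem_nhds (0 : ℂ) one_pos] with q hq
  have hq' : ‖q‖ < 1 := by simpa using hq
  have hs : Summable fun n : ℕ => q ^ (n + 1) / (1 - q ^ (n + 1)) ^ 2 :=
    .of_norm_bounded (((summable_nat_add_iff 1).2
      (summable_geometric_of_lt_one (norm_nonneg q) hq')).mul_left _)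
      (norm_eisenstein_term_le hq' le_rfl)
  rw [E₂, ← hs.sum_add_tsum_nat_add 4]
  simp only [sum_range_succ, sum_range_zero]
  ring

section Continuous

variable {E : Type*} [TopologicalSpace E] {e : E} {u q x y L P R S : E → ℂ}

/-- The first `n` factors give the expansion if `x q^n` is of the order of the error `u`. The witness
`R` is what `P` leaves out of their product, divided by `u`. -/
lemma cong_qPochInf_of_continuous (n : ℕ) (hu : Continuous u) (hq : Continuous q)
    (hx : Continuous x) (hu0 : u e = 0) (hq0 : q e = 0) (hS : Continuous S)
    (hxS : ∀ i, x i * q i ^ n = u i * S i) (hR : Continuous R)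
    (hPR : ∀ i, qPoch (x i) (q i) n = P i + u i * R i) :
    Cong (𝓝 e) u (fun i => qPochInf (x i) (q i)) P := by
  have hu' : Tendsto u (𝓝 e) (𝓝 0) := hu.tendsto' _ _ hu0
  have hq' : Tendsto q (𝓝 e) (𝓝 0) := hq.tendsto' _ _ hq0
  have h1 : Cong (𝓝 e) u (fun i => qPoch (x i) (q i) n) P := by
    refine (Cong.refl hu' ?_).congr_right (hR.isBigO_one_nhds e) hPR
    exact (by unfold qPoch; fun_prop : Continuous fun i => qPoch (x i) (q i) n).isBigO_one_nhds e
  have h2 : (fun i => x i * q i ^ n) =O[𝓝 e] u := by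
    simpa only [← hxS, mul_one] using (Asymptotics.isBigO_refl u (𝓝 e)).mul (hS.isBigO_one_nhds e)
  have h3 := h1.mul (cong_qPochInf_one hu' hq' h2)
  simp only [mul_one] at h3
  refine h3.congr_left ?_
  filter_upwards [hq'.norm.eventually_lt_const (by simp : ‖(0 : ℂ)‖ < 1)] with i hi
  exact (qPochInf_eq_qPoch_mul _ hi n).symm

/-- A form of `cong_qSum` whose side conditions are continuity statements and polynomial identities.
The witnesses `S` and `R` are the remainders of these identities, divided by the error `u`. -/
lemma cong_qSum_of_continuous {c : ℕ} (hc : 1 ≤ c) (hu : Continuous u) (hq : Continuous q)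
    (hx : Continuous x) (hy : Continuous y) (hL : Continuous L) (hu0 : u e = 0) (hq0 : q e = 0)
    (hx0 : x e = 0) (hy0 : y e = 0) (hS : Continuous S)
    (hLS : ∀ i, q i ^ (4 * c) * L i ^ 2 = u i * S i) (hP : Continuous P) (hR : Continuous R)
    (hPR : ∀ i, q i ^ c * L i = (1 - x i) ^ 2 * ((1 - y i) * (1 - y i * q i)) * P i + u i * R i) :
    Cong (𝓝 e) u (fun i => qSum c (q i) (L i) (x i) (y i)) fun i => 1 + P i := by
  refine cong_qSum hc (hu.tendsto' _ _ hu0) (hq.tendsto' _ _ hq0) (hx.tendsto' _ _ hx0)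
    (hy.tendsto' _ _ hy0) (hL.isBigO_one_nhds e) ?_ (hP.isBigO_one_nhds e) (hR.isBigO_one_nhds e) hPR
  simpa only [← hLS, mul_one] using (Asymptotics.isBigO_refl u (𝓝 e)).mul (hS.isBigO_one_nhds e)

lemma Cong.div_of_continuous {f D p d : E → ℂ} (hN : Cong (𝓝 e) u f p) (hD : Cong (𝓝 e) u D d)
    (hd : Continuous d) (hd0 : d e ≠ 0) (hP : Continuous P) (hR : Continuous R)
    (h : ∀ x, p x = d x * P x + u x * R x) : Cong (𝓝 e) u (fun x => f x / D x) P :=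
  hN.div hD hd0 (hd.tendsto e) (hP.isBigO_one_nhds e) (hR.isBigO_one_nhds e) h

end Continuous

/-- A form of `hasExpansion_of_isBigO` for a function that is only given away from the origin by a
function `G` which is holomorphic on the whole disc. -/
lemma hasExpansion_of_cong {H G P : ℂ → ℂ} {l : List ℂ} {N : ℕ} (hl : l.length ≤ N)
    (hHG : ∀ s : ℂ, 0 < ‖s‖ → ‖s‖ < 1 → H s = G s)
    (hG : ∀ s : ℂ, ‖s‖ < 1 → DifferentiableAt ℂ G s)
    (hP : ∀ s, P s = ∑ n ∈ range l.length, l.getD n 0 * s ^ n)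
    (hO : (fun s => G s - P s) =O[𝓝 0] fun s => s ^ N) : HasExpansion H l := by
  have hball : ∀ᶠ s : ℂ in 𝓝[≠] 0, H s = G s := by
    filter_upwards [self_mem_nhdsWithin, nhdsWithin_le_nhds (Metric.ball_mem_nhds (0 : ℂ) one_pos)]
      with s h0 h1
    exact hHG s (norm_pos_iff.2 h0) (by simpa using h1)
  refine hasExpansion_of_isBigO (fun s h0 h1 => ?_) ?_
  · refine (hG s h1).congr_of_eventuallyEq ?_
    filter_upwards [isOpen_ne.mem_nhds (norm_pos_iff.1 h0),
      Metric.isOpen_ball.mem_nhds (by simpa using h1 : s ∈ Metric.ball (0 : ℂ) 1)] with z hz0 hz1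
    exact hHG z (norm_pos_iff.2 hz0) (by simpa using hz1)
  · have h1 : (fun s : ℂ => s ^ N) =O[𝓝 0] fun s => s ^ l.length := by
      have := (Asymptotics.isBigO_refl (fun s : ℂ => s ^ l.length) (𝓝 0)).mul
        ((continuous_pow (N - l.length)).isBigO_one_nhds 0)
      simpa only [← pow_add, Nat.add_sub_cancel' hl, mul_one] using this
    refine ((hO.trans h1).mono nhdsWithin_le_nhds).congr' ?_ EventuallyEq.rfl
    filter_upwards [hball] with s hs
    rw [hs, hP]

/-- An expansion in powers of `q = s²` up to `q^N` is one in powers of `s` up to `s^(2N)`. -/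
lemma Cong.comp_sq {f P : ℂ → ℂ} {N : ℕ} (h : Cong (𝓝 0) (fun q => q ^ N) f P) :
    (fun s : ℂ => f (s ^ 2) - P (s ^ 2)) =O[𝓝 0] fun s => s ^ (2 * N) := by
  simpa only [pow_mul] using (h.comp (tendsto_pow_nhds_zero two_ne_zero)).err

lemma HasExpansion.comp_neg {H : ℂ → ℂ} {l l' : List ℂ} (h : HasExpansion H l)
    (hlen : l'.length = l.length)
    (hl : ∀ n < l.length, l'.getD n 0 = (-1) ^ n * l.getD n 0) : HasExpansion (fun s => H (-s)) l' := by
  obtain ⟨a, ha, hs⟩ := h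
  refine ⟨fun n => (-1) ^ n * a n, fun n hn => ?_, fun s h0 h1 => ?_⟩
  · have hn' : n < l.length := hlen ▸ hn
    have := hl n hn'
    rw [List.getD_eq_getElem _ _ hn, List.getD_eq_getElem _ _ hn'] at this
    beta_reduce
    rw [this, ha n hn']
  · refine (hs (-s) (by simpa using h0) (by simpa using h1)).congr_fun fun n => ?_
    rw [neg_pow s]; ring

lemma one_sub_ne_zero_of_norm_lt {z : ℂ} (h : ‖z‖ < 1) : 1 - z ≠ 0 := fun h0 => by
  rw [← sub_eq_zero.1 h0, norm_one] at h
  exact lt_irrefl _ h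

lemma norm_pow_lt_one {s : ℂ} (h : ‖s‖ < 1) {n : ℕ} (hn : n ≠ 0) : ‖s ^ n‖ < 1 := by
  rw [norm_pow]; exact pow_lt_one₀ (norm_nonneg _) h hn

/-! ### The expansions of `H₀`, `H₃`, `H₄` and `H₅` -/

lemma Fplus_zero_right {q : ℂ} (hq : ‖q‖ < 1) : Fplus q 0 = qSum 2 q q q q := by
  have := qPochInf_ne_zero_of_norm_lt hq hq
  rw [Fplus_eq]
  simp only [mul_zero, Complex.exp_zero, mul_one, one_pow, one_mul]
  field_simp

lemma Fminus_zero_right {q : ℂ} (hq : ‖q‖ < 1) : Fminus q 0 = qSum 1 q q q q := by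
  have := qPochInf_ne_zero_of_norm_lt hq hq
  rw [Fminus_eq]
  simp only [mul_zero, neg_zero, Complex.exp_zero, mul_one, one_pow, one_mul]
  field_simp

lemma hasExpansion_Hplus_zero : HasExpansion (fun s => Hplus s 0) (firstPlus 0) := by
  refine hasExpansion_of_cong (G := fun s => qSum 2 (s ^ 2) (s ^ 2) (s ^ 2) (s ^ 2)) (N := 2 * 7)
    (P := fun s => 1 + ((s ^ 2) ^ 3 + 3 * (s ^ 2) ^ 4 + 7 * (s ^ 2) ^ 5 + 13 * (s ^ 2) ^ 6))
    (by simp [firstPlus]) (fun s _ h => Fplus_zero_right (norm_pow_lt_one h two_ne_zero))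
    (fun s h => ?_) (fun s => ?_) ?_
  · have hq := norm_pow_lt_one h two_ne_zero
    have ha : AnalyticAt ℂ (fun s : ℂ => s ^ 2) s := by fun_prop
    exact (analyticAt_qSum one_le_two ha ha ha ha hq hq hq).differentiableAt
  · simp [firstPlus, sum_range_succ]; ring
  · refine Cong.comp_sq (f := fun q => qSum 2 q q q q)
      (P := fun q => 1 + (q ^ 3 + 3 * q ^ 4 + 7 * q ^ 5 + 13 * q ^ 6)) ?_
    refine cong_qSum_of_continuous (S := fun q => q ^ 3)
      (R := fun q => 22 - 32 * q - 8 * q ^ 2 + 32 * q ^ 3 - 13 * q ^ 4) one_le_two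
      (by fun_prop) (by fun_prop) (by fun_prop) (by fun_prop) (by fun_prop) (by simp) rfl rfl rfl
      (by fun_prop) (fun q => by ring) (by fun_prop) (by fun_prop) (fun q => by ring)

lemma hasExpansion_Hminus_zero : HasExpansion (fun s => Hminus s 0) (firstMinus 0) := by
  refine hasExpansion_of_cong (G := fun s => qSum 1 (s ^ 2) (s ^ 2) (s ^ 2) (s ^ 2)) (N := 2 * 6)
    (P := fun s => 1 + ((s ^ 2) ^ 2 + 3 * (s ^ 2) ^ 3 + 7 * (s ^ 2) ^ 4 + 13 * (s ^ 2) ^ 5))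
    (by simp [firstMinus]) (fun s _ h => Fminus_zero_right (norm_pow_lt_one h two_ne_zero))
    (fun s h => ?_) (fun s => ?_) ?_
  · have hq := norm_pow_lt_one h two_ne_zero
    have ha : AnalyticAt ℂ (fun s : ℂ => s ^ 2) s := by fun_prop
    exact (analyticAt_qSum le_rfl ha ha ha ha hq hq hq).differentiableAt
  · simp [firstMinus, sum_range_succ]; ring
  · refine Cong.comp_sq (f := fun q => qSum 1 q q q q)
      (P := fun q => 1 + (q ^ 2 + 3 * q ^ 3 + 7 * q ^ 4 + 13 * q ^ 5)) ?_
    refine cong_qSum_of_continuous (S := fun _ => 1)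
      (R := fun q => 22 - 32 * q - 8 * q ^ 2 + 32 * q ^ 3 - 13 * q ^ 4) le_rfl
      (by fun_prop) (by fun_prop) (by fun_prop) (by fun_prop) (by fun_prop) (by simp) rfl rfl rfl
      (by fun_prop) (fun q => by ring) (by fun_prop) (by fun_prop) (fun q => by ring)

lemma cong_qPochInf_self : Cong (𝓝 0) (fun q : ℂ => q ^ 5) (fun q => qPochInf q q)
    fun q => 1 - q - q ^ 2 :=
  cong_qPochInf_of_continuous 4 (S := fun _ => 1) (R := fun q => 2 - q ^ 3 - q ^ 4 + q ^ 5)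
    (by fun_prop) (by fun_prop) (by fun_prop) (by simp) rfl (by fun_prop) (fun q => by ring)
    (by fun_prop) fun q => by simp only [qPoch, prod_range_succ, prod_range_zero]; ring

lemma cong_qPochInf_neg_self : Cong (𝓝 0) (fun q : ℂ => q ^ 5) (fun q => qPochInf (-q) q)
    fun q => 1 + q + q ^ 2 + 2 * q ^ 3 + 2 * q ^ 4 :=
  cong_qPochInf_of_continuous 4 (S := fun _ => -1)
    (R := fun q => 2 + 2 * q + 2 * q ^ 2 + q ^ 3 + q ^ 4 + q ^ 5)
    (by fun_prop) (by fun_prop) (by fun_prop) (by simp) rfl (by fun_prop) (fun q => by ring)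
    (by fun_prop) fun q => by simp only [qPoch, prod_range_succ, prod_range_zero]; ring

lemma analyticAt_qPochInf_sq {s : ℂ} (hs : ‖s‖ < 1) {f : ℂ → ℂ} (hf : AnalyticAt ℂ f s) :
    AnalyticAt ℂ (fun s => qPochInf (f s) (s ^ 2)) s :=
  analyticAt_qPochInf hf (by fun_prop) (norm_pow_lt_one hs two_ne_zero)

lemma hasExpansion_Hplus_four : HasExpansion (fun s => Hplus s 4) (firstPlus 4) := by
  refine hasExpansion_of_cong (G := fun s => qPochInf (-s ^ 2) (s ^ 2) ^ 2 /
      qPochInf (s ^ 2) (s ^ 2) ^ 2 * qSum 2 (s ^ 2) (s ^ 2) (-s ^ 2) (s ^ 2)) (N := 2 * 5)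
    (P := fun s => 1 + 4 * s ^ 2 + 12 * (s ^ 2) ^ 2 + 33 * (s ^ 2) ^ 3 + 79 * (s ^ 2) ^ 4)
    (by simp [firstPlus]) (fun s _ h => Hplus_four s) (fun s h => ?_) (fun s => ?_) ?_
  · have hq := norm_pow_lt_one h two_ne_zero
    have hq' : ‖-s ^ 2‖ < 1 := by rwa [norm_neg]
    have ha : AnalyticAt ℂ (fun s : ℂ => s ^ 2) s := by fun_prop
    exact ((((analyticAt_qPochInf_sq h ha.fun_neg).pow 2).div ((analyticAt_qPochInf_sq h ha).pow 2)
      (pow_ne_zero _ (qPochInf_ne_zero_of_norm_lt hq hq))).mul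
      (analyticAt_qSum one_le_two ha ha ha.fun_neg ha hq hq' hq)).differentiableAt
  · simp [firstPlus, sum_range_succ]; ring
  · refine Cong.comp_sq (f := fun q => qPochInf (-q) q ^ 2 / qPochInf q q ^ 2 * qSum 2 q q (-q) q)
      (P := fun q => 1 + 4 * q + 12 * q ^ 2 + 33 * q ^ 3 + 79 * q ^ 4) ?_
    have hK : Cong (𝓝 0) (fun q : ℂ => q ^ 5) (fun q => qSum 2 q q (-q) q)
        fun q => 1 + (q ^ 3 - q ^ 4) :=
      cong_qSum_of_continuous (S := fun q => q ^ 5) (R := fun q => 3 - 3 * q ^ 2 + q ^ 4) one_le_two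
        (by fun_prop) (by fun_prop) (by fun_prop) (by fun_prop) (by fun_prop) (by simp) rfl (by simp)
        rfl (by fun_prop) (fun q => by ring) (by fun_prop) (by fun_prop) (fun q => by ring)
    have key := (cong_qPochInf_neg_self.sq.mul hK).div_of_continuous cong_qPochInf_self.sq
      (P := fun q => 1 + 4 * q + 12 * q ^ 2 + 33 * q ^ 3 + 79 * q ^ 4)
      (R := fun q => 172 + 12 * q - 180 * q ^ 2 - 76 * q ^ 3 - 4 * q ^ 6 - 4 * q ^ 7)
      (by fun_prop) (by simp) (by fun_prop) (by fun_prop) (fun q => by ring)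
    simpa only [div_mul_eq_mul_div] using key

lemma qPochInf_neg_one {q : ℂ} (hq : ‖q‖ < 1) : qPochInf (-1) q = 2 * qPochInf (-q) q := by
  rw [qPochInf_eq_one_sub_mul _ hq]
  congr 1
  · norm_num
  · congr 1; ring

lemma hasExpansion_Hminus_four : HasExpansion (fun s => Hminus s 4) (firstMinus 4) := by
  refine hasExpansion_of_cong (G := fun s => qPochInf (s ^ 2) (s ^ 2) ^ 2 /
      (2 * qPochInf (-s ^ 2) (s ^ 2)) ^ 2 * qSum 1 (s ^ 2) (s ^ 2) (-s ^ 2) (s ^ 2)) (N := 2 * 5)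
    (P := fun s => 1 / 4 - s ^ 2 + 5 / 4 * (s ^ 2) ^ 2 - 5 / 4 * (s ^ 2) ^ 3 + 15 / 4 * (s ^ 2) ^ 4)
    (by simp [firstMinus]) (fun s _ h => ?_) (fun s h => ?_) (fun s => ?_) ?_
  · rw [Hminus_four, qPochInf_neg_one (norm_pow_lt_one h two_ne_zero)]
  · have hq := norm_pow_lt_one h two_ne_zero
    have hq' : ‖-s ^ 2‖ < 1 := by rwa [norm_neg]
    have ha : AnalyticAt ℂ (fun s : ℂ => s ^ 2) s := by fun_prop
    exact ((((analyticAt_qPochInf_sq h ha).pow 2).div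
      ((analyticAt_const.mul (analyticAt_qPochInf_sq h ha.fun_neg)).pow 2)
      (pow_ne_zero _ (mul_ne_zero two_ne_zero (qPochInf_ne_zero_of_norm_lt hq hq')))).mul
      (analyticAt_qSum le_rfl ha ha ha.fun_neg ha hq hq' hq)).differentiableAt
  · simp [firstMinus, sum_range_succ]; ring
  · refine Cong.comp_sq
      (f := fun q => qPochInf q q ^ 2 / (2 * qPochInf (-q) q) ^ 2 * qSum 1 q q (-q) q)
      (P := fun q => 1 / 4 - q + 5 / 4 * q ^ 2 - 5 / 4 * q ^ 3 + 15 / 4 * q ^ 4) ?_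
    have hK : Cong (𝓝 0) (fun q : ℂ => q ^ 5) (fun q => qSum 1 q q (-q) q)
        fun q => 1 + (q ^ 2 - q ^ 3 + 3 * q ^ 4) :=
      cong_qSum_of_continuous (S := fun q => q)
        (R := fun q => -3 + 3 * q + 6 * q ^ 2 - 2 * q ^ 3 - 3 * q ^ 4) le_rfl
        (by fun_prop) (by fun_prop) (by fun_prop) (by fun_prop) (by fun_prop) (by simp) rfl (by simp)
        rfl (by fun_prop) (fun q => by ring) (by fun_prop) (by fun_prop) (fun q => by ring)
    have key := (cong_qPochInf_self.sq.mul hK).div_of_continuous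
      (cong_qPochInf_neg_self.const_mul 2).sq
      (P := fun q => 1 / 4 - q + 5 / 4 * q ^ 2 - 5 / 4 * q ^ 3 + 15 / 4 * q ^ 4)
      (R := fun q => -20 - 40 * q - 56 * q ^ 2 - 104 * q ^ 3 - 104 * q ^ 4 - 100 * q ^ 5 -
        100 * q ^ 6 - 60 * q ^ 7)
      (by fun_prop) (by simp) (by fun_prop) (by fun_prop) (fun q => by ring)
    simpa only [div_mul_eq_mul_div] using key

lemma hasExpansion_Hplus_three : HasExpansion (fun s => Hplus s 3) (firstPlus 3) := by
  refine hasExpansion_of_cong (G := fun s => s ^ 2 * (qPochInf (s ^ 3) (s ^ 2) ^ 2 *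
      qSum 2 (s ^ 2) ((s ^ 2) ^ 3) (s ^ 3) ((s ^ 2) ^ 2) /
      (qPochInf (s ^ 2) (s ^ 2) ^ 2 * (1 - s ^ 2)))) (N := 8)
    (P := fun s => s ^ 2 * (1 + 3 * s ^ 2 - 2 * s ^ 3 + 8 * s ^ 4 - 8 * s ^ 5))
    (by simp [firstPlus]) (fun s _ h => ?_) (fun s h => ?_) (fun s => ?_) ?_
  · rw [Hplus_three]; simp only [div_eq_mul_inv, mul_inv]; ring
  · have hq := norm_pow_lt_one h two_ne_zero
    have hq3 := norm_pow_lt_one h three_ne_zero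
    have ha : AnalyticAt ℂ (fun s : ℂ => s ^ 2) s := by fun_prop
    have ha3 : AnalyticAt ℂ (fun s : ℂ => s ^ 3) s := by fun_prop
    exact (ha.mul ((((analyticAt_qPochInf_sq h ha3).pow 2).mul
      (analyticAt_qSum one_le_two ha (ha.pow 3) ha3 (ha.pow 2) hq hq3
        (norm_pow_lt_one hq two_ne_zero))).div
      (((analyticAt_qPochInf_sq h ha).pow 2).mul (analyticAt_const.sub ha))
      (mul_ne_zero (pow_ne_zero _ (qPochInf_ne_zero_of_norm_lt hq hq))
        (one_sub_ne_zero_of_norm_lt hq)))).differentiableAt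
  · simp [firstPlus, sum_range_succ]; ring
  · have hA : Cong (𝓝 0) (fun s : ℂ => s ^ 6) (fun s => qPochInf (s ^ 3) (s ^ 2))
        fun s => (1 - s ^ 3) * (1 - s ^ 5) :=
      cong_qPochInf_of_continuous 2 (S := fun s => s) (R := fun _ => 0)
        (by fun_prop) (by fun_prop) (by fun_prop) (by simp) (by simp) (by fun_prop)
        (fun q => by ring) (by fun_prop) fun q => by
          simp only [qPoch, prod_range_succ, prod_range_zero]; ring
    have hQ : Cong (𝓝 0) (fun s : ℂ => s ^ 6) (fun s => qPochInf (s ^ 2) (s ^ 2))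
        fun s => (1 - s ^ 2) * (1 - s ^ 4) :=
      cong_qPochInf_of_continuous 2 (S := fun _ => 1) (R := fun _ => 0)
        (by fun_prop) (by fun_prop) (by fun_prop) (by simp) (by simp) (by fun_prop)
        (fun q => by ring) (by fun_prop) fun q => by
          simp only [qPoch, prod_range_succ, prod_range_zero]; ring
    have hK : Cong (𝓝 0) (fun s : ℂ => s ^ 6)
        (fun s => qSum 2 (s ^ 2) ((s ^ 2) ^ 3) (s ^ 3) ((s ^ 2) ^ 2)) fun s => 1 + 0 :=
      cong_qSum_of_continuous (S := fun s => s ^ 22) (R := fun s => s ^ 4) one_le_two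
        (by fun_prop) (by fun_prop) (by fun_prop) (by fun_prop) (by fun_prop) (by simp) (by simp)
        (by simp) (by simp) (by fun_prop) (fun q => by ring) (by fun_prop) (by fun_prop)
        (fun q => by ring)
    have h1 : Cong (𝓝 0) (fun s : ℂ => s ^ 6) (fun s : ℂ => 1 - s ^ 2) fun s => 1 - s ^ 2 :=
      Cong.refl hQ.small ((by fun_prop : Continuous fun s : ℂ => 1 - s ^ 2).isBigO_one_nhds 0)
    have key := (hA.sq.mul hK).div_of_continuous (hQ.sq.mul h1)
      (P := fun s => 1 + 3 * s ^ 2 - 2 * s ^ 3 + 8 * s ^ 4 - 8 * s ^ 5)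
      (R := fun s => 17 - 22 * s - 14 * s ^ 2 + 18 * s ^ 3 - 23 * s ^ 4 + 28 * s ^ 5 +
        40 * s ^ 6 - 44 * s ^ 7 - 2 * s ^ 9 - 20 * s ^ 10 + 22 * s ^ 11 + 8 * s ^ 12 - 8 * s ^ 13)
      (by fun_prop) (by simp) (by fun_prop) (by fun_prop) (fun q => by ring)
    refine ((Asymptotics.isBigO_refl (fun s : ℂ => s ^ 2) _).mul key.err).congr
      (fun s => by ring) fun s => by ring

lemma qPochInf_inv_left {s : ℂ} (h0 : 0 < ‖s‖) (h1 : ‖s‖ < 1) :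
    qPochInf s⁻¹ (s ^ 2) = -(1 - s) / s * qPochInf s (s ^ 2) := by
  have hs : s ≠ 0 := norm_pos_iff.1 h0
  rw [qPochInf_eq_one_sub_mul _ (norm_pow_lt_one h1 two_ne_zero),
    show s⁻¹ * s ^ 2 = s by field_simp]
  congr 1
  field_simp
  ring

lemma hasExpansion_Hminus_three : HasExpansion (fun s => Hminus s 3) (firstMinus 3) := by
  refine hasExpansion_of_cong (G := fun s => s ^ 2 * (qPochInf (s ^ 2) (s ^ 2) ^ 2 *
      qSum 1 (s ^ 2) ((s ^ 2) ^ 2) (s ^ 3) ((s ^ 2) ^ 2) /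
      (qPochInf s (s ^ 2) ^ 2 * ((1 - s) ^ 2 * (1 - s ^ 2))))) (N := 7)
    (P := fun s => s ^ 2 * (1 + 4 * s + 9 * s ^ 2 + 18 * s ^ 3 + 31 * s ^ 4))
    (by simp [firstMinus]) (fun s h0 h => ?_) (fun s h => ?_) (fun s => ?_) ?_
  · have hs : s ≠ 0 := norm_pos_iff.1 h0
    rw [Hminus_three, qPochInf_inv_left h0 h]
    simp only [div_eq_mul_inv, mul_inv, mul_pow, neg_sq, inv_pow, inv_inv, neg_mul]; ring
  · have hq := norm_pow_lt_one h two_ne_zero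
    have hq3 := norm_pow_lt_one h three_ne_zero
    have ha : AnalyticAt ℂ (fun s : ℂ => s ^ 2) s := by fun_prop
    have ha3 : AnalyticAt ℂ (fun s : ℂ => s ^ 3) s := by fun_prop
    exact (ha.mul ((((analyticAt_qPochInf_sq h ha).pow 2).mul
      (analyticAt_qSum le_rfl ha (ha.pow 2) ha3 (ha.pow 2) hq hq3
        (norm_pow_lt_one hq two_ne_zero))).div
      (((analyticAt_qPochInf_sq h analyticAt_id).pow 2).mul
        (((analyticAt_const.sub analyticAt_id).pow 2).mul (analyticAt_const.sub ha)))
      (mul_ne_zero (pow_ne_zero _ (qPochInf_ne_zero_of_norm_lt hq h))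
        (mul_ne_zero (pow_ne_zero _ (one_sub_ne_zero_of_norm_lt h))
        (one_sub_ne_zero_of_norm_lt hq))))).differentiableAt
  · simp [firstMinus, sum_range_succ]; ring
  · have hA : Cong (𝓝 0) (fun s : ℂ => s ^ 5) (fun s => qPochInf s (s ^ 2))
        fun s => (1 - s) * (1 - s ^ 3) :=
      cong_qPochInf_of_continuous 2 (S := fun _ => 1) (R := fun _ => 0)
        (by fun_prop) (by fun_prop) (by fun_prop) (by simp) (by simp) (by fun_prop)
        (fun q => by ring) (by fun_prop) fun q => by
          simp only [qPoch, prod_range_succ, prod_range_zero]; ring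
    have hQ : Cong (𝓝 0) (fun s : ℂ => s ^ 5) (fun s => qPochInf (s ^ 2) (s ^ 2))
        fun s => (1 - s ^ 2) * (1 - s ^ 4) :=
      cong_qPochInf_of_continuous 2 (S := fun s => s) (R := fun _ => 0)
        (by fun_prop) (by fun_prop) (by fun_prop) (by simp) (by simp) (by fun_prop)
        (fun q => by ring) (by fun_prop) fun q => by
          simp only [qPoch, prod_range_succ, prod_range_zero]; ring
    have hK : Cong (𝓝 0) (fun s : ℂ => s ^ 5)
        (fun s => qSum 1 (s ^ 2) ((s ^ 2) ^ 2) (s ^ 3) ((s ^ 2) ^ 2)) fun s => 1 + 0 :=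
      cong_qSum_of_continuous (S := fun s => s ^ 11) (R := fun s => s) le_rfl
        (by fun_prop) (by fun_prop) (by fun_prop) (by fun_prop) (by fun_prop) (by simp) (by simp)
        (by simp) (by simp) (by fun_prop) (fun q => by ring) (by fun_prop) (by fun_prop)
        (fun q => by ring)
    have h1 : Cong (𝓝 0) (fun s : ℂ => s ^ 5) (fun s : ℂ => (1 - s) ^ 2 * (1 - s ^ 2))
        fun s => (1 - s) ^ 2 * (1 - s ^ 2) :=
      Cong.refl hQ.small
        ((by fun_prop : Continuous fun s : ℂ => (1 - s) ^ 2 * (1 - s ^ 2)).isBigO_one_nhds 0)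
    have key := (hQ.sq.mul hK).div_of_continuous (hA.sq.mul h1)
      (P := fun s => 1 + 4 * s + 9 * s ^ 2 + 18 * s ^ 3 + 31 * s ^ 4)
      (R := fun s => 46 - 118 * s + 56 * s ^ 2 - 7 * s ^ 3 + 142 * s ^ 4 - 86 * s ^ 5 -
        134 * s ^ 6 + 88 * s ^ 7 - 4 * s ^ 8 + 92 * s ^ 9 - 106 * s ^ 10 + 31 * s ^ 11)
      (by fun_prop) (by simp) (by fun_prop) (by fun_prop) (fun q => by ring)
    refine ((Asymptotics.isBigO_refl (fun s : ℂ => s ^ 2) _).mul key.err).congr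
      (fun s => by ring) fun s => by ring

lemma hasExpansion_Hplus_five : HasExpansion (fun s => Hplus s 5) (firstPlus 5) := by
  simp only [Hplus_five]
  refine hasExpansion_Hplus_three.comp_neg rfl fun n hn => ?_
  have : n < 8 := hn
  interval_cases n <;> simp [firstPlus] <;> norm_num

lemma hasExpansion_Hminus_five : HasExpansion (fun s => Hminus s 5) (firstMinus 5) := by
  simp only [Hminus_five]
  refine hasExpansion_Hminus_three.comp_neg rfl fun n hn => ?_
  have : n < 7 := hn
  interval_cases n <;> simp [firstMinus] <;> norm_num

/-! ### The expansions of `H₁` and `H₂` -/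

lemma exp_two_mul_eq (z : ℂ) : exp (2 * z) = exp z ^ 2 := by
  rw [← Complex.exp_nat_mul]; norm_num

/-- The Taylor coefficients at `ε = 0` of a function which is congruent to a polynomial in `e^ε`,
uniformly in `ε`. -/
lemma Cong.jet_exp {F P : ℂ → ℂ → ℂ} {N : ℕ} {p : ℂ → Polynomial ℂ}
    (h : Cong (𝓝 (0, 0)) (fun x : ℂ × ℂ => x.1 ^ N) (fun x => F x.1 x.2)
      fun x => P x.1 (exp x.2))
    (hF : ∀ᶠ x : ℂ × ℂ in 𝓝 (0, 0), AnalyticAt ℂ (F x.1) x.2)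
    (hp : ∀ q z, P q z = (p q).eval z) {P₀ P₁ P₂ : ℂ → ℂ} (h0 : ∀ q, P q 1 = P₀ q)
    (h1 : ∀ q, (p q).derivative.eval 1 = P₁ q)
    (h2 : ∀ q, (Polynomial.X * (p q).derivative).derivative.eval 1 = P₂ q)
    (hb0 : Continuous P₀) (hb1 : Continuous P₁) (hb2 : Continuous P₂) :
    Cong (𝓝 0) (fun q => q ^ N) (fun q => F q 0) P₀ ∧
    Cong (𝓝 0) (fun q => q ^ N) (fun q => deriv (F q) 0) P₁ ∧
    Cong (𝓝 0) (fun q => q ^ N) (fun q => deriv (deriv (F q)) 0) P₂ := by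
  have hd (p : Polynomial ℂ) : deriv (fun ε => p.eval (exp ε)) =
      fun ε => (Polynomial.X * p.derivative).eval (exp ε) := by
    funext ε
    refine (HasDerivAt.comp ε (p.hasDerivAt (exp ε)) (Complex.hasDerivAt_exp ε)).deriv.trans ?_
    simp [mul_comm]
  have e (q : ℂ) : (fun ε => P q (exp ε)) = fun ε => (p q).eval (exp ε) := funext fun ε => hp _ _
  have key := Cong.jet (P := fun q ε => P q (exp ε)) (P₁ := P₁) (P₂ := P₂) h hF (fun x => ?_)
    (fun q => ?_) (fun q => ?_) ?_ hb1 hb2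
  · simpa only [Complex.exp_zero, h0] using key
  · rw [e]
    exact (p x.1).differentiable.analyticAt _ |>.comp analyticAt_cexp
  · rw [e, hd]; simp [← h1]
  · rw [e, hd, hd]; simp [← h2]
  · simpa only [Complex.exp_zero, h0] using hb0

section Jets

lemma eventually_norm_fst_mul_exp_lt (c : ℂ) {q₀ : ℂ} (hq : ‖q₀‖ < 1) :
    ∀ᶠ x : ℂ × ℂ in 𝓝 (q₀, 0), ‖x.1 * exp (c * x.2)‖ < 1 := by
  have h : Continuous fun x : ℂ × ℂ => ‖x.1 * exp (c * x.2)‖ := by fun_prop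
  exact (h.tendsto' (q₀, 0) ‖q₀‖ (by simp)).eventually_lt_const hq

/-- The Taylor coefficients in `ε` of `(q e^ε; q)_∞` modulo `q⁵`; the powers of `X = e^ε` in the
expansion come from the products of distinct factors `q^k e^ε`. -/
lemma jet_qPochInf :
    Cong (𝓝 0) (fun q : ℂ => q ^ 5) (fun q => qPochInf (q * exp 0) q) (fun q => 1 - q - q ^ 2) ∧
    Cong (𝓝 0) (fun q : ℂ => q ^ 5) (fun q => deriv (fun ε => qPochInf (q * exp ε) q) 0)
      (fun q => -q - q ^ 2 + q ^ 3 + q ^ 4) ∧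
    Cong (𝓝 0) (fun q : ℂ => q ^ 5) (fun q => deriv (deriv fun ε => qPochInf (q * exp ε) q) 0)
      (fun q => -q - q ^ 2 + 3 * q ^ 3 + 3 * q ^ 4) := by
  refine Cong.jet_exp (F := fun q ε => qPochInf (q * exp ε) q)
    (P := fun q X => 1 - q * X - q ^ 2 * X - q ^ 3 * X + q ^ 3 * X ^ 2 - q ^ 4 * X + q ^ 4 * X ^ 2)
    (p := fun q => 1 + .C (-q - q ^ 2 - q ^ 3 - q ^ 4) * .X + .C (q ^ 3 + q ^ 4) * .X ^ 2)
    ?_ ?_ (fun q z => ?_) (fun q => ?_) (fun q => ?_) (fun q => ?_)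
    (by fun_prop) (by fun_prop) (by fun_prop)
  · refine cong_qPochInf_of_continuous 4 (S := fun x => exp x.2)
      (R := fun x => 2 * exp x.2 ^ 2 + x.1 * exp x.2 ^ 2 - x.1 * exp x.2 ^ 3 +
        x.1 ^ 2 * exp x.2 ^ 2 - x.1 ^ 2 * exp x.2 ^ 3 - x.1 ^ 3 * exp x.2 ^ 3 -
        x.1 ^ 4 * exp x.2 ^ 3 + x.1 ^ 5 * exp x.2 ^ 4) (by fun_prop) (by fun_prop) (by fun_prop)
      (by simp) rfl (by fun_prop) (fun x => by ring) (by fun_prop) fun x => ?_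
    simp only [qPoch, prod_range_succ, prod_range_zero]; ring
  · filter_upwards [eventually_norm_fst_mul_exp_lt 0 (by simp : ‖(0 : ℂ)‖ < 1)] with x hx
    exact analyticAt_qPochInf (by fun_prop) analyticAt_const (by simpa using hx)
  · simp; ring
  · ring
  · simp [-map_pow]; ring
  · simp [-map_pow]; ring

lemma analyticAt_deformed_qSum {c : ℕ} (hc : 1 ≤ c) (k : ℕ) :
    ∀ᶠ x : ℂ × ℂ in 𝓝 (0, 0), AnalyticAt ℂ (fun ε => exp ε *
      qSum c x.1 (x.1 * exp ε ^ k) (x.1 * exp ε) (x.1 * exp (2 * ε))) x.2 := by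
  filter_upwards [eventually_norm_fst_mul_exp_lt 0 (by simp : ‖(0 : ℂ)‖ < 1),
    eventually_norm_fst_mul_exp_lt 1 (by simp : ‖(0 : ℂ)‖ < 1),
    eventually_norm_fst_mul_exp_lt 2 (by simp : ‖(0 : ℂ)‖ < 1)] with x h0 h1 h2
  exact analyticAt_cexp.mul (analyticAt_qSum hc analyticAt_const (by fun_prop) (by fun_prop)
    (by fun_prop) (by simpa using h0) (by simpa using h1) h2)

lemma jet_plus_qSum :
    Cong (𝓝 0) (fun q : ℂ => q ^ 5) (fun q => exp 0 *
      qSum 2 q (q * exp 0 ^ 4) (q * exp 0) (q * exp (2 * 0))) (fun q => 1 + q ^ 3 + 3 * q ^ 4) ∧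
    Cong (𝓝 0) (fun q : ℂ => q ^ 5) (fun q => deriv (fun ε => exp ε *
      qSum 2 q (q * exp ε ^ 4) (q * exp ε) (q * exp (2 * ε))) 0)
      (fun q => 1 + 5 * q ^ 3 + 19 * q ^ 4) ∧
    Cong (𝓝 0) (fun q : ℂ => q ^ 5) (fun q => deriv (deriv fun ε => exp ε *
      qSum 2 q (q * exp ε ^ 4) (q * exp ε) (q * exp (2 * ε))) 0)
      (fun q => 1 + 25 * q ^ 3 + 121 * q ^ 4) := by
  refine Cong.jet_exp (F := fun q ε => exp ε *
      qSum 2 q (q * exp ε ^ 4) (q * exp ε) (q * exp (2 * ε)))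
    (P := fun q X => X * (1 + (q ^ 3 * X ^ 4 + 2 * q ^ 4 * X ^ 5 + q ^ 4 * X ^ 6)))
    (p := fun q => .X + .C (q ^ 3) * .X ^ 5 + .C (2 * q ^ 4) * .X ^ 6 + .C (q ^ 4) * .X ^ 7)
    ?_ (analyticAt_deformed_qSum one_le_two 4) (fun q z => ?_) (fun q => ?_) (fun q => ?_)
    (fun q => ?_) (by fun_prop) (by fun_prop) (by fun_prop)
  · refine Cong.mul (Cong.refl ?_ ?_) (cong_qSum_of_continuous (S := fun x => x.1 ^ 5 * exp x.2 ^ 8)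
      (R := fun x => 4 * exp x.2 ^ 6 + 2 * exp x.2 ^ 7 + exp x.2 ^ 8 - 2 * x.1 * exp x.2 ^ 7 -
        4 * x.1 * exp x.2 ^ 8 - 2 * x.1 * exp x.2 ^ 9 - 3 * x.1 ^ 2 * exp x.2 ^ 8 +
        2 * x.1 ^ 3 * exp x.2 ^ 9 + 4 * x.1 ^ 3 * exp x.2 ^ 10 + 2 * x.1 ^ 3 * exp x.2 ^ 11 -
        2 * x.1 ^ 4 * exp x.2 ^ 11 - x.1 ^ 4 * exp x.2 ^ 12) one_le_two (by fun_prop) (by fun_prop)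
      (by fun_prop) (by fun_prop) (by fun_prop) (by simp) rfl (by simp) (by simp) (by fun_prop)
      (fun x => by ring) (by fun_prop) (by fun_prop) (fun x => by rw [exp_two_mul_eq]; ring))
    · exact Continuous.tendsto' (by fun_prop) _ _ (by simp)
    · exact Continuous.isBigO_one_nhds (by fun_prop) _
  · simp; ring
  · ring
  · simp [-map_pow]; ring
  · simp [-map_pow]; ring

lemma jet_minus_qSum :
    Cong (𝓝 0) (fun q : ℂ => q ^ 5) (fun q => exp 0 *
      qSum 1 q (q * exp 0 ^ 2) (q * exp 0) (q * exp (2 * 0)))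
      (fun q => 1 + q ^ 2 + 3 * q ^ 3 + 7 * q ^ 4) ∧
    Cong (𝓝 0) (fun q : ℂ => q ^ 5) (fun q => deriv (fun ε => exp ε *
      qSum 1 q (q * exp ε ^ 2) (q * exp ε) (q * exp (2 * ε))) 0)
      (fun q => 1 + 3 * q ^ 2 + 13 * q ^ 3 + 39 * q ^ 4) ∧
    Cong (𝓝 0) (fun q : ℂ => q ^ 5) (fun q => deriv (deriv fun ε => exp ε *
      qSum 1 q (q * exp ε ^ 2) (q * exp ε) (q * exp (2 * ε))) 0)
      (fun q => 1 + 9 * q ^ 2 + 57 * q ^ 3 + 221 * q ^ 4) := by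
  refine Cong.jet_exp (F := fun q ε => exp ε *
      qSum 1 q (q * exp ε ^ 2) (q * exp ε) (q * exp (2 * ε)))
    (P := fun q X => X * (1 + (q ^ 2 * X ^ 2 + 2 * q ^ 3 * X ^ 3 + q ^ 3 * X ^ 4 +
      4 * q ^ 4 * X ^ 4 + 2 * q ^ 4 * X ^ 5 + q ^ 4 * X ^ 6)))
    (p := fun q => .X + .C (q ^ 2) * .X ^ 3 + .C (2 * q ^ 3) * .X ^ 4 +
      .C (q ^ 3 + 4 * q ^ 4) * .X ^ 5 + .C (2 * q ^ 4) * .X ^ 6 + .C (q ^ 4) * .X ^ 7)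
    ?_ (analyticAt_deformed_qSum le_rfl 2) (fun q z => ?_) (fun q => ?_) (fun q => ?_)
    (fun q => ?_) (by fun_prop) (by fun_prop) (by fun_prop)
  · refine Cong.mul (Cong.refl ?_ ?_) (cong_qSum_of_continuous (S := fun x => x.1 * exp x.2 ^ 4)
      (R := fun x => 6 * exp x.2 ^ 5 + 4 * exp x.2 ^ 6 + 2 * exp x.2 ^ 7 + exp x.2 ^ 8 -
        3 * x.1 * exp x.2 ^ 6 - 8 * x.1 * exp x.2 ^ 7 - 4 * x.1 * exp x.2 ^ 8 -
        2 * x.1 * exp x.2 ^ 9 - 6 * x.1 ^ 2 * exp x.2 ^ 7 + 4 * x.1 ^ 3 * exp x.2 ^ 8 +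
        8 * x.1 ^ 3 * exp x.2 ^ 9 + 4 * x.1 ^ 3 * exp x.2 ^ 10 + 2 * x.1 ^ 3 * exp x.2 ^ 11 -
        4 * x.1 ^ 4 * exp x.2 ^ 10 - 2 * x.1 ^ 4 * exp x.2 ^ 11 - x.1 ^ 4 * exp x.2 ^ 12) le_rfl
      (by fun_prop) (by fun_prop) (by fun_prop) (by fun_prop) (by fun_prop) (by simp) rfl (by simp)
      (by simp) (by fun_prop) (fun x => by ring) (by fun_prop) (by fun_prop)
      (fun x => by rw [exp_two_mul_eq]; ring))
    · exact Continuous.tendsto' (by fun_prop) _ _ (by simp)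
    · exact Continuous.isBigO_one_nhds (by fun_prop) _
  · simp; ring
  · ring
  · simp [-map_pow]; ring
  · simp [-map_pow]; ring

lemma cong_logDeriv_qPochInf : Cong (𝓝 0) (fun q : ℂ => q ^ 5)
    (fun q => deriv (fun ε => qPochInf (q * exp ε) q) 0 / qPochInf (q * exp 0) q)
    fun q => -q - 2 * q ^ 2 - 2 * q ^ 3 - 3 * q ^ 4 :=
  jet_qPochInf.2.1.div_of_continuous jet_qPochInf.1 (R := fun q => -5 - 3 * q)
    (by fun_prop) (by simp) (by fun_prop) (by fun_prop) fun q => by ring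

lemma cong_deriv_deriv_div_qPochInf : Cong (𝓝 0) (fun q : ℂ => q ^ 5)
    (fun q => deriv (deriv fun ε => qPochInf (q * exp ε) q) 0 / qPochInf (q * exp 0) q)
    fun q => -q - 2 * q ^ 2 + q ^ 4 :=
  jet_qPochInf.2.2.div_of_continuous jet_qPochInf.1 (R := fun q => 1 + q)
    (by fun_prop) (by simp) (by fun_prop) (by fun_prop) fun q => by ring

end Jets

lemma deriv_deriv_sq_mul_comp_two {φ : ℂ → ℂ} (hφ : AnalyticAt ℂ φ 0) :
    AnalyticAt ℂ (fun ε => φ ε ^ 2 * φ (2 * ε)) 0 ∧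
    deriv (fun ε => φ ε ^ 2 * φ (2 * ε)) 0 = 4 * φ 0 ^ 2 * deriv φ 0 ∧
    deriv (deriv fun ε => φ ε ^ 2 * φ (2 * ε)) 0 =
      6 * φ 0 ^ 2 * deriv (deriv φ) 0 + 10 * φ 0 * deriv φ 0 ^ 2 := by
  have h2 : AnalyticAt ℂ (fun ε => φ (2 * ε)) 0 :=
    AnalyticAt.comp_of_eq hφ (f := fun z => 2 * z) (by fun_prop) (by simp)
  obtain ⟨d1, d1'⟩ := deriv_deriv_comp_mul_left 2 φ
  obtain ⟨d2, d2'⟩ := deriv_deriv_mul hφ hφ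
  obtain ⟨d3, d3'⟩ := deriv_deriv_mul (hφ.fun_mul hφ) h2
  simp only [← pow_two] at d2 d2' d3 d3'
  refine ⟨(hφ.fun_pow 2).fun_mul h2, ?_, ?_⟩
  · rw [d3, d2, d1, mul_zero]; ring
  · rw [d3', d2', d2, d1, d1', mul_zero]; ring

/-- The second-order jet of the deformation `φ(ε)² φ(2ε) / φ(0)³ · G(ε)`. -/
lemma deriv_deriv_plus {φ G : ℂ → ℂ} (hφ : AnalyticAt ℂ φ 0) (hG : AnalyticAt ℂ G 0)
    (h0 : φ 0 ≠ 0) :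
    deriv (fun ε => φ ε ^ 2 * φ (2 * ε) / φ 0 ^ 3 * G ε) 0 =
      deriv G 0 + 4 * (deriv φ 0 / φ 0) * G 0 ∧
    deriv (deriv fun ε => φ ε ^ 2 * φ (2 * ε) / φ 0 ^ 3 * G ε) 0 =
      deriv (deriv G) 0 + 8 * (deriv φ 0 / φ 0) * deriv G 0 +
        (6 * (deriv (deriv φ) 0 / φ 0) + 10 * (deriv φ 0 / φ 0) ^ 2) * G 0 := by
  obtain ⟨hu, d1, d2⟩ := deriv_deriv_sq_mul_comp_two hφ
  obtain ⟨d3, d4⟩ := deriv_deriv_mul hu hG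
  have e : (fun ε => φ ε ^ 2 * φ (2 * ε) / φ 0 ^ 3 * G ε) =
      fun ε => (φ 0 ^ 3)⁻¹ * (φ ε ^ 2 * φ (2 * ε) * G ε) := by
    funext ε; ring
  have e' : deriv (fun ε => (φ 0 ^ 3)⁻¹ * (φ ε ^ 2 * φ (2 * ε) * G ε)) =
      fun ε => (φ 0 ^ 3)⁻¹ * deriv (fun ε => φ ε ^ 2 * φ (2 * ε) * G ε) ε :=
    funext fun ε => deriv_const_mul_field _
  constructor
  · rw [e, e']; beta_reduce; rw [d3, d1, mul_zero]; field_simp; ring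
  · rw [e, e', deriv_const_mul_field, d4, d1, d2, mul_zero]; field_simp; ring

/-- The second-order jet of the deformation `φ(0)³ / (φ(-ε)² φ(-2ε)) · G(ε)`. -/
lemma deriv_deriv_minus {φ G : ℂ → ℂ} (hφ : AnalyticAt ℂ φ 0) (hG : AnalyticAt ℂ G 0)
    (h0 : φ 0 ≠ 0) :
    deriv (fun ε => φ 0 ^ 3 / (φ (-ε) ^ 2 * φ (-(2 * ε))) * G ε) 0 =
      deriv G 0 + 4 * (deriv φ 0 / φ 0) * G 0 ∧
    deriv (deriv fun ε => φ 0 ^ 3 / (φ (-ε) ^ 2 * φ (-(2 * ε))) * G ε) 0 =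
      deriv (deriv G) 0 + 8 * (deriv φ 0 / φ 0) * deriv G 0 +
        (22 * (deriv φ 0 / φ 0) ^ 2 - 6 * (deriv (deriv φ) 0 / φ 0)) * G 0 := by
  obtain ⟨hu, d1, d2⟩ := deriv_deriv_sq_mul_comp_two hφ
  set u : ℂ → ℂ := fun ε => φ ε ^ 2 * φ (2 * ε) with hu_def
  obtain ⟨d3, d4⟩ := deriv_deriv_comp_mul_left (-1) u
  have hD : AnalyticAt ℂ (fun ε => u (-1 * ε)) 0 :=
    AnalyticAt.comp_of_eq hu (f := fun z => -1 * z) (by fun_prop) (by simp)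
  have hu0 : u 0 = φ 0 ^ 3 := by simp only [hu_def, mul_zero]; ring
  have hD0 : u (-1 * 0) ≠ 0 := by rw [mul_zero, hu0]; exact pow_ne_zero _ h0
  have e : (fun ε => φ 0 ^ 3 / (φ (-ε) ^ 2 * φ (-(2 * ε))) * G ε) =
      fun ε => φ 0 ^ 3 * G ε / u (-1 * ε) := by
    funext ε
    rw [hu_def, neg_one_mul, div_mul_eq_mul_div]; beta_reduce; rw [mul_neg]
  have hf : AnalyticAt ℂ (fun ε => φ 0 ^ 3 * G ε / u (-1 * ε)) 0 :=
    (analyticAt_const.mul hG).div hD hD0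
  rw [e]
  obtain ⟨d5, d6⟩ := deriv_deriv_mul hf hD
  -- multiplying back by the denominator determines the jet of the quotient
  have hback : (fun ε => φ 0 ^ 3 * G ε / u (-1 * ε) * u (-1 * ε)) =ᶠ[𝓝 0]
      fun ε => φ 0 ^ 3 * G ε := by
    filter_upwards [hD.continuousAt.eventually_ne hD0] with ε hε
    exact div_mul_cancel₀ _ hε
  have e' : deriv (fun ε => φ 0 ^ 3 * G ε) = fun ε => φ 0 ^ 3 * deriv G ε :=
    funext fun ε => deriv_const_mul_field _
  rw [hback.deriv_eq, e', d3] at d5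
  rw [hback.deriv.deriv_eq, e', deriv_const_mul_field, d3, d4] at d6
  rw [d1, mul_zero, hu0] at d5
  rw [d1, d2, mul_zero, hu0] at d6
  set f : ℂ → ℂ := fun ε => φ 0 ^ 3 * G ε / u (-1 * ε)
  have r1 : deriv f 0 = deriv G 0 + 4 * (deriv φ 0 / φ 0) * G 0 := by
    have h3 : φ 0 ^ 3 ≠ 0 := pow_ne_zero _ h0
    refine mul_right_cancel₀ h3 ?_
    field_simp at d5 ⊢
    linear_combination -d5
  refine ⟨r1, ?_⟩
  rw [r1] at d6
  refine mul_right_cancel₀ (pow_ne_zero 3 h0) ?_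
  field_simp at d6 ⊢
  linear_combination -d6

lemma tendsto_mul_exp {q₀ : ℂ} {f : ℂ → ℂ} (hf : Continuous f) (h0 : f 0 = 0) :
    Tendsto (fun x : ℂ × ℂ => x.1 * exp (f x.2)) (𝓝 (q₀, 0)) (𝓝 q₀) :=
  Continuous.tendsto' (by fun_prop) _ _ (by simp [h0])

lemma holAt_Fplus {q₀ : ℂ} (hq : ‖q₀‖ < 1) : HolAt Fplus (q₀, 0) := by
  have t0 : Tendsto (fun x : ℂ × ℂ => x.1) (𝓝 (q₀, 0)) (𝓝 q₀) := continuous_fst.tendsto _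
  have t1 := tendsto_mul_exp (q₀ := q₀) (f := fun ε => ε) (by fun_prop) rfl
  have t2 := tendsto_mul_exp (q₀ := q₀) (f := fun ε => 2 * ε) (by fun_prop) (by simp)
  have hb : (fun x : ℂ × ℂ => Fplus x.1 x.2) =O[𝓝 (q₀, 0)] fun _ => (1 : ℂ) := by
    have h3 : (fun x : ℂ × ℂ => x.1 * exp x.2 ^ 4) =O[𝓝 (q₀, 0)] fun _ => (1 : ℂ) :=
      Continuous.isBigO_one_nhds (by fun_prop) _
    have h4 : (fun x : ℂ × ℂ => exp x.2) =O[𝓝 (q₀, 0)] fun _ => (1 : ℂ) :=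
      Continuous.isBigO_one_nhds (by fun_prop) _
    have := ((((isBigO_qPochInf_one t0 hq t1).pow 2).mul (isBigO_qPochInf_one t0 hq t2)).mul
      ((isBigO_inv_qPochInf_one t0 hq t0 hq).pow 3)).mul (h4.mul
      (isBigO_qSum_one one_le_two t0 hq t1 hq t2 hq h3))
    simpa only [Fplus_eq, div_eq_mul_inv, inv_pow, one_pow, mul_one] using this
  obtain ⟨C, hC⟩ := hb.bound
  refine ⟨C, ?_⟩
  filter_upwards [hC, t0.norm.eventually_lt_const hq, t1.norm.eventually_lt_const hq,
    t2.norm.eventually_lt_const hq] with x hx h0 h1 h2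
  rw [norm_one, mul_one] at hx
  exact ⟨hx, (analyticAt_Fplus analyticAt_const analyticAt_id h0 h1 h2).differentiableAt,
    (analyticAt_Fplus analyticAt_id analyticAt_const h0 h1 h2).differentiableAt⟩

lemma holAt_Fminus {q₀ : ℂ} (hq : ‖q₀‖ < 1) : HolAt Fminus (q₀, 0) := by
  have t0 : Tendsto (fun x : ℂ × ℂ => x.1) (𝓝 (q₀, 0)) (𝓝 q₀) := continuous_fst.tendsto _
  have t1 := tendsto_mul_exp (q₀ := q₀) (f := fun ε => ε) (by fun_prop) rfl
  have t2 := tendsto_mul_exp (q₀ := q₀) (f := fun ε => 2 * ε) (by fun_prop) (by simp)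
  have t3 := tendsto_mul_exp (q₀ := q₀) (f := fun ε => -ε) (by fun_prop) (by simp)
  have t4 := tendsto_mul_exp (q₀ := q₀) (f := fun ε => -(2 * ε)) (by fun_prop) (by simp)
  have hb : (fun x : ℂ × ℂ => Fminus x.1 x.2) =O[𝓝 (q₀, 0)] fun _ => (1 : ℂ) := by
    have h3 : (fun x : ℂ × ℂ => x.1 * exp x.2 ^ 2) =O[𝓝 (q₀, 0)] fun _ => (1 : ℂ) :=
      Continuous.isBigO_one_nhds (by fun_prop) _
    have h4 : (fun x : ℂ × ℂ => exp x.2) =O[𝓝 (q₀, 0)] fun _ => (1 : ℂ) :=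
      Continuous.isBigO_one_nhds (by fun_prop) _
    have := (((isBigO_qPochInf_one t0 hq t0).pow 3).mul
      (((isBigO_inv_qPochInf_one t0 hq t3 hq).pow 2).mul
        (isBigO_inv_qPochInf_one t0 hq t4 hq))).mul (h4.mul
      (isBigO_qSum_one le_rfl t0 hq t1 hq t2 hq h3))
    simpa only [Fminus_eq, div_eq_mul_inv, mul_inv, inv_pow, one_pow, mul_one] using this
  obtain ⟨C, hC⟩ := hb.bound
  refine ⟨C, ?_⟩
  filter_upwards [hC, t0.norm.eventually_lt_const hq, t1.norm.eventually_lt_const hq,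
    t2.norm.eventually_lt_const hq, t3.norm.eventually_lt_const hq,
    t4.norm.eventually_lt_const hq] with x hx h0 h1 h2 h3 h4
  rw [norm_one, mul_one] at hx
  exact ⟨hx, (analyticAt_Fminus analyticAt_const analyticAt_id h0 h1 h2 h3 h4).differentiableAt,
    (analyticAt_Fminus analyticAt_id analyticAt_const h0 h1 h2 h3 h4).differentiableAt⟩

/-- The hypotheses of the jet computations, and the agreement of `qPochInf (q e^ε) q` with
`qPochInf q q` at `ε = 0`. -/
lemma analyticAt_deformed_qPochInf {q : ℂ} (hq : ‖q‖ < 1) :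
    AnalyticAt ℂ (fun ε => qPochInf (q * exp ε) q) 0 ∧ qPochInf (q * exp 0) q ≠ 0 := by
  refine ⟨analyticAt_qPochInf (by fun_prop) analyticAt_const hq, ?_⟩
  rw [Complex.exp_zero, mul_one]
  exact qPochInf_ne_zero_of_norm_lt hq hq

/-- The expansions of `H₁⁺` and `H₂⁺`, written as derivatives in `ε`. -/
lemma cong_deriv_Fplus :
    Cong (𝓝 0) (fun q : ℂ => q ^ 5) (fun q => deriv (Fplus q) 0)
      (fun q => 1 - 4 * q - 8 * q ^ 2 - 3 * q ^ 3 + 3 * q ^ 4) ∧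
    Cong (𝓝 0) (fun q : ℂ => q ^ 5)
      (fun q => deriv (deriv (Fplus q)) 0 - 1 / 3 * E₂ q * Fplus q 0)
      (fun q => 2 / 3 - 6 * q + 6 * q ^ 2 + 242 / 3 * q ^ 3 + 200 * q ^ 4) := by
  have hFeq (q : ℂ) : Fplus q = fun ε => qPochInf (q * exp ε) q ^ 2 *
      qPochInf (q * exp (2 * ε)) q / qPochInf (q * exp 0) q ^ 3 *
      (exp ε * qSum 2 q (q * exp ε ^ 4) (q * exp ε) (q * exp (2 * ε))) := by
    funext ε
    rw [Fplus_eq, Complex.exp_zero, mul_one]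
  have hsmall : ∀ᶠ q : ℂ in 𝓝 0, ‖q‖ < 1 := by
    filter_upwards [Metric.ball_mem_nhds (0 : ℂ) one_pos] with q hq using by simpa using hq
  have hG : ∀ᶠ q : ℂ in 𝓝 0, AnalyticAt ℂ (fun ε => exp ε *
      qSum 2 q (q * exp ε ^ 4) (q * exp ε) (q * exp (2 * ε))) 0 :=
    ((continuous_id.prodMk continuous_const).tendsto' 0 ((0 : ℂ), (0 : ℂ)) rfl).eventually
      (analyticAt_deformed_qSum one_le_two 4)
  have a := cong_logDeriv_qPochInf
  have b := cong_deriv_deriv_div_qPochInf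
  obtain ⟨g0, g1, g2⟩ := jet_plus_qSum
  constructor
  · refine ((g1.add ((a.const_mul 4).mul g0)).congr_right (R := fun q => -20 - 32 * q - 36 * q ^ 2 -
      36 * q ^ 3) (Continuous.isBigO_one_nhds (by fun_prop) _) fun q => by ring).congr_left ?_
    filter_upwards [hsmall, hG] with q hq hGq
    obtain ⟨h1, h2⟩ := analyticAt_deformed_qPochInf hq
    rw [hFeq, (deriv_deriv_plus h1 hGq h2).1]
  · refine (((((g2.add ((a.const_mul 8).mul g1)).add
      (((b.const_mul 6).add (a.sq.const_mul 10)).mul g0))).sub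
      ((cong_E₂.const_mul (1 / 3)).mul g0)).congr_right (R := fun q => -64 - 86 * q + 54 * q ^ 2 +
      200 * q ^ 3 + 580 * q ^ 4 + 600 * q ^ 5 + 450 * q ^ 6 + 270 * q ^ 7)
      (Continuous.isBigO_one_nhds (by fun_prop) _) fun q => by ring).congr_left ?_
    filter_upwards [hsmall, hG] with q hq hGq
    obtain ⟨h1, h2⟩ := analyticAt_deformed_qPochInf hq
    rw [show Fplus q 0 = exp 0 * qSum 2 q (q * exp 0 ^ 4) (q * exp 0) (q * exp (2 * 0)) by
      rw [Fplus_zero_right hq]; simp, hFeq, (deriv_deriv_plus h1 hGq h2).2]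

/-- The expansions of `H₁⁻` and `H₂⁻`, written as derivatives in `ε`. -/
lemma cong_deriv_Fminus :
    Cong (𝓝 0) (fun q : ℂ => q ^ 5) (fun q => deriv (Fminus q) 0)
      (fun q => 1 - 4 * q - 5 * q ^ 2 + q ^ 3 + 7 * q ^ 4) ∧
    Cong (𝓝 0) (fun q : ℂ => q ^ 5)
      (fun q => deriv (deriv (Fminus q)) 0 - (1 / 2 - 1 / 3 * E₂ q) * Fminus q 0)
      (fun q => 5 / 6 - 10 * q + 17 / 6 * q ^ 2 + 141 / 2 * q ^ 3 + 971 / 6 * q ^ 4) := by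
  have hFeq (q : ℂ) : Fminus q = fun ε => qPochInf (q * exp 0) q ^ 3 /
      (qPochInf (q * exp (-ε)) q ^ 2 * qPochInf (q * exp (-(2 * ε))) q) *
      (exp ε * qSum 1 q (q * exp ε ^ 2) (q * exp ε) (q * exp (2 * ε))) := by
    funext ε
    rw [Fminus_eq, Complex.exp_zero, mul_one]
  have hsmall : ∀ᶠ q : ℂ in 𝓝 0, ‖q‖ < 1 := by
    filter_upwards [Metric.ball_mem_nhds (0 : ℂ) one_pos] with q hq using by simpa using hq
  have hG : ∀ᶠ q : ℂ in 𝓝 0, AnalyticAt ℂ (fun ε => exp ε *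
      qSum 1 q (q * exp ε ^ 2) (q * exp ε) (q * exp (2 * ε))) 0 :=
    ((continuous_id.prodMk continuous_const).tendsto' 0 ((0 : ℂ), (0 : ℂ)) rfl).eventually
      (analyticAt_deformed_qSum le_rfl 2)
  have a := cong_logDeriv_qPochInf
  have b := cong_deriv_deriv_div_qPochInf
  obtain ⟨g0, g1, g2⟩ := jet_minus_qSum
  have hE : Cong (𝓝 0) (fun q : ℂ => q ^ 5) (fun q => 1 / 2 - 1 / 3 * E₂ q)
      fun q => 1 / 2 - 1 / 3 * (1 - 24 * q - 72 * q ^ 2 - 96 * q ^ 3 - 168 * q ^ 4) := by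
    simpa only [neg_mul, ← sub_eq_add_neg] using (cong_E₂.const_mul (-(1 / 3))).const_add (1 / 2)
  constructor
  · refine ((g1.add ((a.const_mul 4).mul g0)).congr_right (R := fun q => -60 - 92 * q - 92 * q ^ 2 -
      84 * q ^ 3) (Continuous.isBigO_one_nhds (by fun_prop) _) fun q => by ring).congr_left ?_
    filter_upwards [hsmall, hG] with q hq hGq
    obtain ⟨h1, h2⟩ := analyticAt_deformed_qPochInf hq
    rw [hFeq, (deriv_deriv_minus h1 hGq h2).1]
  · refine (((((g2.add ((a.const_mul 8).mul g1)).add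
      (((a.sq.const_mul 22).sub (b.const_mul 6)).mul g0))).sub
      (hE.mul g0)).congr_right (R := fun q => -188 - 200 * q + 370 * q ^ 2 +
      1336 * q ^ 3 + 3476 * q ^ 4 + 3454 * q ^ 5 + 2442 * q ^ 6 + 1386 * q ^ 7)
      (Continuous.isBigO_one_nhds (by fun_prop) _) fun q => by ring).congr_left ?_
    filter_upwards [hsmall, hG] with q hq hGq
    obtain ⟨h1, h2⟩ := analyticAt_deformed_qPochInf hq
    rw [show Fminus q 0 = exp 0 * qSum 1 q (q * exp 0 ^ 2) (q * exp 0) (q * exp (2 * 0)) by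
      rw [Fminus_zero_right hq]; simp, hFeq, (deriv_deriv_minus h1 hGq h2).2]

/-- Expansions in `q` up to `q^5` of a function that is holomorphic on the disc in `q`. -/
lemma hasExpansion_comp_sq {H f P : ℂ → ℂ} {l : List ℂ} (hl : l.length ≤ 2 * 5)
    (hH : ∀ s, H s = f (s ^ 2)) (hf : ∀ q : ℂ, ‖q‖ < 1 → DifferentiableAt ℂ f q)
    (h : Cong (𝓝 0) (fun q => q ^ 5) f P)
    (hP : ∀ s, P (s ^ 2) = ∑ n ∈ range l.length, l.getD n 0 * s ^ n) : HasExpansion H l :=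
  hasExpansion_of_cong hl (fun s _ _ => hH s) (fun s hs =>
    (hf _ (norm_pow_lt_one hs two_ne_zero)).fun_comp' s (differentiableAt_pow 2)) hP h.comp_sq

lemma hasExpansion_Hplus_one : HasExpansion (fun s => Hplus s 1) (firstPlus 1) :=
  hasExpansion_comp_sq (by simp [firstPlus]) (fun s => rfl)
    (fun q hq => (holAt_Fplus hq).differentiableAt_deriv) cong_deriv_Fplus.1
    fun s => by simp [firstPlus, sum_range_succ]; ring

lemma hasExpansion_Hminus_one : HasExpansion (fun s => Hminus s 1) (firstMinus 1) :=
  hasExpansion_comp_sq (by simp [firstMinus]) (fun s => rfl)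
    (fun q hq => (holAt_Fminus hq).differentiableAt_deriv) cong_deriv_Fminus.1
    fun s => by simp [firstMinus, sum_range_succ]; ring

lemma hasExpansion_Hplus_two : HasExpansion (fun s => Hplus s 2) (firstPlus 2) := by
  refine hasExpansion_comp_sq (by simp [firstPlus])
    (fun s => by rw [← iteratedDeriv_two_eq]; rfl) (fun q hq => ?_) cong_deriv_Fplus.2
    fun s => by simp [firstPlus, sum_range_succ]; ring
  exact (holAt_Fplus hq).deriv.differentiableAt_deriv.fun_sub
    (((differentiableAt_E₂ hq).const_mul _).fun_mul
      (analyticAt_Fplus analyticAt_id analyticAt_const hq (by simpa) (by simpa)).differentiableAt)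

lemma hasExpansion_Hminus_two : HasExpansion (fun s => Hminus s 2) (firstMinus 2) := by
  refine hasExpansion_comp_sq (by simp [firstMinus])
    (fun s => by rw [← iteratedDeriv_two_eq]; rfl) (fun q hq => ?_) cong_deriv_Fminus.2
    fun s => by simp [firstMinus, sum_range_succ]; ring
  exact (holAt_Fminus hq).deriv.differentiableAt_deriv.fun_sub
    ((((differentiableAt_E₂ hq).const_mul _).const_sub _).fun_mul
      (analyticAt_Fminus analyticAt_id analyticAt_const hq (by simpa) (by simpa) (by simpa)
        (by simpa)).differentiableAt)

end PretzelKnot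

end

theorem mainTheorem3 :
    (∀ τ : ℂ, τ.im ≠ 0 → ∀ ε : ℝ, 0 < ε → ε < (bOf τ + (bOf τ)⁻¹).re / 4 →
      Integrable (fun t : ℝ => integrand τ (contour τ ε t)) ∧
      2 * exp (Real.pi * I / 4) * qRatioPow τ (1 / 24) * stateIntegral ε τ =
        -(1 / (2 * τ)) * (h 0 τ * h 2 τ⁻¹) - h 1 τ * h 1 τ⁻¹ - τ / 2 * (h 2 τ * h 0 τ⁻¹) +
          (if 0 < τ.im then
            1 / τ * (h 3 τ * h 4 τ⁻¹ - h 4 τ * h 3 τ⁻¹ + h 5 τ * h 5 τ⁻¹)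
          else
            τ * (h 4 τ * h 3 τ⁻¹ - h 3 τ * h 4 τ⁻¹ + h 5 τ * h 5 τ⁻¹))) ∧
    (∀ j : Fin 6, HasExpansion (fun s => Hplus s j) (firstPlus j) ∧
      HasExpansion (fun s => Hminus s j) (firstMinus j)) := by
  refine ⟨fun τ hτ ε h0 h1 => stateIntegral_factorization hτ h0 h1, fun j => ?_⟩
  fin_cases j
  · exact ⟨hasExpansion_Hplus_zero, hasExpansion_Hminus_zero⟩
  · exact ⟨hasExpansion_Hplus_one, hasExpansion_Hminus_one⟩
  · exact ⟨hasExpansion_Hplus_two, hasExpansion_Hminus_two⟩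
  · exact ⟨hasExpansion_Hplus_three, hasExpansion_Hminus_three⟩
  · exact ⟨hasExpansion_Hplus_four, hasExpansion_Hminus_four⟩
  · exact ⟨hasExpansion_Hplus_five, hasExpansion_Hminus_five⟩
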